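/- Let $Y$ be a nonempty complex manifold, $L$ a holomorphic line bundle on $Y$, and $Z\subset Y$ a compact complex submanifold. Let $\vartheta: TY\to L$ be a nowhere vanishing $L$-valued 1-form, i.e. a surjective holomorphic homomorphism of vector bundles, and let $\mathrm{Ker}(\vartheta)\subset TY$ be the distribution of corank 1 that it defines. For $y\in Y$, let $\mathrm{Levi}_y:\wedge^2\mathrm{Ker}(\vartheta_y)\to T_yY/\mathrm{Ker}(\vartheta_y)$ be the Levi tensor of $\mathrm{Ker}(\vartheta)$, induced by the Lie brackets of local holomorphic sections of $\mathrm{Ker}(\vartheta)$, and let $$N_y:=\{v\in\mathrm{Ker}(\vartheta_y) : \mathrm{Levi}_y(v,u)=0\ \text{ for all } u\in\mathrm{Ker}(\vartheta_y)\}$$ be its null space. Assume that 1. for some integer $k\ge 0$, $\dim N_y=k$ for all $y\in Y$; and 2. $N_y\cap T_yZ=0$ for all $y\in Z$. Then there exist an open neighborhood $O\subset Y$ of $Z$, a complex manifold $X$ of dimension $\dim Y-k$ with a contact structure $D\subset TX$, and a surjective holomorphic submersion $\nu:O\to X$ such that for all $y\in O$ $$\mathrm{Ker}(\vartheta_y)=(\mathrm{d}_y\nu)^{-1}(D_{\nu(y)})\qquad\text{and}\qquad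 \mathrm{Ker}(\mathrm{d}_y\nu)=N_y .$$ Here a contact structure on $X$ is a distribution of the form $D=\mathrm{Ker}(\eta)$, where $\eta:TX\to L'$ is a nowhere vanishing holomorphic 1-form with values in a line bundle $L'$ on $X$ such that, for every $x\in X$, the form $\mathrm{d}_x\eta(u,v):=\mathrm{d}\check\eta(u,v)\cdot l_x$ on $\mathrm{Ker}(\eta_x)$ is nondegenerate; here $\eta=\check\eta\otimes l$ near $x$ for a 1-form $\check\eta$ and a local section $l$ of $L'$ with $l_x\ne 0$ (the form does not depend on $l$). Complex manifolds are Hausdorff, and $X$ is moreover second countable. -/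

import Mathlib

open Bundle Manifold
open scoped ContDiff Topology

universe uY

noncomputable section

/-! Complex manifolds are `ω`-manifolds over `ℂ`, without boundary, modelled on a finite-dimensional
complex normed space `E`. A line bundle is a holomorphic vector bundle with model fibre `ℂ`.
A (not necessarily regular) family of tangent subspaces is a function
`D : ∀ y, Submodule ℂ (TangentSpace 𝓘(ℂ, E) y)`. -/

section LineBundleValuedForms

variable {E : Type*} [NormedAddCommGroup E] [NormedSpace ℂ E]
  {M : Type*} [TopologicalSpace M] [ChartedSpace E M] [IsManifold 𝓘(ℂ, E) ω M]
  {L : M → Type*} [TopologicalSpace (TotalSpace ℂ L)] [∀ y, TopologicalSpace (L y)]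
  [∀ y, AddCommGroup (L y)] [∀ y, Module ℂ (L y)]
  [FiberBundle ℂ L] [VectorBundle ℂ ℂ L]

/-- A nowhere vanishing holomorphic `L`-valued 1-form: a holomorphic homomorphism `TM → L` of vector
bundles (a holomorphic section of `Hom(TM, L)`) that is surjective on every fibre. -/
structure IsNowhereVanishingForm [∀ y, IsTopologicalAddGroup (L y)]
    [∀ y, ContinuousSMul ℂ (L y)]
    (ϑ : ∀ y : M, TangentSpace 𝓘(ℂ, E) y →L[ℂ] L y) : Prop where
  holomorphic : ContMDiff 𝓘(ℂ, E) (𝓘(ℂ, E).prod 𝓘(ℂ, E →L[ℂ] ℂ)) ω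
    (fun y => TotalSpace.mk' (E →L[ℂ] ℂ)
      (E := fun y => TangentSpace 𝓘(ℂ, E) y →L[ℂ] L y) y (ϑ y))
  surjective : ∀ y, Function.Surjective (ϑ y)

/-- The distribution `Ker ϑ`. -/
def kerForm (ϑ : ∀ y : M, TangentSpace 𝓘(ℂ, E) y →L[ℂ] L y) (y : M) :
    Submodule ℂ (TangentSpace 𝓘(ℂ, E) y) :=
  LinearMap.ker (ϑ y).toLinearMap

/-- The scalar 1-form `θ` with `ϑ = θ ⊗ l` near `x`, read in the preferred chart at `x`. Here `l` is
the nowhere zero local section of `L` that is constantly `1` in the preferred trivialization of `L`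
at `x`. (Meaningful on the points of the chart that lie over the base set of this
trivialization.) -/
def localForm (ϑ : ∀ y : M, TangentSpace 𝓘(ℂ, E) y →L[ℂ] L y) (x : M) (p : E) : E →L[ℂ] ℂ :=
  ((trivializationAt ℂ L x).continuousLinearMapAt ℂ ((extChartAt 𝓘(ℂ, E) x).symm p)).comp
    ((ϑ ((extChartAt 𝓘(ℂ, E) x).symm p)).comp
      (mfderiv 𝓘(ℂ, E) 𝓘(ℂ, E) (extChartAt 𝓘(ℂ, E) x).symm p))

/-- `d_x ϑ (u, v) = dθ (u, v) · l_x`, where `ϑ = θ ⊗ l` near `x` and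
`dθ (u, v) = (∂_u θ)(v) - (∂_v θ)(u)` in a chart. Only its values on `Ker ϑ_x` are used: these do
not depend on the choice of `l`. -/
def dForm (ϑ : ∀ y : M, TangentSpace 𝓘(ℂ, E) y →L[ℂ] L y) (x : M)
    (u v : TangentSpace 𝓘(ℂ, E) x) : L x :=
  let A : E →L[ℂ] E →L[ℂ] ℂ := fderiv ℂ (localForm ϑ x) (extChartAt 𝓘(ℂ, E) x x)
  let u' : E := mfderiv 𝓘(ℂ, E) 𝓘(ℂ, E) (extChartAt 𝓘(ℂ, E) x) x u
  let v' : E := mfderiv 𝓘(ℂ, E) 𝓘(ℂ, E) (extChartAt 𝓘(ℂ, E) x) x v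
  (trivializationAt ℂ L x).symm x (A u' v' - A v' u')

/-- A contact form: a nowhere vanishing `L`-valued form `ϑ` such that
`Null(d_x ϑ) = {v ∈ Ker ϑ_x | d_x ϑ (u, v) = 0 for all u ∈ Ker ϑ_x}` is zero for all `x`. -/
structure IsContactForm [∀ y, IsTopologicalAddGroup (L y)] [∀ y, ContinuousSMul ℂ (L y)]
    (ϑ : ∀ y : M, TangentSpace 𝓘(ℂ, E) y →L[ℂ] L y) : Prop where
  nowhereVanishing : IsNowhereVanishingForm ϑ
  nondegenerate : ∀ x, ∀ v ∈ kerForm ϑ x, (∀ u ∈ kerForm ϑ x, dForm ϑ x u v = 0) → v = 0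

end LineBundleValuedForms

/-- A contact structure: the kernel of a contact form with values in some line bundle. -/
def IsContactStructure {E : Type*} [NormedAddCommGroup E] [NormedSpace ℂ E]
    {M : Type*} [TopologicalSpace M] [ChartedSpace E M] [IsManifold 𝓘(ℂ, E) ω M]
    (D : ∀ x : M, Submodule ℂ (TangentSpace 𝓘(ℂ, E) x)) : Prop :=
  ∃ (L : M → Type) (_ : TopologicalSpace (TotalSpace ℂ L)) (_ : ∀ x, TopologicalSpace (L x))
    (_ : ∀ x, AddCommGroup (L x)) (_ : ∀ x, Module ℂ (L x))
    (_ : ∀ x, IsTopologicalAddGroup (L x)) (_ : ∀ x, ContinuousSMul ℂ (L x))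
    (_ : FiberBundle ℂ L) (_ : VectorBundle ℂ ℂ L) (_ : ContMDiffVectorBundle ω ℂ L 𝓘(ℂ, E))
    (ϑ : ∀ x : M, TangentSpace 𝓘(ℂ, E) x →L[ℂ] L x),
    IsContactForm ϑ ∧ ∀ x, D x = kerForm ϑ x

section Levi

variable {E : Type*} [NormedAddCommGroup E] [NormedSpace ℂ E]
  {M : Type*} [TopologicalSpace M] [ChartedSpace E M] [IsManifold 𝓘(ℂ, E) ω M]

/-- Local sections of `D` at `x`: vector fields that are holomorphic and tangent to `D` on a
neighborhood of `x` (with arbitrary values away from it). -/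
def localSections (D : ∀ y : M, Submodule ℂ (TangentSpace 𝓘(ℂ, E) y)) (x : M) :
    Submodule ℂ (∀ y : M, TangentSpace 𝓘(ℂ, E) y) where
  carrier := {V | ContMDiffAt 𝓘(ℂ, E) 𝓘(ℂ, E).tangent ω
    (fun y => (⟨y, V y⟩ : TangentBundle 𝓘(ℂ, E) M)) x ∧ ∀ᶠ y in 𝓝 x, V y ∈ D y}
  add_mem' := fun {V W} hV hW =>
    ⟨hV.1.add_section hW.1, by
      filter_upwards [hV.2, hW.2] with y h1 h2 using (D y).add_mem h1 h2⟩
  zero_mem' := ⟨(contMDiff_zeroSection ℂ (TangentSpace 𝓘(ℂ, E) : M → Type _)).contMDiffAt,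
    Filter.Eventually.of_forall fun y => (D y).zero_mem⟩
  smul_mem' := fun c V hV =>
    ⟨hV.1.const_smul_section, by filter_upwards [hV.2] with y h using (D y).smul_mem c h⟩

theorem localSections_mdifferentiableAt (D : ∀ y : M, Submodule ℂ (TangentSpace 𝓘(ℂ, E) y)) (x : M)
    (V : localSections D x) :
    MDifferentiableAt 𝓘(ℂ, E) 𝓘(ℂ, E).tangent
      (fun y => (⟨y, V.1 y⟩ : TangentBundle 𝓘(ℂ, E) M)) x :=
  V.2.1.mdifferentiableAt (by simp)

/-- The pairing `(V, W) ↦ [V, W](x) mod D_x` of local sections of `D`. For a distribution `D`, this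
depends only on `V(x)` and `W(x)`, and the Levi tensor `∧² D_x → T_x M / D_x` is the map that it
induces. -/
def leviPairing [FiniteDimensional ℂ E] (D : ∀ y : M, Submodule ℂ (TangentSpace 𝓘(ℂ, E) y)) (x : M) :
    localSections D x →ₗ[ℂ] localSections D x →ₗ[ℂ] (TangentSpace 𝓘(ℂ, E) x ⧸ D x) :=
  haveI : CompleteSpace E := FiniteDimensional.complete ℂ E
  haveI : IsManifold 𝓘(ℂ, E) (minSmoothness ℂ 2) M := IsManifold.of_le (n := ω) le_top
  LinearMap.mk₂ ℂ (fun V W => (D x).mkQ (VectorField.mlieBracket 𝓘(ℂ, E) V.1 W.1 x))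
    (fun V V' W => by
      rw [← map_add]; congr 1
      exact VectorField.mlieBracket_add_left (localSections_mdifferentiableAt D x V)
        (localSections_mdifferentiableAt D x V'))
    (fun c V W => by
      rw [← map_smul]; congr 1
      exact VectorField.mlieBracket_const_smul_left (localSections_mdifferentiableAt D x V))
    (fun V W W' => by
      rw [← map_add]; congr 1
      exact VectorField.mlieBracket_add_right (localSections_mdifferentiableAt D x W)
        (localSections_mdifferentiableAt D x W'))
    (fun c V W => by
      rw [← map_smul]; congr 1
      exact VectorField.mlieBracket_const_smul_right (localSections_mdifferentiableAt D x W))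

/-- Evaluation of local sections at `x`. -/
def evalSection (D : ∀ y : M, Submodule ℂ (TangentSpace 𝓘(ℂ, E) y)) (x : M) :
    localSections D x →ₗ[ℂ] TangentSpace 𝓘(ℂ, E) x :=
  (LinearMap.proj x).comp (localSections D x).subtype

/-- The null space `{v ∈ D_x | Levi_x^D (v, w) = 0 for all w ∈ D_x}` of the Levi tensor of `D` at
`x`. As every vector of a distribution extends to a local section and the Levi tensor is induced by
`leviPairing`, this consists of the values at `x` of the local sections `V` of `D` such that
`[V, W](x) ∈ D_x` for all local sections `W` of `D`. -/
def leviNull [FiniteDimensional ℂ E] (D : ∀ y : M, Submodule ℂ (TangentSpace 𝓘(ℂ, E) y)) (x : M) :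
    Submodule ℂ (TangentSpace 𝓘(ℂ, E) x) :=
  (LinearMap.ker (leviPairing D x)).map (evalSection D x)

end Levi

end

/-! Locally `ϑ` is a scalar 1-form `θ`. For sections `V`, `W` of `Ker θ`, Cartan's formula gives
`θ([V, W]) = -dθ(V, W)`, so `N` is the null space of `dθ` on `Ker θ` (`mem_leviNull_iff`). Since
`d(dθ) = 0`, brackets of sections of `N` stay in `N`. As `N` has constant rank, Frobenius gives
local first integrals `f` with `Ker df = N` (`exists_first_integral_nullSpace`). In coordinates with
first component `f`, the form `θ`, scaled to be 1 on a fixed vector, does not vary along the leaves,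
because flows along `N` preserve `Ker θ`. Hence `Ker θ = (df)⁻¹(Ker σ)` for a form `σ` on the target
(`exists_form_on_fst`), and `σ` is contact, because all null directions have been divided out.

The global difficulty is a Hausdorff leaf space near `Z`. Since `N ∩ TZ = 0`, first integrals are
locally injective on `Z`. Finitely many of them, on compact sets `C i` covering `Z`, define a closed
relation: two points lie in one `C i` and have the same value there. On `Z` it is equality. Triples
that are not chains for this relation, together with triples lying in one small set, form a
neighborhood of `Z × Z × Z`. By the tube lemma this contains `O × O × O`, so the relation is
transitive on `O` (`exists_setoid_of_local_fibres`). Its quotient map is open, because the relation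
is locally the fibre relation of a submersion; being closed as well, it has a Hausdorff quotient.
First integrals, transported along leaves (`IsLocalModel.transport`), descend to charts, and
holomorphic local sections make the transition maps analytic. The forms `σ` of two charts have the
same kernel, so they differ by a factor; these factors are the cocycle of a line bundle in which the
forms glue (`IsContactAtlas.isContactForm_contactForm`).

Frobenius rests on commuting flows that are analytic in all parameters (`exists_commuting_flow`).
The time-one flow comes from an integral equation in the Banach space of paths, where composition
with an analytic map is analytic, so that the implicit function theorem applies. -/

/-! ### Analytic superposition operators on spaces of continuous functions -/

section Superposition

variable {K : Type*} [TopologicalSpace K] [CompactSpace K]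
  {E H : Type*} [NormedAddCommGroup E] [NormedSpace ℂ E] [NormedAddCommGroup H] [NormedSpace ℂ H]

/-- The pointwise action of a continuous multilinear map on continuous functions. -/
noncomputable def ContinuousMultilinearMap.pointwise {n : ℕ}
    (q : ContinuousMultilinearMap ℂ (fun _ : Fin n => E) H) :
    ContinuousMultilinearMap ℂ (fun _ : Fin n => C(K, E)) C(K, H) :=
  MultilinearMap.mkContinuous
    { toFun := fun u => ⟨fun t => q fun i => u i t, q.cont.comp (by fun_prop)⟩
      map_update_add' := fun u i x y => by
        ext t
        have h (z : C(K, E)) : (fun j => Function.update u i z j t) =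
            Function.update (fun j => u j t) i (z t) := by
          ext j; by_cases hj : j = i
          · subst hj; simp
          · simp [hj]
        simp [h]
      map_update_smul' := fun u i c x => by
        ext t
        have h (z : C(K, E)) : (fun j => Function.update u i z j t) =
            Function.update (fun j => u j t) i (z t) := by
          ext j; by_cases hj : j = i
          · subst hj; simp
          · simp [hj]
        simp [h] }
    ‖q‖ fun u => by
      rw [ContinuousMap.norm_le _ (by positivity)]
      intro t
      refine (q.le_opNorm _).trans ?_
      gcongr with i
      exact (u i).norm_coe_le_norm t

theorem ContinuousMultilinearMap.norm_pointwise_le {n : ℕ}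
    (q : ContinuousMultilinearMap ℂ (fun _ : Fin n => E) H) :
    ‖(q.pointwise : ContinuousMultilinearMap ℂ (fun _ : Fin n => C(K, E)) C(K, H))‖ ≤ ‖q‖ :=
  MultilinearMap.mkContinuous_norm_le _ (norm_nonneg _) _

/-- Composition with an analytic map `X` is an analytic operation on continuous functions that are
uniformly close to a constant. -/
theorem exists_analyticAt_superposition [CompleteSpace H] {X : E → H} {p : E}
    (hX : AnalyticAt ℂ X p) :
    ∃ N : C(K, E) → C(K, H), AnalyticAt ℂ N (ContinuousMap.const K p) ∧
      ∀ᶠ γ in 𝓝 (ContinuousMap.const K p), ∀ t, N γ t = X (γ t) := by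
  obtain ⟨q, r, hq⟩ := hX
  let Q : FormalMultilinearSeries ℂ C(K, E) C(K, H) := fun n => (q n).pointwise
  -- The bound on the norm of `pointwise` makes the series on function space converge wherever `q`
  -- does; evaluation at `t` then identifies its sum.
  have hr : r ≤ Q.radius :=
    hq.r_le.trans (FormalMultilinearSeries.radius_le_of_le fun n => (q n).norm_pointwise_le)
  have hQ := Q.hasFPowerSeriesOnBall (hq.r_pos.trans_le hr)
  refine ⟨fun γ => Q.sum (γ - ContinuousMap.const K p), ?_, ?_⟩
  · have h0 : AnalyticAt ℂ Q.sum (ContinuousMap.const K p - ContinuousMap.const K p) := by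
      rw [sub_self]; exact hQ.analyticAt
    exact h0.fun_comp (f := fun γ : C(K, E) => γ - ContinuousMap.const K p) (by fun_prop)
  · filter_upwards [Metric.eball_mem_nhds (ContinuousMap.const K p) hq.r_pos] with γ hγ t
    have hγ' : γ - ContinuousMap.const K p ∈ Metric.eball 0 r := by
      simpa [edist_eq_enorm_sub] using hγ
    have h1 := (Q.hasSum (Metric.eball_subset_eball hr hγ')).mapL (ContinuousMap.evalCLM ℂ t)
    have ht : γ t - p ∈ Metric.eball (0 : E) r := by
      refine lt_of_le_of_lt ?_ (Metric.mem_eball.1 hγ')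
      rw [edist_zero_right, edist_zero_right, ← ofReal_norm, ← ofReal_norm]
      exact ENNReal.ofReal_le_ofReal ((γ - ContinuousMap.const K p).norm_coe_le_norm t)
    have h2 := hq.hasSum ht
    rw [add_sub_cancel] at h2
    exact h1.unique h2

end Superposition

/-! ### Analytic flows and the Frobenius theorem for commuting fields -/

section Flow

open intervalIntegral unitInterval

variable {E : Type*} [NormedAddCommGroup E] [NormedSpace ℂ E] [CompleteSpace E]

/-- The primitive, vanishing at `0`, of a continuous function on the unit interval. -/
noncomputable def primitiveCLM (E : Type*) [NormedAddCommGroup E] [NormedSpace ℂ E]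
    [CompleteSpace E] : C(I, E) →L[ℂ] C(I, E) :=
  LinearMap.mkContinuous
    { toFun := fun u => ⟨fun t => ∫ s in (0 : ℝ)..t, u.IccExtend zero_le_one s, by
        have := intervalIntegral.continuous_primitive (μ := MeasureTheory.volume)
          (fun a b => (u.IccExtend zero_le_one).continuous.intervalIntegrable a b) 0
        exact this.comp continuous_subtype_val⟩
      map_add' := fun u v => by
        ext t
        exact intervalIntegral.integral_add
          ((u.IccExtend zero_le_one).continuous.intervalIntegrable _ _)
          ((v.IccExtend zero_le_one).continuous.intervalIntegrable _ _)
      map_smul' := fun c u => by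
        ext t
        exact intervalIntegral.integral_smul c _ }
    1 fun u => by
      rw [ContinuousMap.norm_le _ (by positivity)]
      intro t
      have h := intervalIntegral.norm_integral_le_of_norm_le_const (a := (0 : ℝ)) (b := (t : ℝ))
        (f := u.IccExtend zero_le_one) (C := ‖u‖) fun s _ => u.norm_coe_le_norm _
      refine h.trans ?_
      have := t.2.1
      have := t.2.2
      rw [sub_zero, abs_of_nonneg t.2.1, one_mul]
      exact mul_le_of_le_one_right (norm_nonneg _) t.2.2

theorem primitiveCLM_apply (u : C(I, E)) (t : I) :
    primitiveCLM E u t = ∫ s in (0 : ℝ)..t, u.IccExtend zero_le_one s := rfl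

theorem hasDerivAt_primitiveCLM (u : C(I, E)) {t : ℝ} (ht : t ∈ Set.Ioo (0 : ℝ) 1) :
    HasDerivAt ((primitiveCLM E u).IccExtend zero_le_one) (u ⟨t, ht.1.le, ht.2.le⟩) t := by
  have hc := (u.IccExtend zero_le_one).continuous
  have h := intervalIntegral.integral_hasDerivAt_right (hc.intervalIntegrable 0 t)
    (hc.stronglyMeasurableAtFilter _ _) hc.continuousAt
  have e : u.IccExtend zero_le_one t = u ⟨t, ht.1.le, ht.2.le⟩ :=
    Set.IccExtend_of_mem _ _ ⟨ht.1.le, ht.2.le⟩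
  rw [e] at h
  refine h.congr_of_eventuallyEq ?_
  filter_upwards [Ioo_mem_nhds ht.1 ht.2] with s hs
  exact Set.IccExtend_of_mem zero_le_one (primitiveCLM E u) ⟨hs.1.le, hs.2.le⟩

/-- A function with continuous derivative `u` that vanishes at `0` is the primitive of `u`. -/
theorem eq_primitiveCLM (z u : C(I, E)) (h0 : z 0 = 0)
    (h : ∀ t (ht : t ∈ Set.Ioo (0 : ℝ) 1),
      HasDerivAt (z.IccExtend zero_le_one) (u ⟨t, ht.1.le, ht.2.le⟩) t) :
    z = primitiveCLM E u := by
  ext t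
  rw [primitiveCLM_apply, intervalIntegral.integral_eq_sub_of_hasDerivAt_of_le
    (f := z.IccExtend zero_le_one) t.2.1 (z.IccExtend zero_le_one).continuous.continuousOn
    (fun s hs => ?_)
    ((u.IccExtend zero_le_one).continuous.intervalIntegrable _ _)]
  · have e1 : z.IccExtend zero_le_one (t : ℝ) = z t := Set.IccExtend_val _ _ t
    have e2 : z.IccExtend zero_le_one (0 : ℝ) = z 0 := Set.IccExtend_left _ _
    rw [e1, e2, h0, sub_zero]
  · have hs' : s ∈ Set.Ioo (0 : ℝ) 1 := ⟨hs.1, hs.2.trans_le t.2.2⟩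
    have e : u.IccExtend zero_le_one s = u ⟨s, hs'.1.le, hs'.2.le⟩ :=
      Set.IccExtend_of_mem _ _ ⟨hs'.1.le, hs'.2.le⟩
    rw [e]
    exact h s hs'

/-- Pointwise application of a path of (encoded) operators to a fixed vector. -/
noncomputable def pathApply {E H : Type*} [NormedAddCommGroup E] [NormedSpace ℂ E]
    [NormedAddCommGroup H] [NormedSpace ℂ H] (b : H →L[ℂ] E →L[ℂ] E) :
    C(I, H) →L[ℂ] E →L[ℂ] C(I, E) :=
  LinearMap.mkContinuous₂
    (LinearMap.mk₂ ℂ (fun (f : C(I, H)) (a : E) => (⟨fun t => b (f t) a, by fun_prop⟩ : C(I, E)))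
      (fun _ _ _ => by ext; simp) (fun _ _ _ => by ext; simp)
      (fun _ _ _ => by ext; simp) (fun _ _ _ => by ext; simp)) ‖b‖ fun f a => by
    rw [ContinuousMap.norm_le _ (by positivity)]
    exact fun t => (b.le_opNorm₂ (f t) a).trans (by gcongr; exact f.norm_coe_le_norm t)

@[simp] theorem pathApply_apply {E H : Type*} [NormedAddCommGroup E] [NormedSpace ℂ E]
    [NormedAddCommGroup H] [NormedSpace ℂ H] (b : H →L[ℂ] E →L[ℂ] E) (f : C(I, H)) (a : E) (t : I) :
    pathApply b f a t = b (f t) a := rfl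

/-- Constant paths. -/
noncomputable def constPath (E : Type*) [NormedAddCommGroup E] [NormedSpace ℂ E] :
    E →L[ℂ] C(I, E) :=
  LinearMap.mkContinuous
    { toFun := ContinuousMap.const I
      map_add' := fun _ _ => rfl
      map_smul' := fun _ _ => rfl } 1 fun x => by
    rw [one_mul, ContinuousMap.norm_le _ (by positivity)]
    exact fun t => le_rfl

@[simp] theorem constPath_apply (E : Type*) [NormedAddCommGroup E] [NormedSpace ℂ E] (x : E) :
    constPath E x = ContinuousMap.const I x := rfl

/-- The sup norm bounds the distance at every time, so conditions near `p` carry over to whole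
trajectories close to the constant path. -/
theorem eventually_forall_path {E : Type*} [NormedAddCommGroup E] {p : E} {Q : E → Prop}
    (hQ : ∀ᶠ x in 𝓝 p, Q x) :
    ∀ᶠ γ in 𝓝 (ContinuousMap.const I p), ∀ t, Q (γ t) := by
  obtain ⟨ε, hε, h⟩ := Metric.eventually_nhds_iff.1 hQ
  filter_upwards [Metric.ball_mem_nhds _ hε] with γ hγ t
  exact h ((ContinuousMap.dist_apply_le_dist t).trans_lt hγ)

/-- The solutions `γ` of the integral equation `γ = κ x + J (B (N γ) a)` depend analytically on the
parameters `(a, x)` near `(0, p)`, and their derivative in the direction of `a` is characterized by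
the linearized equation. -/
theorem exists_parametric_solution {C D : Type*} [NormedAddCommGroup C] [NormedSpace ℂ C]
    [CompleteSpace C] [NormedAddCommGroup D] [NormedSpace ℂ D] (J : C →L[ℂ] C)
    (B : D →L[ℂ] E →L[ℂ] C) (κ : E →L[ℂ] C) {N : C → D} {p : E} (hN : ContDiffAt ℂ ω N (κ p)) :
    ∃ γ : E × E → C, ContDiffAt ℂ ω γ (0, p) ∧ γ (0, p) = κ p ∧
      (∀ᶠ z in 𝓝 ((0, p) : E × E), γ z = κ z.2 + J (B (N (γ z)) z.1)) ∧
      ∀ᶠ z in 𝓝 ((0, p) : E × E), ∀ (c : E) (ζ : C),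
        ζ = J (B (fderiv ℂ N (γ z) ζ) z.1 + B (N (γ z)) c) → fderiv ℂ γ z (c, 0) = ζ := by
  let Θ : (E × E) × C → C := fun z => z.2 - κ z.1.2 - J (B (N z.2) z.1.1)
  let u : (E × E) × C := ((0, p), κ p)
  have hΘ : ContDiffAt ℂ ω Θ u := by
    have h1 : ContDiffAt ℂ ω (fun z : (E × E) × C => N z.2) u :=
      ContDiffAt.comp (g := N) u hN contDiffAt_snd
    have h2 : ContDiffAt ℂ ω (fun z : (E × E) × C => B (N z.2) z.1.1) u :=
      ((B.contDiff.contDiffAt.comp u h1)).clm_apply (by fun_prop)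
    have h3 := J.contDiff.contDiffAt.comp u h2
    exact ContDiffAt.sub (by fun_prop) h3
  have hΘu : Θ u = 0 := by simp [Θ, u]
  -- At `a = 0` the nonlinear term vanishes for every path, so the partial derivative in the path is
  -- the identity and the implicit function theorem applies.
  have hpart : fderiv ℂ Θ u ∘L .inr ℂ (E × E) C = ContinuousLinearMap.id ℂ _ := by
    have h1 : HasFDerivAt (fun γ => Θ ((0, p), γ))
        (fderiv ℂ Θ u ∘L .inr ℂ (E × E) C) (κ p) :=
      (hΘ.differentiableAt (by simp)).hasFDerivAt.comp (κ p) (hasFDerivAt_prodMk_right _ _)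
    have h2 : HasFDerivAt (fun γ => Θ ((0, p), γ)) (ContinuousLinearMap.id ℂ _) (κ p) := by
      have : (fun γ => Θ ((0, p), γ)) = fun γ => γ - κ p := by ext γ; simp [Θ]
      rw [this]
      exact (hasFDerivAt_id _).sub_const _
    exact h1.unique h2
  have hif : (fderiv ℂ Θ u ∘L .inr ℂ (E × E) C).IsInvertible := by
    rw [hpart]; exact ⟨ContinuousLinearEquiv.refl ℂ _, rfl⟩
  set γ : E × E → C := hΘ.implicitFunction (by simp) hif with hγdef
  have hγ : ContDiffAt ℂ ω γ (0, p) := hΘ.contDiffAt_implicitFunction (by simp) hif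
  have hγ0 : γ (0, p) = κ p := hΘ.implicitFunction_apply_self (by simp) hif
  have hγΘ : ∀ᶠ z in 𝓝 ((0, p) : E × E), Θ (z, γ z) = 0 := by
    have := hΘ.eventually_apply_implicitFunction (by simp) hif
    rwa [hΘu] at this
  refine ⟨γ, hγ, hγ0, hγΘ.mono fun z hz => ?_, ?_⟩
  · simp only [Θ] at hz
    rw [sub_sub, sub_eq_zero] at hz
    exact hz
  have hγt : Filter.Tendsto γ (𝓝 (0, p)) (𝓝 (κ p)) := by
    have := hγ.continuousAt.tendsto; rwa [hγ0] at this
  have hNd : ∀ᶠ f in 𝓝 (κ p), DifferentiableAt ℂ N f :=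
    (hN.eventually (by simp)).mono fun x hx => hx.differentiableAt (by simp)
  -- This product bounds the norm of the operator acting on `ζ` in the linearized equation. Below 1,
  -- it makes the solution unique, so any candidate that solves the equation is the derivative.
  have hsmall : ∀ᶠ z in 𝓝 ((0, p) : E × E), ‖J‖ * (‖B‖ * ‖fderiv ℂ N (γ z)‖ * ‖z.1‖) < 1 := by
    have h1 : ContinuousAt (fderiv ℂ N) (κ p) :=
      (hN.fderiv_right (m := 0) (by simp)).continuousAt
    have h2 : Filter.Tendsto (fun z : E × E => ‖J‖ * (‖B‖ * ‖fderiv ℂ N (γ z)‖ * ‖z.1‖))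
        (𝓝 (0, p)) (𝓝 (‖J‖ * (‖B‖ * ‖fderiv ℂ N (κ p)‖ * ‖(0 : E)‖))) :=
      (((h1.tendsto.comp hγt).norm.const_mul _).mul (continuous_fst.tendsto _).norm).const_mul _
    exact h2.eventually (gt_mem_nhds (by simp))
  filter_upwards [hγΘ.eventually_nhds, (hγ.eventually (by simp)), hγt.eventually hNd, hsmall]
    with z hz hγz hNdz hsm c ζ hζ
  set w := fderiv ℂ γ z (c, 0) with hw
  have hγd := (hγz.differentiableAt (by simp)).hasFDerivAt
  have hweq : w = J (B (fderiv ℂ N (γ z) w) z.1 + B (N (γ z)) c) := by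
    have h1 : HasFDerivAt (fun z : E × E => B (N (γ z)))
        (B ∘L fderiv ℂ N (γ z) ∘L fderiv ℂ γ z) z :=
      B.hasFDerivAt.comp z (hNdz.hasFDerivAt.comp z hγd)
    have h2 := h1.clm_apply (hasFDerivAt_fst (𝕜 := ℂ) (p := z))
    have h3 := (hγd.sub (κ.hasFDerivAt.comp z (hasFDerivAt_snd (𝕜 := ℂ) (p := z)))).sub
      (J.hasFDerivAt.comp z h2)
    have h4 : HasFDerivAt (fun _ : E × E => (0 : C)) (0 : E × E →L[ℂ] C) z := hasFDerivAt_const _ _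
    have h5 := DFunLike.congr_fun (h3.unique (h4.congr_of_eventuallyEq hz)) (c, 0)
    simp only [_root_.sub_apply, ContinuousLinearMap.comp_apply,
      _root_.add_apply, ContinuousLinearMap.flip_apply,
      ContinuousLinearMap.coe_fst', ContinuousLinearMap.coe_snd', map_zero, sub_zero,
      _root_.zero_apply, sub_eq_zero] at h5
    rw [add_comm]
    exact h5
  have h1 : w - ζ = J (B (fderiv ℂ N (γ z) (w - ζ)) z.1) := by
    conv_lhs => rw [hweq, hζ]
    simp only [map_sub, map_add, _root_.sub_apply]
    abel
  by_contra hne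
  have hpos : 0 < ‖w - ζ‖ := norm_pos_iff.2 (sub_ne_zero.2 hne)
  have h2 : ‖w - ζ‖ ≤ ‖J‖ * (‖B‖ * ‖fderiv ℂ N (γ z)‖ * ‖z.1‖) * ‖w - ζ‖ := by
    calc ‖w - ζ‖ = ‖J (B (fderiv ℂ N (γ z) (w - ζ)) z.1)‖ := by rw [← h1]
      _ ≤ ‖J‖ * ‖B (fderiv ℂ N (γ z) (w - ζ)) z.1‖ := J.le_opNorm _
      _ ≤ ‖J‖ * (‖B (fderiv ℂ N (γ z) (w - ζ))‖ * ‖z.1‖) := by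
        gcongr; exact ContinuousLinearMap.le_opNorm _ _
      _ ≤ ‖J‖ * (‖B‖ * (‖fderiv ℂ N (γ z)‖ * ‖w - ζ‖) * ‖z.1‖) := by
        gcongr
        exact (B.le_opNorm _).trans (by gcongr; exact ContinuousLinearMap.le_opNorm _ _)
      _ = _ := by ring
  nlinarith

/-- The time-one flow of a commuting family of vector fields `x ↦ X x a` depends analytically on
the parameter `a` and the initial point, and its derivative in the direction `c` of the parameter
is the vector field with parameter `c`. -/
theorem exists_commuting_flow {H : Type*} [NormedAddCommGroup H] [NormedSpace ℂ H]
    [CompleteSpace H] (b : H →L[ℂ] E →L[ℂ] E) {X : E → H} {p : E} (hX : ContDiffAt ℂ ω X p)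
    (hinv : ∀ᶠ x in 𝓝 p, ∀ a c, b (fderiv ℂ X x (b (X x) a)) c = b (fderiv ℂ X x (b (X x) c)) a) :
    ∃ g : E × E → E, ContDiffAt ℂ ω g (0, p) ∧ (∀ᶠ b in 𝓝 p, g (0, b) = b) ∧
      ∀ᶠ z in 𝓝 ((0, p) : E × E), ∀ c, fderiv ℂ g z (c, 0) = b (X (g z)) c := by
  obtain ⟨N, hN, hNX⟩ := exists_analyticAt_superposition (K := I) hX.analyticAt
  set J := primitiveCLM E with hJ
  set B := pathApply b with hB
  set κ := constPath E with hκ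
  have hNω : ContDiffAt ℂ ω N (κ p) := hN.contDiffAt
  obtain ⟨γ, hγ, hγ0, hγΘ, hγ'⟩ := exists_parametric_solution J B κ hNω
  have hev1 : ContDiff ℂ ω fun f : C(I, E) => f 1 :=
    (ContinuousMap.evalCLM ℂ (1 : I) : C(I, E) →L[ℂ] E).contDiff
  refine ⟨fun z => γ z 1, hev1.contDiffAt.comp _ hγ, ?_, ?_⟩
  · have h : Filter.Tendsto (fun x : E => ((0 : E), x)) (𝓝 p) (𝓝 (0, p)) :=
      (Continuous.prodMk_right (0 : E)).tendsto p
    filter_upwards [h.eventually hγΘ] with x hx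
    have : γ (0, x) = κ x := by simpa using hx
    simp [this, hκ]
  -- conditions on nearby paths
  have hγt : Filter.Tendsto γ (𝓝 (0, p)) (𝓝 (κ p)) := by
    have := hγ.continuousAt.tendsto; rwa [hγ0] at this
  have hXd : ∀ᶠ x in 𝓝 p, DifferentiableAt ℂ X x :=
    (hX.eventually (by simp)).mono fun x hx => hx.differentiableAt (by simp)
  have hNd : ∀ᶠ f in 𝓝 (κ p), DifferentiableAt ℂ N f :=
    (hNω.eventually (by simp)).mono fun x hx => hx.differentiableAt (by simp)
  filter_upwards [hγΘ.eventually_nhds, (hγ.eventually (by simp)),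
    hγt.eventually hNX.eventually_nhds, hγt.eventually hNd,
    hγt.eventually (eventually_forall_path hXd), hγt.eventually (eventually_forall_path hinv),
    hγ'] with z hz hγz hNz hNdz hXz hinvz hγ'z c
  set a := z.1
  set f := γ z
  -- the derivative of the superposition operator
  have hDN (v : C(I, E)) (t : I) : fderiv ℂ N f v t = fderiv ℂ X (f t) (v t) := by
    have h1 : HasFDerivAt (fun φ => N φ t)
        ((ContinuousMap.evalCLM ℂ t : C(I, H) →L[ℂ] _) ∘L fderiv ℂ N f) f :=
      (ContinuousMap.evalCLM ℂ t : C(I, H) →L[ℂ] _).hasFDerivAt.comp f hNdz.hasFDerivAt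
    have h2 : HasFDerivAt (fun φ : C(I, E) => X (φ t))
        (fderiv ℂ X (f t) ∘L (ContinuousMap.evalCLM ℂ t : C(I, E) →L[ℂ] _)) f :=
      (hXz t).hasFDerivAt.comp (g := X) f (ContinuousMap.evalCLM ℂ t : C(I, E) →L[ℂ] _).hasFDerivAt
    have h3 := h2.congr_of_eventuallyEq (hNz.mono fun φ hφ => hφ t)
    exact DFunLike.congr_fun (h1.unique h3) v
  have hNf : ∀ t, N f t = X (f t) := hNz.self_of_nhds
  have hf : f = κ z.2 + J (B (N f) a) := hz.self_of_nhds
  -- the candidate solution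
  let ζ : C(I, E) := ⟨fun t => (t : ℝ) • b (N f t) c, by fun_prop⟩
  have hζ (t : I) : ζ t = (t : ℝ) • b (X (f t)) c := by rw [← hNf]; rfl
  -- For commuting fields the parameter derivative of the trajectory at time `t` is `t` times the
  -- field at the point reached. Differentiating `t • X c` along `f` gives `X c + t • DX(X a) c`,
  -- and `hinv` exchanges `a` and `c` in the second term, which yields the linearized equation.
  have hζeq : ζ = J (B (fderiv ℂ N f ζ) a + B (N f) c) := by
    refine eq_primitiveCLM _ _ (by simp [hζ]) fun t ht => ?_
    have hft : HasDerivAt (f.IccExtend zero_le_one) (b (X (f ⟨t, ht.1.le, ht.2.le⟩)) a) t := by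
      have h1 := (hasDerivAt_primitiveCLM (B (N f) a) ht).const_add z.2
      rw [pathApply_apply, hNf] at h1
      refine h1.congr_of_eventuallyEq ?_
      filter_upwards with s
      have := DFunLike.congr_fun hf (Set.projIcc 0 1 zero_le_one s)
      exact this
    have hval : f.IccExtend zero_le_one t = f ⟨t, ht.1.le, ht.2.le⟩ :=
      Set.IccExtend_of_mem _ _ ⟨ht.1.le, ht.2.le⟩
    have hXt : HasFDerivAt X ((fderiv ℂ X (f ⟨t, ht.1.le, ht.2.le⟩)).restrictScalars ℝ)
        (f.IccExtend zero_le_one t) := by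
      rw [hval]; exact (hXz _).hasFDerivAt.restrictScalars ℝ
    have h2 := hXt.comp_hasDerivAt t hft
    have h3 : HasDerivAt (fun s => b (X (f.IccExtend zero_le_one s)) c)
        (b (fderiv ℂ X (f ⟨t, ht.1.le, ht.2.le⟩) (b (X (f ⟨t, ht.1.le, ht.2.le⟩)) a)) c) t :=
      ((b.flip c).restrictScalars ℝ).hasFDerivAt.comp_hasDerivAt t h2
    have h4 := (hasDerivAt_id t).smul h3
    have h5 : (fun s => id s • b (X (f.IccExtend zero_le_one s)) c) =ᶠ[𝓝 t]
        ζ.IccExtend zero_le_one := by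
      filter_upwards [Ioo_mem_nhds ht.1 ht.2] with s hs
      have e1 : ζ.IccExtend zero_le_one s = ζ ⟨s, hs.1.le, hs.2.le⟩ :=
        Set.IccExtend_of_mem zero_le_one ζ ⟨hs.1.le, hs.2.le⟩
      have e2 : f.IccExtend zero_le_one s = f ⟨s, hs.1.le, hs.2.le⟩ :=
        Set.IccExtend_of_mem zero_le_one f ⟨hs.1.le, hs.2.le⟩
      rw [e1, e2, hζ]; rfl
    refine (h4.congr_of_eventuallyEq h5.symm).congr_deriv ?_
    have hs : fderiv ℂ X (f ⟨t, ht.1.le, ht.2.le⟩) (t • b (X (f ⟨t, ht.1.le, ht.2.le⟩)) c) =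
        t • fderiv ℂ X (f ⟨t, ht.1.le, ht.2.le⟩) (b (X (f ⟨t, ht.1.le, ht.2.le⟩)) c) :=
      ((fderiv ℂ X (f ⟨t, ht.1.le, ht.2.le⟩)).restrictScalars ℝ).map_smul t _
    have hs'' (x : H) : b (t • x) a = t • b x a :=
      ((b.flip a).restrictScalars ℝ).map_smul t x
    simp only [ContinuousMap.add_apply, hB, pathApply_apply, hDN, hζ, hNf, hval, id, hs, hs'', one_smul]
    rw [hinvz]
  have h1 : HasFDerivAt (fun z => γ z 1)
      ((ContinuousMap.evalCLM ℂ (1 : I) : C(I, E) →L[ℂ] _) ∘L fderiv ℂ γ z) z :=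
    (ContinuousMap.evalCLM ℂ (1 : I) : C(I, E) →L[ℂ] _).hasFDerivAt.comp z
      (hγz.differentiableAt (by simp)).hasFDerivAt
  rw [h1.fderiv]
  change fderiv ℂ γ z (c, 0) 1 = _
  rw [hγ'z c ζ hζeq, hζ]
  simp [f]

/-- The local Frobenius theorem: an involutive distribution, given as the range of an analytic
family of operators `X x` that is normalized by a projection `P`, is the kernel of the derivative of
an analytic map. -/
theorem exists_first_integral_of_commuting [FiniteDimensional ℂ E] {G : Type*}
    [NormedAddCommGroup G] [NormedSpace ℂ G] {X : E → E →L[ℂ] E} {p : E} (hX : ContDiffAt ℂ ω X p)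
    (hinv : ∀ᶠ x in 𝓝 p, ∀ a c, fderiv ℂ X x (X x a) c = fderiv ℂ X x (X x c) a)
    (P : E →L[ℂ] E) (hP : ∀ v, P (P v) = P v)
    (hXP : ∀ᶠ x in 𝓝 p, ∀ v, X x (P v) = X x v) (hPX : ∀ᶠ x in 𝓝 p, ∀ v, P (X x v) = P v)
    (l : E →L[ℂ] G) (hl : ∀ v, l v = 0 ↔ P v = v) :
    ∃ f : E → G, ContDiffAt ℂ ω f p ∧
      ∀ᶠ x in 𝓝 p, LinearMap.ker (fderiv ℂ f x).toLinearMap = LinearMap.range (X x).toLinearMap := by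
  obtain ⟨g, hg, hg0, hgX⟩ := exists_commuting_flow (ContinuousLinearMap.id ℂ (E →L[ℂ] E)) hX hinv
  simp only [ContinuousLinearMap.coe_id', id] at hgX
  -- Coordinates adapted to the leaves: `Ψ e` is the flow with parameter `P e` started at `p + (e -
  -- P e)`. Its derivative at 0 is injective because `P ∘ X p = P`.
  let j : E →L[ℂ] E × E := P.prod (ContinuousLinearMap.id ℂ E - P)
  let j' : E → E × E := fun e => j e + (0, p)
  have hj'0 : j' 0 = (0, p) := by simp [j']
  have hj' (e : E) : HasFDerivAt j' j e := j.hasFDerivAt.add_const _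
  have hj'c : ContDiff ℂ ω j' := j.contDiff.add contDiff_const
  let Ψ : E → E := fun e => g (j' e)
  have hg0p : g (0, p) = p := hg0.self_of_nhds
  have hΨ0 : Ψ 0 = p := by simp [Ψ, hj'0, hg0p]
  have hΨ : ContDiffAt ℂ ω Ψ 0 := ContDiffAt.comp (g := g) 0 (by rwa [hj'0]) hj'c.contDiffAt
  have hgd : HasFDerivAt g (fderiv ℂ g (0, p)) (0, p) :=
    (hg.differentiableAt (by simp)).hasFDerivAt
  have hg2 (v : E) : fderiv ℂ g (0, p) (0, v) = v := by
    have h1 : HasFDerivAt (fun b => g ((0 : E), b)) (fderiv ℂ g (0, p) ∘L .inr ℂ E E) p :=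
      hgd.comp p (hasFDerivAt_prodMk_right _ _)
    have h2 := (hasFDerivAt_id (𝕜 := ℂ) p).congr_of_eventuallyEq hg0
    exact DFunLike.congr_fun (h1.unique h2) v
  have hΨ' : HasFDerivAt Ψ (fderiv ℂ g (0, p) ∘L j) 0 := by
    have : HasFDerivAt g (fderiv ℂ g (0, p)) (j' 0) := by rwa [hj'0]
    exact this.comp (0 : E) (hj' 0)
  have hval (v : E) : (fderiv ℂ g (0, p) ∘L j) v = X p v + (v - P v) := by
    have h1 : j v = (P v, 0) + (0, v - P v) := by simp [j]
    rw [ContinuousLinearMap.comp_apply, h1, map_add, hg2, hgX.self_of_nhds, hg0p,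
      hXP.self_of_nhds]
  have hinj : Function.Injective (fderiv ℂ g (0, p) ∘L j) := by
    rw [injective_iff_map_eq_zero]
    intro v hv
    rw [hval] at hv
    have h1 : P v = 0 := by
      have := congrArg P hv
      simpa [hPX.self_of_nhds, hP] using this
    have h2 : X p v = 0 := by rw [← hXP.self_of_nhds, h1, map_zero]
    simpa [h1, h2] using hv
  let Ψ' : E ≃L[ℂ] E :=
    (LinearEquiv.ofInjectiveEndo (fderiv ℂ g (0, p) ∘L j).toLinearMap hinj).toContinuousLinearEquiv
  have hΨ'e : HasFDerivAt Ψ (Ψ' : E →L[ℂ] E) 0 := by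
    convert! hΨ' using 1
  have hs := hΨ.hasStrictFDerivAt' hΨ'e (by simp)
  let Φ : E → E := hΨ.localInverse hΨ'e (by simp)
  have hΦ : ContDiffAt ℂ ω Φ p := by
    have := hΨ.to_localInverse hΨ'e (by simp)
    rwa [hΨ0] at this
  have hΦ0 : Φ p = 0 := by
    have := hs.localInverse_apply_image
    rwa [hΨ0] at this
  have hΨΦ : ∀ᶠ x in 𝓝 p, Ψ (Φ x) = x := by
    have := hs.eventually_right_inverse
    rwa [hΨ0] at this
  have hΦΨ : ∀ᶠ e in 𝓝 0, Φ (Ψ e) = e := hs.eventually_left_inverse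
  have hΦt : Filter.Tendsto Φ (𝓝 p) (𝓝 0) := by
    have := hΦ.continuousAt.tendsto; rwa [hΦ0] at this
  have hj't : Filter.Tendsto (fun x => j' (Φ x)) (𝓝 p) (𝓝 (0, p)) := by
    have := hj'c.continuous.tendsto 0; rw [hj'0] at this; exact this.comp hΦt
  -- The first integral is the transverse coordinate: `l` kills exactly the range of `P`, the
  -- directions of the flow.
  refine ⟨fun x => l (Φ x), l.contDiff.contDiffAt.comp p hΦ, ?_⟩
  filter_upwards [hXP, hPX, hΦ.eventually (by simp), hΨΦ.eventually_nhds,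
    hΦt.eventually hΦΨ.eventually_nhds, hj't.eventually (hg.eventually (by simp)),
    hj't.eventually hgX] with x hXPx hPXx hΦx hΨΦx hΦΨx hgx hgXx
  have hdΦ := (hΦx.differentiableAt (by simp)).hasFDerivAt
  have hdg := (hgx.differentiableAt (by simp)).hasFDerivAt
  have hx : Ψ (Φ x) = x := hΨΦx.self_of_nhds
  have hdΨ : HasFDerivAt Ψ (fderiv ℂ g (j' (Φ x)) ∘L j) (Φ x) :=
    HasFDerivAt.comp (g := g) (Φ x) hdg (hj' _)
  have h1 (v : E) : (fderiv ℂ g (j' (Φ x)) ∘L j) (fderiv ℂ Φ x v) = v := by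
    have h := (hdΨ.comp x hdΦ).unique ((hasFDerivAt_id x).congr_of_eventuallyEq hΨΦx)
    exact DFunLike.congr_fun h v
  have h2 (v : E) : fderiv ℂ Φ x ((fderiv ℂ g (j' (Φ x)) ∘L j) v) = v := by
    have hd : HasFDerivAt Φ (fderiv ℂ Φ x) (Ψ (Φ x)) := by rwa [hx]
    have h := (hd.comp (Φ x) hdΨ).unique ((hasFDerivAt_id _).congr_of_eventuallyEq hΦΨx)
    exact DFunLike.congr_fun h v
  -- The derivative of `Ψ` carries the range of `P` onto the range of `X x` at every nearby point,
  -- not only at `p`: here the derivative of the flow in its parameter is used.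
  have h3 (v : E) : (fderiv ℂ g (j' (Φ x)) ∘L j) (P v) = X x v := by
    have : j (P v) = (P v, 0) := by simp [j, hP]
    rw [ContinuousLinearMap.comp_apply, this, hgXx]
    change X (Ψ (Φ x)) _ = _
    rw [hx, hXPx]
  have hf : fderiv ℂ (fun x => l (Φ x)) x = l ∘L fderiv ℂ Φ x :=
    (l.hasFDerivAt.comp x hdΦ).fderiv
  ext v
  simp only [hf, LinearMap.mem_ker, LinearMap.mem_range, ContinuousLinearMap.coe_coe,
    ContinuousLinearMap.comp_apply]
  constructor
  · intro hv
    have hv' := (hl _).1 hv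
    exact ⟨fderiv ℂ Φ x v, by rw [← h3, hv', h1]⟩
  · rintro ⟨u, rfl⟩
    rw [← h3, h2, hl, hP]

end Flow

/-! ### Null spaces of a 1-form and their involutivity -/

section NullSpace

variable {E : Type*} [NormedAddCommGroup E] [NormedSpace ℂ E]

/-- The null space of `dθ` restricted to the kernel of the 1-form `θ` at `p`. -/
def nullSpace (θ : E → E →L[ℂ] ℂ) (p : E) : Submodule ℂ E where
  carrier := {v | θ p v = 0 ∧ ∀ u, θ p u = 0 → fderiv ℂ θ p u v = fderiv ℂ θ p v u}
  add_mem' := fun ⟨h1, h2⟩ ⟨h3, h4⟩ => ⟨by simp [h1, h3], fun u hu => by simp [h2 u hu, h4 u hu]⟩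
  zero_mem' := by simp
  smul_mem' := fun c v ⟨h1, h2⟩ => ⟨by simp [h1], fun u hu => by simp [h2 u hu]⟩

theorem mem_nullSpace {θ : E → E →L[ℂ] ℂ} {p v : E} :
    v ∈ nullSpace θ p ↔ θ p v = 0 ∧ ∀ u, θ p u = 0 → fderiv ℂ θ p u v = fderiv ℂ θ p v u := Iff.rfl

/-- The Cartan formula for a 1-form and two vector fields in its kernel. -/
theorem apply_fderiv_sub_of_ker {θ : E → E →L[ℂ] ℂ} {x : E} {V W : E → E}
    (hθ : DifferentiableAt ℂ θ x) (hV : DifferentiableAt ℂ V x) (hW : DifferentiableAt ℂ W x)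
    (hVk : ∀ᶠ y in 𝓝 x, θ y (V y) = 0) (hWk : ∀ᶠ y in 𝓝 x, θ y (W y) = 0) :
    θ x (fderiv ℂ V x (W x) - fderiv ℂ W x (V x)) =
      fderiv ℂ θ x (V x) (W x) - fderiv ℂ θ x (W x) (V x) := by
  have key {U : E → E} (hU : DifferentiableAt ℂ U x) (hUk : ∀ᶠ y in 𝓝 x, θ y (U y) = 0) (z : E) :
      θ x (fderiv ℂ U x z) + fderiv ℂ θ x z (U x) = 0 := by
    have h1 := hθ.hasFDerivAt.clm_apply hU.hasFDerivAt
    have h2 : HasFDerivAt (fun y => θ y (U y)) (0 : E →L[ℂ] ℂ) x :=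
      (hasFDerivAt_const (0 : ℂ) x).congr_of_eventuallyEq hUk
    simpa using DFunLike.congr_fun (h1.unique h2) z
  have h1 := key hV hVk (W x)
  have h2 := key hW hWk (V x)
  rw [map_sub]
  linear_combination h1 - h2

/-- The bracket of two vector fields in the null space of `dθ` on the kernel of `θ` is again in this
null space: the closedness of `dθ`. -/
theorem fderiv_bracket_of_null {θ : E → E →L[ℂ] ℂ} {x : E} {V W U : E → E}
    (hθ : ContDiffAt ℂ ω θ x) (hV : DifferentiableAt ℂ V x) (hW : DifferentiableAt ℂ W x)
    (hU : DifferentiableAt ℂ U x) (hVN : ∀ᶠ y in 𝓝 x, V y ∈ nullSpace θ y)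
    (hWN : ∀ᶠ y in 𝓝 x, W y ∈ nullSpace θ y) (hUk : ∀ᶠ y in 𝓝 x, θ y (U y) = 0) :
    fderiv ℂ θ x (U x) (fderiv ℂ V x (W x) - fderiv ℂ W x (V x)) =
      fderiv ℂ θ x (fderiv ℂ V x (W x) - fderiv ℂ W x (V x)) (U x) := by
  have hθd : DifferentiableAt ℂ θ x := hθ.differentiableAt (by simp)
  have hA : DifferentiableAt ℂ (fderiv ℂ θ) x :=
    (hθ.fderiv_right (m := ω) (by simp)).differentiableAt (by simp)
  have hS (a b : E) : fderiv ℂ (fderiv ℂ θ) x a b = fderiv ℂ (fderiv ℂ θ) x b a :=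
    (hθ.isSymmSndFDerivAt (by simp)) a b
  have hVk := hVN.mono fun y hy => hy.1
  have hWk := hWN.mono fun y hy => hy.1
  have key {V U : E → E} (hV : DifferentiableAt ℂ V x) (hU : DifferentiableAt ℂ U x)
      (h : ∀ᶠ y in 𝓝 x, fderiv ℂ θ y (U y) (V y) = fderiv ℂ θ y (V y) (U y)) (z : E) :
      fderiv ℂ θ x (U x) (fderiv ℂ V x z) +
        (fderiv ℂ θ x (fderiv ℂ U x z) (V x) + fderiv ℂ (fderiv ℂ θ) x z (U x) (V x)) =
      fderiv ℂ θ x (V x) (fderiv ℂ U x z) +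
        (fderiv ℂ θ x (fderiv ℂ V x z) (U x) + fderiv ℂ (fderiv ℂ θ) x z (V x) (U x)) := by
    have h1 := (hA.hasFDerivAt.clm_apply hU.hasFDerivAt).clm_apply hV.hasFDerivAt
    have h2 := (hA.hasFDerivAt.clm_apply hV.hasFDerivAt).clm_apply hU.hasFDerivAt
    simpa using DFunLike.congr_fun (h1.unique (h2.congr_of_eventuallyEq h)) z
  have hVU : ∀ᶠ y in 𝓝 x, fderiv ℂ θ y (U y) (V y) = fderiv ℂ θ y (V y) (U y) := by
    filter_upwards [hVN, hUk] with y h1 h2 using h1.2 _ h2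
  have hWU : ∀ᶠ y in 𝓝 x, fderiv ℂ θ y (U y) (W y) = fderiv ℂ θ y (W y) (U y) := by
    filter_upwards [hWN, hUk] with y h1 h2 using h1.2 _ h2
  have hVW : ∀ᶠ y in 𝓝 x, fderiv ℂ θ y (W y) (V y) = fderiv ℂ θ y (V y) (W y) := by
    filter_upwards [hVN, hWN] with y h1 h2 using h1.2 _ h2.1
  -- Each of the three relations `dθ = 0` between two of the fields is differentiated along the
  -- third. In the alternating sum the second derivatives of `θ` cancel by symmetry, which is `d(dθ)
  -- = 0`, and pairings with brackets remain.
  have h1 := key hV hU hVU (W x)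
  have h2 := key hW hU hWU (V x)
  have h3 := key hV hW hVW (U x)
  have bracket {W U : E → E} (hW : DifferentiableAt ℂ W x) (hU : DifferentiableAt ℂ U x)
      (hWk : ∀ᶠ y in 𝓝 x, θ y (W y) = 0) (hUk : ∀ᶠ y in 𝓝 x, θ y (U y) = 0)
      (hWU : ∀ᶠ y in 𝓝 x, fderiv ℂ θ y (U y) (W y) = fderiv ℂ θ y (W y) (U y)) :
      θ x (fderiv ℂ W x (U x) - fderiv ℂ U x (W x)) = 0 := by
    rw [apply_fderiv_sub_of_ker hθd hW hU hWk hUk, sub_eq_zero]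
    exact hWU.self_of_nhds.symm
  -- The brackets of `U` with `W` and `V` lie only in `Ker θ`, but that suffices to pair to zero
  -- with the null fields `V` and `W` respectively.
  have h4 := hVN.self_of_nhds.2 _ (bracket hW hU hWk hUk hWU)
  have h5 := hWN.self_of_nhds.2 _ (bracket hV hU hVk hUk hVU)
  rw [hS (W x) (U x), hS (W x) (V x)] at h1
  rw [hS (V x) (U x)] at h2
  simp only [map_sub, _root_.sub_apply] at h4 h5 ⊢
  linear_combination h1 - h2 - h3 + h4 - h5

end NullSpace

/-! ### Analytic families of kernels of constant dimension -/

section KernelFamily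

variable {E G : Type*} [NormedAddCommGroup E] [NormedSpace ℂ E] [FiniteDimensional ℂ E]
  [NormedAddCommGroup G] [NormedSpace ℂ G] [FiniteDimensional ℂ G]

/-- The kernels of an analytic family of linear maps, if they have constant dimension, are locally
parametrized by an analytic family of operators. -/
theorem exists_kernel_parametrization {T : E → E →L[ℂ] G} {p : E} {k : ℕ}
    (hT : ContDiffAt ℂ ω T p)
    (hk : ∀ᶠ x in 𝓝 p, Module.finrank ℂ (LinearMap.ker (T x).toLinearMap) = k) :
    ∃ (P : E →L[ℂ] E) (X : E → E →L[ℂ] E), ContDiffAt ℂ ω X p ∧ (∀ v, P (P v) = P v) ∧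
      Module.finrank ℂ (LinearMap.range P.toLinearMap) = k ∧
      ∀ᶠ x in 𝓝 p, (∀ v, X x (P v) = X x v) ∧ (∀ v, P (X x v) = P v) ∧
        LinearMap.range (X x).toLinearMap = LinearMap.ker (T x).toLinearMap := by
  have : CompleteSpace E := FiniteDimensional.complete ℂ E
  obtain ⟨s, hs⟩ := (T p).toLinearMap.rangeRestrict.exists_rightInverse_of_surjective
    (LinearMap.range_rangeRestrict _)
  obtain ⟨S₀, hS₀⟩ := LinearMap.exists_extend s
  let S : G →L[ℂ] E := S₀.toContinuousLinearMap
  have hTS (v : E) : T p (S (T p v)) = T p v := by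
    have h1 : S₀ (T p v) = s ⟨T p v, v, rfl⟩ := DFunLike.congr_fun hS₀ ⟨T p v, v, rfl⟩
    have h2 := congrArg Subtype.val (DFunLike.congr_fun hs ⟨T p v, v, rfl⟩)
    change T p (S₀ (T p v)) = T p v
    rw [h1]
    exact h2
  let P : E →L[ℂ] E := ContinuousLinearMap.id ℂ E - S ∘L T p
  have hTP (v : E) : T p (P v) = 0 := by simp [P, hTS]
  have hPP (v : E) : P (P v) = P v := by
    change P v - S (T p (P v)) = P v
    rw [hTP, map_zero, sub_zero]
  have hrP : LinearMap.range P.toLinearMap = LinearMap.ker (T p).toLinearMap := by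
    ext v
    constructor
    · rintro ⟨u, rfl⟩; exact hTP u
    · intro hv
      have hv' : T p v = 0 := hv
      exact ⟨v, by simp [P, hv']⟩
  have hfP : Module.finrank ℂ (LinearMap.range P.toLinearMap) = k := by
    rw [hrP]; exact hk.self_of_nhds
  -- `M p` is the identity, so `M x` is invertible near `p`, and it agrees with `P` on the kernel of
  -- `T x`. Thus `(M x)⁻¹ ∘ P` fixes this kernel pointwise; its range has dimension `k`, so it is no
  -- larger.
  let M : E → E →L[ℂ] E := fun x => P + S ∘L T x
  have hM : ContDiffAt ℂ ω M p := contDiffAt_const.add (contDiffAt_const.clm_comp hT)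
  have hMp : M p = ContinuousLinearMap.id ℂ E := by ext v; simp [M, P]
  have hinv : ContDiffAt ℂ ω (ContinuousLinearMap.inverse : (E →L[ℂ] E) → E →L[ℂ] E) (M p) := by
    rw [hMp]
    exact contDiffAt_map_inverse (ContinuousLinearEquiv.refl ℂ E)
  have hunit : ∀ᶠ x in 𝓝 p, (M x).IsInvertible := by
    have h := hM.continuousAt.tendsto
    rw [hMp] at h
    exact h.eventually (ContinuousLinearEquiv.nhds (ContinuousLinearEquiv.refl ℂ E))
  refine ⟨P, fun x => (M x).inverse ∘L P,
    (hinv.comp p hM).clm_comp contDiffAt_const, hPP, hfP, ?_⟩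
  filter_upwards [hunit, hk] with x hx hkx
  obtain ⟨e, he⟩ := hx
  have hinve : (M x).inverse = e.symm := by rw [← he, ContinuousLinearMap.inverse_equiv]
  have heM (v : E) : e v = P v + S (T x v) := by
    have := DFunLike.congr_fun he v
    exact this
  have hker (v : E) (hv : T x v = 0) : e.symm (P v) = v := by
    rw [e.symm_apply_eq, heM, hv, map_zero, add_zero]
  have hrange : LinearMap.range ((M x).inverse ∘L P).toLinearMap =
      LinearMap.ker (T x).toLinearMap := by
    symm
    apply Submodule.eq_of_le_of_finrank_eq
    · intro v hv
      exact ⟨v, by rw [hinve]; exact hker v hv⟩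
    · rw [hkx, ← hfP, hinve]
      have : LinearMap.range ((e.symm : E →L[ℂ] E) ∘L P).toLinearMap =
          (LinearMap.range P.toLinearMap).map (e.symm.toLinearEquiv : E →ₗ[ℂ] E) :=
        LinearMap.range_comp _ _
      rw [this]
      exact (LinearEquiv.finrank_map_eq e.symm.toLinearEquiv _).symm
  refine ⟨fun v => by simp [hPP], fun v => ?_, hrange⟩
  have hv : T x (((M x).inverse ∘L P) v) = 0 := by
    have : ((M x).inverse ∘L P) v ∈ LinearMap.ker (T x).toLinearMap := hrange ▸ ⟨v, rfl⟩
    exact this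
  have h1 := heM (((M x).inverse ∘L P) v)
  rw [hv, map_zero, add_zero] at h1
  rw [← h1, hinve]
  exact e.apply_symm_apply _

end KernelFamily

/-! ### Local first integrals of the null spaces -/

section LocalFrobenius

/-- An operator-valued map on a finite-dimensional space is `C^n` if it is so pointwise. -/
theorem contDiffAt_clm_apply_of_finite {D E F : Type*} [NormedAddCommGroup D] [NormedSpace ℂ D]
    [NormedAddCommGroup E] [NormedSpace ℂ E] [FiniteDimensional ℂ E]
    [NormedAddCommGroup F] [NormedSpace ℂ F] {n : WithTop ℕ∞} {f : D → E →L[ℂ] F} {x : D}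
    (h : ∀ v, ContDiffAt ℂ n (fun y => f y v) x) : ContDiffAt ℂ n f x := by
  let d := Module.finrank ℂ E
  have hd : d = Module.finrank ℂ (Fin d → ℂ) := (Module.finrank_fin_fun ℂ).symm
  let e₁ := ContinuousLinearEquiv.ofFinrankEq hd
  let e₂ := (e₁.arrowCongr (1 : F ≃L[ℂ] F)).trans (ContinuousLinearEquiv.piRing (Fin d))
  rw [← Function.id_comp f, ← e₂.symm_comp_self]
  exact e₂.symm.contDiff.contDiffAt.comp x (contDiffAt_pi.2 fun i => h _)

variable {E : Type*} [NormedAddCommGroup E] [NormedSpace ℂ E] [FiniteDimensional ℂ E]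

/-- If the null spaces of `dθ` on the kernel of `θ` have constant dimension, they are the kernels of
the derivative of an analytic map. -/
theorem exists_first_integral_nullSpace {θ : E → E →L[ℂ] ℂ} {p : E} {k m : ℕ}
    (hθ : ContDiffAt ℂ ω θ p) (h0 : θ p ≠ 0)
    (hk : ∀ᶠ x in 𝓝 p, Module.finrank ℂ (nullSpace θ x) = k) (hm : m + k = Module.finrank ℂ E) :
    ∃ f : E → EuclideanSpace ℂ (Fin m), ContDiffAt ℂ ω f p ∧
      ∀ᶠ x in 𝓝 p, LinearMap.ker (fderiv ℂ f x).toLinearMap = nullSpace θ x := by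
  have : CompleteSpace E := FiniteDimensional.complete ℂ E
  obtain ⟨w, hw⟩ : ∃ w, θ p w ≠ 0 := by
    by_contra! h
    exact h0 (by ext v; simpa using h v)
  have hθev := hθ.eventually (by simp)
  have hθw : ContDiffAt ℂ ω (fun x => θ x w) p := hθ.clm_apply contDiffAt_const
  have hwev : ∀ᶠ x in 𝓝 p, θ x w ≠ 0 := hθw.continuousAt.eventually_ne hw
  -- `Q x` has values in `Ker (θ x)` and is multiplication by `θ x w ≠ 0` there. Testing `dθ`
  -- against `Q x u` for all `u` replaces the varying test space `Ker (θ x)`, so that the null space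
  -- becomes the kernel of one analytic family `T`.
  let Q : E → E →L[ℂ] E := fun x => θ x w • ContinuousLinearMap.id ℂ E - (θ x).smulRight w
  have hQ : ContDiffAt ℂ ω Q p := by
    have h1 : ContDiffAt ℂ ω (fun x => (θ x).smulRight w) p :=
      ((ContinuousLinearMap.smulRightL ℂ E E).flip w).contDiff.contDiffAt.comp p hθ
    exact (hθw.smul contDiffAt_const).sub h1
  have hQk (x u : E) : θ x (Q x u) = 0 := by simp [Q, mul_comm]
  have hQu (x u : E) (hu : θ x u = 0) : Q x u = θ x w • u := by simp [Q, hu]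
  let Ω : E → E →L[ℂ] E →L[ℂ] ℂ := fun x => fderiv ℂ θ x - (fderiv ℂ θ x).flip
  have hΩ : ContDiffAt ℂ ω Ω p := by
    have h1 := hθ.fderiv_right (m := ω) (by simp)
    refine contDiffAt_clm_apply_of_finite fun a => contDiffAt_clm_apply_of_finite fun b => ?_
    exact ((h1.clm_apply contDiffAt_const).clm_apply contDiffAt_const).sub
      ((h1.clm_apply contDiffAt_const).clm_apply contDiffAt_const)
  let T : E → E →L[ℂ] (E →L[ℂ] ℂ) × ℂ := fun x =>
    (((ContinuousLinearMap.compL ℂ E E ℂ).flip (Q x)) ∘L Ω x).prod (θ x)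
  have hT : ContDiffAt ℂ ω T p := by
    refine contDiffAt_clm_apply_of_finite fun v => ?_
    exact ((hΩ.clm_apply contDiffAt_const).clm_comp hQ).prodMk (hθ.clm_apply contDiffAt_const)
  have hTker : ∀ᶠ x in 𝓝 p, LinearMap.ker (T x).toLinearMap = nullSpace θ x := by
    filter_upwards [hwev] with x hx
    ext v
    rw [LinearMap.mem_ker, mem_nullSpace]
    change (((Ω x v) ∘L Q x), θ x v) = 0 ↔ _
    rw [Prod.mk_eq_zero, and_comm]
    refine and_congr_right fun hv => ⟨fun h u hu => ?_, fun h => ?_⟩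
    · have := DFunLike.congr_fun h u
      rw [ContinuousLinearMap.comp_apply, hQu x u hu] at this
      simp only [map_smul, smul_eq_mul, _root_.zero_apply, mul_eq_zero, hx, false_or, Ω,
        _root_.sub_apply, ContinuousLinearMap.flip_apply] at this
      exact (sub_eq_zero.1 this).symm
    · ext u
      have := h _ (hQk x u)
      simp [Ω, this]
  obtain ⟨P, X, hX, hP, hfP, hPX⟩ := exists_kernel_parametrization hT
    (k := k) (by filter_upwards [hTker, hk] with x h1 h2; rw [h1, h2])
  have hrX : ∀ᶠ x in 𝓝 p, LinearMap.range (X x).toLinearMap = nullSpace θ x := by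
    filter_upwards [hPX, hTker] with x h1 h2 using h1.2.2.trans h2
  have hXN : ∀ᶠ x in 𝓝 p, ∀ a, X x a ∈ nullSpace θ x := by
    filter_upwards [hrX] with x hx a
    rw [← hx]; exact ⟨a, rfl⟩
  -- The bracket `β` of two fields of the normalized frame lies in the null space, hence in the
  -- range of `X x`. It is also killed by `P`, since `P (X y a) = P a` does not depend on `y`. As
  -- `P` is injective on that range, `β = 0`: the frame commutes.
  have hinv : ∀ᶠ x in 𝓝 p, ∀ a c, fderiv ℂ X x (X x a) c = fderiv ℂ X x (X x c) a := by
    filter_upwards [hX.eventually (by simp), hXN.eventually_nhds, hPX.eventually_nhds, hrX, hθev,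
      hwev] with x hXx hXNx hPXx hrXx hθx hwx a c
    have hd (a : E) : HasFDerivAt (fun y => X y a) ((fderiv ℂ X x).flip a) x := by
      simpa using (hXx.differentiableAt (by simp)).hasFDerivAt.clm_apply (hasFDerivAt_const a x)
    have hθd := (hθx.differentiableAt (by simp))
    have hVk (a : E) : ∀ᶠ y in 𝓝 x, θ y (X y a) = 0 := hXNx.mono fun y hy => (hy a).1
    have hUd (u : E) : DifferentiableAt ℂ (fun y => Q y u) x := by
      have h1 : DifferentiableAt ℂ (fun y => θ y w • u - θ y u • w) x := by fun_prop
      simpa [Q] using h1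
    set β := fderiv ℂ X x (X x a) c - fderiv ℂ X x (X x c) a with hβ
    have hβ' : β = fderiv ℂ (fun y => X y c) x (X x a) - fderiv ℂ (fun y => X y a) x (X x c) := by
      rw [(hd a).fderiv, (hd c).fderiv]; rfl
    have hβN : β ∈ nullSpace θ x := by
      rw [hβ']
      refine mem_nullSpace.2 ⟨?_, fun u hu => ?_⟩
      · rw [apply_fderiv_sub_of_ker hθd (hd c).differentiableAt (hd a).differentiableAt
          (hVk c) (hVk a), sub_eq_zero]
        exact (hXNx.self_of_nhds a).2 _ (hXNx.self_of_nhds c).1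
      · have := fderiv_bracket_of_null hθx (hd c).differentiableAt (hd a).differentiableAt (hUd u)
          (hXNx.mono fun y hy => hy c) (hXNx.mono fun y hy => hy a)
          (Filter.Eventually.of_forall fun y => hQk y u)
        simp only [hQu x u hu, map_smul, _root_.smul_apply, smul_eq_mul] at this
        exact mul_left_cancel₀ hwx this
    rw [← hrXx] at hβN
    obtain ⟨e, he⟩ := hβN
    have hPd (a z : E) : P (fderiv ℂ X x z a) = 0 := by
      have h1 := P.hasFDerivAt.comp x (hd a)
      have h2 : HasFDerivAt (P ∘ fun y => X y a) (0 : E →L[ℂ] E) x :=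
        (hasFDerivAt_const (P a) x).congr_of_eventuallyEq
        (hPXx.mono fun y hy => hy.2.1 a)
      exact DFunLike.congr_fun (h1.unique h2) z
    have hPβ : P β = 0 := by rw [hβ, map_sub, hPd, hPd, sub_zero]
    have hXe : X x e = β := he
    have h0 : β = 0 := by
      rw [← hXe, hPXx.self_of_nhds.2.1] at hPβ
      rw [← hXe, ← hPXx.self_of_nhds.1, hPβ, map_zero]
    exact sub_eq_zero.1 h0
  have hfin : Module.finrank ℂ (E ⧸ LinearMap.range P.toLinearMap) =
      Module.finrank ℂ (EuclideanSpace ℂ (Fin m)) := by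
    have := Submodule.finrank_quotient_add_finrank (LinearMap.range P.toLinearMap)
    rw [hfP] at this
    simp only [finrank_euclideanSpace, Fintype.card_fin]
    omega
  let l : E →ₗ[ℂ] EuclideanSpace ℂ (Fin m) :=
    (LinearEquiv.ofFinrankEq _ _ hfin).toLinearMap ∘ₗ (LinearMap.range P.toLinearMap).mkQ
  obtain ⟨f, hf, hf'⟩ := exists_first_integral_of_commuting hX hinv P hP
    (hPX.mono fun x hx => hx.1) (hPX.mono fun x hx => hx.2.1) l.toContinuousLinearMap fun v => by
      simp only [l, LinearMap.coe_toContinuousLinearMap', LinearMap.comp_apply,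
        LinearEquiv.coe_coe, LinearEquiv.map_eq_zero_iff, Submodule.mkQ_apply,
        Submodule.Quotient.mk_eq_zero]
      exact ⟨by rintro ⟨u, rfl⟩; exact hP u, fun h => ⟨v, h⟩⟩
  exact ⟨f, hf, by filter_upwards [hf', hrX] with x h1 h2 using h1.trans h2⟩

end LocalFrobenius

/-! ### Holomorphic charts with values in an arbitrary normed space -/

section AnalyticChart

variable {E : Type*} [NormedAddCommGroup E] [NormedSpace ℂ E]
  {M : Type*} [TopologicalSpace M] [ChartedSpace E M]
  {V : Type*} [NormedAddCommGroup V] [NormedSpace ℂ V]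

/-- A chart with values in an arbitrary normed space that is holomorphic together with its
inverse. -/
structure IsAnalyticChart (Φ : OpenPartialHomeomorph M V) : Prop where
  contMDiffOn : ContMDiffOn 𝓘(ℂ, E) 𝓘(ℂ, V) ω Φ Φ.source
  contMDiffOn_symm : ContMDiffOn 𝓘(ℂ, V) 𝓘(ℂ, E) ω Φ.symm Φ.target

namespace IsAnalyticChart

variable {Φ : OpenPartialHomeomorph M V}

theorem contMDiffAt (h : IsAnalyticChart (E := E) Φ) {y : M} (hy : y ∈ Φ.source) :
    ContMDiffAt 𝓘(ℂ, E) 𝓘(ℂ, V) ω Φ y :=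
  h.contMDiffOn.contMDiffAt (Φ.open_source.mem_nhds hy)

theorem contMDiffAt_symm (h : IsAnalyticChart (E := E) Φ) {q : V} (hq : q ∈ Φ.target) :
    ContMDiffAt 𝓘(ℂ, V) 𝓘(ℂ, E) ω Φ.symm q :=
  h.contMDiffOn_symm.contMDiffAt (Φ.open_target.mem_nhds hq)

theorem mdifferentiable (h : IsAnalyticChart (E := E) Φ) :
    Φ.MDifferentiable 𝓘(ℂ, E) 𝓘(ℂ, V) :=
  ⟨h.contMDiffOn.mdifferentiableOn (by simp), h.contMDiffOn_symm.mdifferentiableOn (by simp)⟩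

theorem mfderiv_mfderiv_symm (h : IsAnalyticChart (E := E) Φ) {q : V} (hq : q ∈ Φ.target) (u : V) :
    mfderiv 𝓘(ℂ, E) 𝓘(ℂ, V) Φ (Φ.symm q) (mfderiv 𝓘(ℂ, V) 𝓘(ℂ, E) Φ.symm q u) = u :=
  DFunLike.congr_fun (h.mdifferentiable.comp_symm_deriv hq) u

theorem mfderiv_symm_mfderiv (h : IsAnalyticChart (E := E) Φ) {q : V} (hq : q ∈ Φ.target)
    (v : TangentSpace 𝓘(ℂ, E) (Φ.symm q)) :
    mfderiv 𝓘(ℂ, V) 𝓘(ℂ, E) Φ.symm q (mfderiv 𝓘(ℂ, E) 𝓘(ℂ, V) Φ (Φ.symm q) v) = v := by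
  have h1 := DFunLike.congr_fun (h.mdifferentiable.symm_comp_deriv (Φ.map_target hq)) v
  rw [Φ.right_inv hq] at h1
  exact h1

/-- The derivative of the inverse of an analytic chart as a linear equivalence. -/
noncomputable def symmDeriv (h : IsAnalyticChart (E := E) Φ) {q : V} (hq : q ∈ Φ.target) :
    TangentSpace 𝓘(ℂ, V) q ≃L[ℂ] TangentSpace 𝓘(ℂ, E) (Φ.symm q) :=
  ContinuousLinearEquiv.equivOfInverse (mfderiv 𝓘(ℂ, V) 𝓘(ℂ, E) Φ.symm q)
    (mfderiv 𝓘(ℂ, E) 𝓘(ℂ, V) Φ (Φ.symm q)) (h.mfderiv_mfderiv_symm hq) (h.mfderiv_symm_mfderiv hq)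

theorem isInvertible_symm (h : IsAnalyticChart (E := E) Φ) {q : V} (hq : q ∈ Φ.target) :
    (mfderiv 𝓘(ℂ, V) 𝓘(ℂ, E) Φ.symm q).IsInvertible :=
  ⟨h.symmDeriv hq, rfl⟩

theorem inverse_mfderiv_symm (h : IsAnalyticChart (E := E) Φ) {q : V} (hq : q ∈ Φ.target) :
    (mfderiv 𝓘(ℂ, V) 𝓘(ℂ, E) Φ.symm q).inverse = mfderiv 𝓘(ℂ, E) 𝓘(ℂ, V) Φ (Φ.symm q) :=
  ContinuousLinearMap.inverse_equiv (h.symmDeriv hq)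

theorem inverse_mfderiv (h : IsAnalyticChart (E := E) Φ) {q : V} (hq : q ∈ Φ.target) :
    (mfderiv 𝓘(ℂ, E) 𝓘(ℂ, V) Φ (Φ.symm q)).inverse = mfderiv 𝓘(ℂ, V) 𝓘(ℂ, E) Φ.symm q :=
  ContinuousLinearMap.inverse_equiv (h.symmDeriv hq).symm

theorem isInvertible (h : IsAnalyticChart (E := E) Φ) {q : V} (hq : q ∈ Φ.target) :
    (mfderiv 𝓘(ℂ, E) 𝓘(ℂ, V) Φ (Φ.symm q)).IsInvertible :=
  ⟨(h.symmDeriv hq).symm, rfl⟩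

theorem mpullback_symm_apply (h : IsAnalyticChart (E := E) Φ) {q : V} (hq : q ∈ Φ.target)
    (W : ∀ y : M, TangentSpace 𝓘(ℂ, E) y) :
    VectorField.mpullback 𝓘(ℂ, V) 𝓘(ℂ, E) Φ.symm W q =
      mfderiv 𝓘(ℂ, E) 𝓘(ℂ, V) Φ (Φ.symm q) (W (Φ.symm q)) := by
  rw [VectorField.mpullback_apply, h.inverse_mfderiv_symm hq]
  rfl

theorem mpullback_apply (h : IsAnalyticChart (E := E) Φ) {q : V} (hq : q ∈ Φ.target) (W : V → V) :
    VectorField.mpullback 𝓘(ℂ, E) 𝓘(ℂ, V) Φ W (Φ.symm q) =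
      mfderiv 𝓘(ℂ, V) 𝓘(ℂ, E) Φ.symm q (W q) := by
  have h1 : W (Φ (Φ.symm q)) = W q := by rw [Φ.right_inv hq]
  change (mfderiv 𝓘(ℂ, E) 𝓘(ℂ, V) Φ (Φ.symm q)).inverse (W (Φ (Φ.symm q))) = _
  rw [h.inverse_mfderiv hq]
  exact congrArg (mfderiv 𝓘(ℂ, V) 𝓘(ℂ, E) Φ.symm q) h1

omit [NormedSpace ℂ V] in
theorem tendsto_symm {q : V} (hq : q ∈ Φ.target) :
    Filter.Tendsto Φ.symm (𝓝 q) (𝓝 (Φ.symm q)) := (Φ.symm.continuousAt hq).tendsto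

omit [NormedSpace ℂ V] in
theorem tendsto {q : V} (hq : q ∈ Φ.target) :
    Filter.Tendsto Φ (𝓝 (Φ.symm q)) (𝓝 q) := by
  have := (Φ.continuousAt (Φ.map_target hq)).tendsto
  rwa [Φ.right_inv hq] at this

end IsAnalyticChart

end AnalyticChart

/-! ### The Levi tensor in a chart -/

theorem mlieBracket_vectorSpace {V : Type*} [NormedAddCommGroup V] [NormedSpace ℂ V] (A B : V → V)
    (q : V) : VectorField.mlieBracket 𝓘(ℂ, V) A B q =
      fderiv ℂ B q (A q) - fderiv ℂ A q (B q) := by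
  have h := congrFun
    (VectorField.mlieBracketWithin_eq_lieBracketWithin (𝕜 := ℂ) (V := A) (W := B) (s := Set.univ)) q
  refine ((congrFun (VectorField.mlieBracketWithin_univ (I := 𝓘(ℂ, V)) (V := A) (W := B)) q).symm.trans
    h).trans ?_
  change fderivWithin ℂ B Set.univ q (A q) - fderivWithin ℂ A Set.univ q (B q) = _
  rw [fderivWithin_univ, fderivWithin_univ]

section LeviChart

set_option linter.unusedSectionVars false

variable {E : Type*} [NormedAddCommGroup E] [NormedSpace ℂ E] [FiniteDimensional ℂ E]
  {M : Type*} [TopologicalSpace M] [ChartedSpace E M] [IsManifold 𝓘(ℂ, E) ω M]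
  {V : Type*} [NormedAddCommGroup V] [NormedSpace ℂ V] [FiniteDimensional ℂ V]
  {Φ : OpenPartialHomeomorph M V} {q : V} {θ : V → V →L[ℂ] ℂ}
  {D : ∀ y : M, Submodule ℂ (TangentSpace 𝓘(ℂ, E) y)}

/-- A 1-form on a normed space represents a distribution in a chart near a point if its kernel
corresponds to the distribution. -/
def RepresentsAt (D : ∀ y : M, Submodule ℂ (TangentSpace 𝓘(ℂ, E) y)) (Φ : OpenPartialHomeomorph M V)
    (θ : V → V →L[ℂ] ℂ) (y : M) : Prop :=
  ∀ᶠ z in 𝓝 y, ∀ v, v ∈ D z ↔ θ (Φ z) (mfderiv 𝓘(ℂ, E) 𝓘(ℂ, V) Φ z v) = 0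

variable (hΦ : IsAnalyticChart (E := E) Φ) (hq : q ∈ Φ.target)

include hΦ hq

theorem contDiffAt_mpullback_symm {W : ∀ y : M, TangentSpace 𝓘(ℂ, E) y}
    (hW : ContMDiffAt 𝓘(ℂ, E) 𝓘(ℂ, E).tangent ω
      (fun y => (⟨y, W y⟩ : TangentBundle 𝓘(ℂ, E) M)) (Φ.symm q)) :
    ContDiffAt ℂ ω (VectorField.mpullback 𝓘(ℂ, V) 𝓘(ℂ, E) Φ.symm W) q := by
  have : CompleteSpace V := FiniteDimensional.complete ℂ V
  have : IsManifold 𝓘(ℂ, E) 1 M := IsManifold.of_le (n := ω) le_top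
  rw [← contMDiffAt_vectorSpace_iff_contDiffAt]
  exact hW.mpullback_vectorField_preimage (hΦ.contMDiffAt_symm hq) (hΦ.isInvertible_symm hq) le_rfl

theorem eventually_mpullback_symm_ker {W : ∀ y : M, TangentSpace 𝓘(ℂ, E) y}
    (hD : RepresentsAt D Φ θ (Φ.symm q)) (hW : ∀ᶠ y in 𝓝 (Φ.symm q), W y ∈ D y) :
    ∀ᶠ z in 𝓝 q, θ z (VectorField.mpullback 𝓘(ℂ, V) 𝓘(ℂ, E) Φ.symm W z) = 0 := by
  filter_upwards [(IsAnalyticChart.tendsto_symm hq).eventually (hD.and hW),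
    Φ.open_target.mem_nhds hq] with z hz hzt
  rw [hΦ.mpullback_symm_apply hzt]
  have := (hz.1 _).1 hz.2
  rwa [Φ.right_inv hzt] at this

/-- Pullback by the inverse chart commutes with brackets, so Cartan's formula computes the bracket
modulo `D` by `dθ`. In particular the vanishing depends only on the values of the two sections at
the point. -/
theorem leviPairing_eq_zero_iff (hθ : ContDiffAt ℂ ω θ q) (hD : RepresentsAt D Φ θ (Φ.symm q))
    (W₁ W₂ : localSections D (Φ.symm q)) :
    leviPairing D (Φ.symm q) W₁ W₂ = 0 ↔
      fderiv ℂ θ q (mfderiv 𝓘(ℂ, E) 𝓘(ℂ, V) Φ (Φ.symm q) (W₁.1 (Φ.symm q)))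
        (mfderiv 𝓘(ℂ, E) 𝓘(ℂ, V) Φ (Φ.symm q) (W₂.1 (Φ.symm q))) =
      fderiv ℂ θ q (mfderiv 𝓘(ℂ, E) 𝓘(ℂ, V) Φ (Φ.symm q) (W₂.1 (Φ.symm q)))
        (mfderiv 𝓘(ℂ, E) 𝓘(ℂ, V) Φ (Φ.symm q) (W₁.1 (Φ.symm q))) := by
  have : CompleteSpace E := FiniteDimensional.complete ℂ E
  have : CompleteSpace V := FiniteDimensional.complete ℂ V
  have : IsManifold 𝓘(ℂ, E) (minSmoothness ℂ 2) M := IsManifold.of_le (n := ω) le_top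
  have h1 := contDiffAt_mpullback_symm hΦ hq W₁.2.1
  have h2 := contDiffAt_mpullback_symm hΦ hq W₂.2.1
  have k1 := eventually_mpullback_symm_ker hΦ hq hD W₁.2.2
  have k2 := eventually_mpullback_symm_ker hΦ hq hD W₂.2.2
  have hb := VectorField.mpullback_mlieBracket (localSections_mdifferentiableAt D _ W₁)
    (localSections_mdifferentiableAt D _ W₂) (hΦ.contMDiffAt_symm hq)
    (by simp [minSmoothness_of_isRCLikeNormedField])
  have hc := apply_fderiv_sub_of_ker (hθ.differentiableAt (by simp))
    (h2.differentiableAt (by simp)) (h1.differentiableAt (by simp)) k2 k1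
  have hb' := ((hΦ.mpullback_symm_apply hq _).symm.trans hb).trans (mlieBracket_vectorSpace _ _ q)
  have e : leviPairing D (Φ.symm q) W₁ W₂ =
      (D (Φ.symm q)).mkQ (VectorField.mlieBracket 𝓘(ℂ, E) W₁.1 W₂.1 (Φ.symm q)) := rfl
  rw [e, Submodule.mkQ_apply, Submodule.Quotient.mk_eq_zero, hD.self_of_nhds, Φ.right_inv hq]
  refine (Eq.congr_left ((congrArg (θ q) hb').trans hc)).trans ?_
  rw [sub_eq_zero, eq_comm, hΦ.mpullback_symm_apply hq, hΦ.mpullback_symm_apply hq]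
  exact Iff.rfl

/-- The constant field `u` is corrected by the multiple of a fixed `w`, with `θ q w ≠ 0`, that
brings it into `Ker θ`; the correction vanishes at `q`. So the Levi tensor can be tested on all
vectors of `D`. -/
theorem exists_localSection (hθ : ContDiffAt ℂ ω θ q) (h0 : θ q ≠ 0)
    (hD : RepresentsAt D Φ θ (Φ.symm q)) {u : V} (hu : θ q u = 0) :
    ∃ W : localSections D (Φ.symm q),
      W.1 (Φ.symm q) = mfderiv 𝓘(ℂ, V) 𝓘(ℂ, E) Φ.symm q u := by
  have : CompleteSpace E := FiniteDimensional.complete ℂ E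
  have : CompleteSpace V := FiniteDimensional.complete ℂ V
  have : IsManifold 𝓘(ℂ, E) 1 M := IsManifold.of_le (n := ω) le_top
  obtain ⟨w, hw⟩ : ∃ w, θ q w ≠ 0 := by
    by_contra! h
    exact h0 (by ext v; simpa using h v)
  have hθc (v : V) : ContDiffAt ℂ ω (fun z => θ z v) q := hθ.clm_apply contDiffAt_const
  let U : V → V := fun z => u - (θ z u / θ z w) • w
  have hU : ContDiffAt ℂ ω U q :=
    contDiffAt_const.sub (((hθc u).div (hθc w) hw).smul contDiffAt_const)
  have hUk : ∀ᶠ z in 𝓝 q, θ z (U z) = 0 := by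
    filter_upwards [(hθc w).continuousAt.eventually_ne hw] with z hz
    simp [U, hz]
  have hUq : U q = u := by simp [U, hu]
  have hq' : Φ (Φ.symm q) = q := Φ.right_inv hq
  refine ⟨⟨VectorField.mpullback 𝓘(ℂ, E) 𝓘(ℂ, V) Φ U, ?_, ?_⟩, ?_⟩
  · refine ContMDiffAt.mpullback_vectorField_preimage ?_ (hΦ.contMDiffAt (Φ.map_target hq))
      (hΦ.isInvertible hq) le_rfl
    have h1 : ContMDiffAt 𝓘(ℂ, V) 𝓘(ℂ, V).tangent ω
        (fun z => (⟨z, U z⟩ : TangentBundle 𝓘(ℂ, V) V)) q :=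
      contMDiffAt_vectorSpace_iff_contDiffAt.2 hU
    exact hq'.symm ▸ h1
  · filter_upwards [hD, (IsAnalyticChart.tendsto hq).eventually hUk,
      Φ.open_source.mem_nhds (Φ.map_target hq)] with z hz hUz hzs
    rw [hz]
    obtain ⟨z', hz', rfl⟩ : ∃ z' ∈ Φ.target, Φ.symm z' = z :=
      ⟨Φ z, Φ.map_source hzs, Φ.left_inv hzs⟩
    rw [hΦ.mpullback_apply hz', hΦ.mfderiv_mfderiv_symm hz']
    rwa [Φ.right_inv hz'] at hUz ⊢
  · change VectorField.mpullback 𝓘(ℂ, E) 𝓘(ℂ, V) Φ U (Φ.symm q) = _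
    rw [hΦ.mpullback_apply hq, hUq]

/-- The null space of the Levi tensor in a chart. -/
theorem mem_leviNull_iff (hθ : ContDiffAt ℂ ω θ q) (h0 : θ q ≠ 0)
    (hD : RepresentsAt D Φ θ (Φ.symm q)) (v : TangentSpace 𝓘(ℂ, E) (Φ.symm q)) :
    v ∈ leviNull D (Φ.symm q) ↔ mfderiv 𝓘(ℂ, E) 𝓘(ℂ, V) Φ (Φ.symm q) v ∈ nullSpace θ q := by
  have hmem {w : TangentSpace 𝓘(ℂ, E) (Φ.symm q)} (hw : w ∈ D (Φ.symm q)) :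
      θ q (mfderiv 𝓘(ℂ, E) 𝓘(ℂ, V) Φ (Φ.symm q) w) = 0 := by
    have := (hD.self_of_nhds w).1 hw
    rwa [Φ.right_inv hq] at this
  constructor
  · rintro ⟨W, hW, rfl⟩
    refine ⟨hmem W.2.2.self_of_nhds, fun u hu => ?_⟩
    obtain ⟨U, hU⟩ := exists_localSection hΦ hq hθ h0 hD hu
    have := (leviPairing_eq_zero_iff hΦ hq hθ hD W U).1 (DFunLike.congr_fun hW U)
    rw [hU, hΦ.mfderiv_mfderiv_symm hq] at this
    exact this.symm
  · rintro ⟨hv1, hv2⟩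
    obtain ⟨W, hW⟩ := exists_localSection hΦ hq hθ h0 hD hv1
    rw [hΦ.mfderiv_symm_mfderiv hq] at hW
    refine ⟨W, ?_, hW⟩
    change leviPairing D (Φ.symm q) W = 0
    ext U
    refine (leviPairing_eq_zero_iff hΦ hq hθ hD W U).2 ?_
    rw [hW]
    exact (hv2 _ (hmem U.2.2.self_of_nhds)).symm

theorem finrank_nullSpace_eq (hθ : ContDiffAt ℂ ω θ q) (h0 : θ q ≠ 0)
    (hD : RepresentsAt D Φ θ (Φ.symm q)) :
    Module.finrank ℂ (nullSpace θ q) = Module.finrank ℂ (leviNull D (Φ.symm q)) := by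
  let e : V ≃ₗ[ℂ] TangentSpace 𝓘(ℂ, E) (Φ.symm q) := (hΦ.symmDeriv hq).toLinearEquiv
  have h : (nullSpace θ q).map (e : V →ₗ[ℂ] TangentSpace 𝓘(ℂ, E) (Φ.symm q)) =
      leviNull D (Φ.symm q) := by
    ext v
    rw [mem_leviNull_iff hΦ hq hθ h0 hD]
    constructor
    · rintro ⟨u, hu, rfl⟩
      have : mfderiv 𝓘(ℂ, E) 𝓘(ℂ, V) Φ (Φ.symm q) (mfderiv 𝓘(ℂ, V) 𝓘(ℂ, E) Φ.symm q u) = u :=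
        hΦ.mfderiv_mfderiv_symm hq u
      exact this.symm ▸ hu
    · intro hv
      exact ⟨_, hv, hΦ.mfderiv_symm_mfderiv hq v⟩
  rw [← h]
  exact (LinearEquiv.finrank_map_eq e _).symm

end LeviChart

/-! ### Straightening submersions and descending forms in coordinates -/

section VectorSpace

variable {E G F H : Type*} [NormedAddCommGroup E] [NormedSpace ℂ E]
  [NormedAddCommGroup G] [NormedSpace ℂ G] [NormedAddCommGroup F] [NormedSpace ℂ F]
  [NormedAddCommGroup H] [NormedSpace ℂ H]

/-- A map whose derivative vanishes in the direction of the second factor depends locally only on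
the first variable. -/
theorem eventually_eq_of_fderiv_snd_eq_zero {g : G × F → H} {q : G × F}
    (hg : ∀ᶠ z in 𝓝 q, DifferentiableAt ℂ g z ∧ ∀ c, fderiv ℂ g z (0, c) = 0) :
    ∀ᶠ z in 𝓝 q, g z = g (z.1, q.2) := by
  obtain ⟨r, hr, h⟩ := Metric.eventually_nhds_iff_ball.1 hg
  filter_upwards [Metric.ball_mem_nhds q hr] with z hz
  rw [← Prod.mk.eta (p := q), ← ball_prod_same] at hz
  have hd (c : F) (hc : c ∈ Metric.ball q.2 r) :
      HasFDerivAt (fun c => g (z.1, c)) (0 : F →L[ℂ] H) c := by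
    have hzc : (z.1, c) ∈ Metric.ball q r := by
      rw [← Prod.mk.eta (p := q), ← ball_prod_same]; exact ⟨hz.1, hc⟩
    have h1 := (h _ hzc).1.hasFDerivAt.comp c (hasFDerivAt_prodMk_right z.1 c)
    refine h1.congr_fderiv ?_
    ext v
    exact (h _ hzc).2 v
  exact Metric.isOpen_ball.is_const_of_fderiv_eq_zero (convex_ball q.2 r).isPreconnected
    (fun c hc => (hd c hc).differentiableAt.differentiableWithinAt)
    (fun c hc => (hd c hc).fderiv) hz.2 (Metric.mem_ball_self hr)

/-- An analytic submersion between finite-dimensional spaces is locally the first component of an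
analytic change of coordinates. -/
theorem exists_straightening [FiniteDimensional ℂ E] [FiniteDimensional ℂ G]
    [FiniteDimensional ℂ F] {f : E → G} {p : E} (hf : ContDiffAt ℂ ω f p)
    (hs : Function.Surjective (fderiv ℂ f p))
    (hdim : Module.finrank ℂ G + Module.finrank ℂ F = Module.finrank ℂ E) :
    ∃ Φ : OpenPartialHomeomorph E (G × F), p ∈ Φ.source ∧ ContDiffOn ℂ ω Φ Φ.source ∧
      ContDiffOn ℂ ω Φ.symm Φ.target ∧ ∀ x ∈ Φ.source, (Φ x).1 = f x := by
  have : CompleteSpace E := FiniteDimensional.complete ℂ E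
  have : CompleteSpace (G × F) := FiniteDimensional.complete ℂ _
  have hker : Module.finrank ℂ (LinearMap.ker (fderiv ℂ f p).toLinearMap) =
      Module.finrank ℂ F := by
    have h1 := LinearMap.finrank_range_add_finrank_ker (fderiv ℂ f p).toLinearMap
    rw [LinearMap.range_eq_top.2 hs, finrank_top] at h1
    omega
  -- An isomorphism from the kernel of the derivative onto `F`, extended to `E`, supplies the
  -- missing coordinates: `(f, l)` has bijective derivative at `p`.
  obtain ⟨l, hl⟩ := LinearMap.exists_extend (LinearEquiv.ofFinrankEq _ _ hker).toLinearMap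
  have hl' (v : E) (hv : fderiv ℂ f p v = 0) (hlv : l v = 0) : v = 0 := by
    have h1 : l v = LinearEquiv.ofFinrankEq _ _ hker ⟨v, hv⟩ :=
      (DFunLike.congr_fun hl ⟨v, hv⟩)
    rw [hlv] at h1
    have h2 := (LinearEquiv.map_eq_zero_iff _).1 h1.symm
    exact congrArg Subtype.val h2
  let h : E → G × F := fun x => (f x, l.toContinuousLinearMap x)
  have hh : ContDiffAt ℂ ω h p := hf.prodMk l.toContinuousLinearMap.contDiff.contDiffAt
  let h' : E →L[ℂ] G × F := (fderiv ℂ f p).prod l.toContinuousLinearMap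
  have hinj : Function.Injective h'.toLinearMap := by
    rw [injective_iff_map_eq_zero]
    intro v hv
    have hv' : (fderiv ℂ f p v, l v) = (0, 0) := hv
    rw [Prod.mk.injEq] at hv'
    exact hl' v hv'.1 hv'.2
  have hdim' : Module.finrank ℂ E = Module.finrank ℂ (G × F) := by
    rw [Module.finrank_prod, hdim]
  let e : E ≃L[ℂ] G × F :=
    (LinearMap.linearEquivOfInjective h'.toLinearMap hinj hdim').toContinuousLinearEquiv
  have he : HasFDerivAt h (e : E →L[ℂ] G × F) p := by
    have h1 : HasFDerivAt h h' p :=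
      (hf.differentiableAt (by simp)).hasFDerivAt.prodMk l.toContinuousLinearMap.hasFDerivAt
    exact h1
  let Φ₀ := hh.toOpenPartialHomeomorph h he (by simp)
  have hΦ₀ : ∀ x, Φ₀ x = h x := fun x => rfl
  have hp : p ∈ Φ₀.source := hh.mem_toOpenPartialHomeomorph_source he (by simp)
  have hsymm : ContDiffAt ℂ ω Φ₀.symm (h p) := hh.to_localInverse he (by simp)
  let Φ := Φ₀.restrContDiff ℂ ω (by simp)
  refine ⟨Φ, ⟨hp, hh, hsymm⟩, fun x hx => hx.2.1.contDiffWithinAt,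
    fun x hx => hx.2.1.contDiffWithinAt, fun x hx => rfl⟩

/-- If the null space of `dθ` on the kernel of `θ` is the second factor of a product, then the
kernel of `θ` is locally the preimage of the kernel of a 1-form on the first factor. -/
theorem exists_form_on_fst [FiniteDimensional ℂ G] {θ : G × F → G × F →L[ℂ] ℂ} {q : G × F}
    (hθ : ContDiffAt ℂ ω θ q) (h0 : θ q ≠ 0)
    (hN : ∀ᶠ z in 𝓝 q, ∀ c : F, ((0 : G), c) ∈ nullSpace θ z) :
    ∃ σ : G → G →L[ℂ] ℂ, ContDiffAt ℂ ω σ q.1 ∧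
      ∀ᶠ z in 𝓝 q, ∀ u : G × F, θ z u = 0 ↔ σ z.1 u.1 = 0 := by
  have hθN : ∀ᶠ z in 𝓝 q, ∀ c : F, θ z (0, c) = 0 := hN.mono fun z hz c => (hz c).1
  have hsplit (z : G × F) (hz : ∀ c : F, θ z (0, c) = 0) (u : G × F) : θ z u = θ z (u.1, 0) := by
    have : u = (u.1, 0) + (0, u.2) := by simp
    conv_lhs => rw [this, map_add, hz, add_zero]
  obtain ⟨d, hd⟩ : ∃ d : G, θ q (d, 0) ≠ 0 := by
    by_contra! h
    exact h0 (by ext v <;> simp [h, hθN.self_of_nhds])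
  have hdc : ContDiffAt ℂ ω (fun z => θ z (d, 0)) q := hθ.clm_apply contDiffAt_const
  -- The kernel determines the form only up to a factor. Normalizing the value on `(d, 0)` to 1
  -- fixes this factor, and the result is constant along `F`.
  let τ : G × F → G →L[ℂ] ℂ := fun z => (θ z (d, 0))⁻¹ • (θ z ∘L .inl ℂ G F)
  have hτ : ContDiffAt ℂ ω τ q := (hdc.inv hd).smul (hθ.clm_comp contDiffAt_const)
  have hτ0 : ∀ᶠ z in 𝓝 q, DifferentiableAt ℂ τ z ∧ ∀ c, fderiv ℂ τ z (0, c) = 0 := by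
    filter_upwards [hτ.eventually (by simp), hθ.eventually (by simp), hN, hθN.eventually_nhds,
      hdc.continuousAt.eventually_ne hd] with z hτz hθz hNz hθNz hdz
    refine ⟨hτz.differentiableAt (by simp), fun c => ?_⟩
    have hθd := (hθz.differentiableAt (by simp)).hasFDerivAt
    have hev (v : G × F) : HasFDerivAt (fun y => θ y v) ((fderiv ℂ θ z).flip v) z := by
      simpa using hθd.clm_apply (hasFDerivAt_const v z)
    have h1 (u : G × F) : fderiv ℂ θ z u (0, c) = 0 := by
      have h2 : HasFDerivAt (fun y => θ y (0, c)) (0 : G × F →L[ℂ] ℂ) z :=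
        (hasFDerivAt_const (0 : ℂ) z).congr_of_eventuallyEq (hθNz.mono fun y hy => hy c)
      exact DFunLike.congr_fun ((hev (0, c)).unique h2) u
    -- As `θ (0, c)` vanishes identically, nullity of `(0, c)` says that the derivative of `θ` along
    -- `(0, c)` vanishes on `Ker θ`: `θ` changes along `F` only by a factor. Applied to a
    -- combination of `(b, 0)` and `(d, 0)` in the kernel, this gives the derivative of the quotient
    -- `τ`.
    have h2 (u : G × F) (hu : θ z u = 0) : fderiv ℂ θ z (0, c) u = 0 := by
      rw [← (hNz c).2 u hu, h1]
    ext b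
    have h3 := h2 (θ z (d, 0) • (b, 0) - θ z (b, 0) • (d, 0))
      (by rw [map_sub, map_smul, map_smul, smul_eq_mul, smul_eq_mul, mul_comm, sub_self])
    simp only [map_sub, map_smul, smul_eq_mul, sub_eq_zero] at h3
    have h4 : HasFDerivAt (fun y => τ y b) ((fderiv ℂ τ z).flip b) z := by
      simpa using (hτz.differentiableAt (by simp)).hasFDerivAt.clm_apply (hasFDerivAt_const b z)
    have h5 : HasFDerivAt (fun y => τ y b * θ y (d, 0)) ((fderiv ℂ θ z).flip (b, 0)) z := by
      refine (hev (b, 0)).congr_of_eventuallyEq ?_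
      filter_upwards [(hev (d, 0)).continuousAt.eventually_ne hdz] with y hy
      simp only [τ, _root_.smul_apply, ContinuousLinearMap.comp_apply,
        ContinuousLinearMap.inl_apply, smul_eq_mul]
      field_simp
    have h6 := DFunLike.congr_fun ((h4.mul (hev (d, 0))).unique h5) (0, c)
    simp only [_root_.add_apply, _root_.smul_apply, ContinuousLinearMap.flip_apply,
      smul_eq_mul] at h6
    have h7 : τ z b * θ z (d, 0) = θ z (b, 0) := by
      simp only [τ, _root_.smul_apply, ContinuousLinearMap.comp_apply,
        ContinuousLinearMap.inl_apply, smul_eq_mul]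
      field_simp
    have h8 : θ z (d, 0) * (θ z (d, 0) * fderiv ℂ τ z (0, c) b) = 0 := by
      linear_combination θ z (d, 0) * h6 + h3 - fderiv ℂ θ z (0, c) (d, 0) * h7
    simpa [hdz] using h8
  refine ⟨fun b => τ (b, q.2), ?_, ?_⟩
  · exact ContDiffAt.comp (g := τ) q.1 hτ (contDiffAt_id.prodMk contDiffAt_const)
  · filter_upwards [eventually_eq_of_fderiv_snd_eq_zero hτ0, hθN,
      hdc.continuousAt.eventually_ne hd] with z h1 h2 h3 u
    rw [← h1, hsplit z h2]
    simp [τ, h3]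

end VectorSpace

/-! ### Straightening submersions on manifolds -/

section Straightening

set_option linter.unusedSectionVars false

variable {E : Type*} [NormedAddCommGroup E] [NormedSpace ℂ E]
  {M : Type*} [TopologicalSpace M] [ChartedSpace E M] [IsManifold 𝓘(ℂ, E) ω M]
  {G F : Type*} [NormedAddCommGroup G] [NormedSpace ℂ G] [NormedAddCommGroup F] [NormedSpace ℂ F]

theorem isAnalyticChart_chartAt (y : M) : IsAnalyticChart (E := E) (chartAt E y) :=
  ⟨contMDiffOn_chart, contMDiffOn_chart_symm⟩

theorem IsAnalyticChart.trans {V W : Type*} [NormedAddCommGroup V] [NormedSpace ℂ V]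
    [NormedAddCommGroup W] [NormedSpace ℂ W] {Φ : OpenPartialHomeomorph M V}
    (hΦ : IsAnalyticChart (E := E) Φ) {Ψ : OpenPartialHomeomorph V W}
    (h : ContDiffOn ℂ ω Ψ Ψ.source) (h' : ContDiffOn ℂ ω Ψ.symm Ψ.target) :
    IsAnalyticChart (E := E) (Φ.trans Ψ) := by
  constructor
  · refine ContMDiffOn.comp (t := Ψ.source) h.contMDiffOn
      (hΦ.contMDiffOn.mono fun x hx => ?_) fun x hx => ?_
    · simp only [OpenPartialHomeomorph.trans_source, Set.mem_inter_iff] at hx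
      exact hx.1
    · simp only [OpenPartialHomeomorph.trans_source, Set.mem_inter_iff] at hx
      exact hx.2
  · refine ContMDiffOn.comp (t := Φ.target) hΦ.contMDiffOn_symm
      (h'.contMDiffOn.mono fun x hx => ?_) fun x hx => ?_
    · simp only [OpenPartialHomeomorph.trans_target, Set.mem_inter_iff] at hx
      exact hx.1
    · simp only [OpenPartialHomeomorph.trans_target, Set.mem_inter_iff] at hx
      exact hx.2

theorem ContMDiffAt.contDiffAt_comp_symm {V : Type*} [NormedAddCommGroup V] [NormedSpace ℂ V]
    {Φ : OpenPartialHomeomorph M V} (hΦ : IsAnalyticChart (E := E) Φ) {q : V} (hq : q ∈ Φ.target)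
    {f : M → G} (hf : ContMDiffAt 𝓘(ℂ, E) 𝓘(ℂ, G) ω f (Φ.symm q)) :
    ContDiffAt ℂ ω (f ∘ Φ.symm) q :=
  (hf.comp q (hΦ.contMDiffAt_symm hq)).contDiffAt

theorem fderiv_comp_symm_apply {V : Type*} [NormedAddCommGroup V] [NormedSpace ℂ V]
    {Φ : OpenPartialHomeomorph M V} (hΦ : IsAnalyticChart (E := E) Φ) {q : V} (hq : q ∈ Φ.target)
    {f : M → G} (hf : MDifferentiableAt 𝓘(ℂ, E) 𝓘(ℂ, G) f (Φ.symm q)) (u : V) :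
    fderiv ℂ (f ∘ Φ.symm) q u =
      mfderiv 𝓘(ℂ, E) 𝓘(ℂ, G) f (Φ.symm q) (mfderiv 𝓘(ℂ, V) 𝓘(ℂ, E) Φ.symm q u) := by
  rw [← mfderiv_eq_fderiv, mfderiv_comp q hf ((hΦ.contMDiffAt_symm hq).mdifferentiableAt (by simp))]
  rfl

/-- A holomorphic submersion is locally the first component of an analytic chart. -/
theorem exists_analyticChart_fst [FiniteDimensional ℂ E] [FiniteDimensional ℂ G]
    [FiniteDimensional ℂ F] {f : M → G} {y : M} (hf : ContMDiffAt 𝓘(ℂ, E) 𝓘(ℂ, G) ω f y)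
    (hs : Function.Surjective (mfderiv 𝓘(ℂ, E) 𝓘(ℂ, G) f y))
    (hdim : Module.finrank ℂ G + Module.finrank ℂ F = Module.finrank ℂ E) :
    ∃ Φ : OpenPartialHomeomorph M (G × F), y ∈ Φ.source ∧ IsAnalyticChart (E := E) Φ ∧
      ∀ x ∈ Φ.source, (Φ x).1 = f x := by
  obtain ⟨e, he, hy⟩ : ∃ e : OpenPartialHomeomorph M E, IsAnalyticChart (E := E) e ∧ y ∈ e.source :=
    ⟨chartAt E y, isAnalyticChart_chartAt y, mem_chart_source E y⟩
  obtain ⟨q, hq, rfl⟩ : ∃ q ∈ e.target, e.symm q = y := ⟨_, e.map_source hy, e.left_inv hy⟩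
  obtain ⟨Φ, hqΦ, h1, h2, h3⟩ := exists_straightening (F := F) (p := q)
    (ContMDiffAt.contDiffAt_comp_symm he hq hf) (fun w => by
      obtain ⟨v, hv⟩ := hs w
      refine ⟨mfderiv 𝓘(ℂ, E) 𝓘(ℂ, E) e (e.symm q) v, ?_⟩
      refine (fderiv_comp_symm_apply he hq (hf.mdifferentiableAt (by simp)) _).trans ?_
      exact (congrArg (mfderiv 𝓘(ℂ, E) 𝓘(ℂ, G) f (e.symm q)) (he.mfderiv_symm_mfderiv hq v)).trans
        hv) hdim
  refine ⟨e.trans Φ, ?_, he.trans h1 h2, fun x hx => ?_⟩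
  · rw [OpenPartialHomeomorph.trans_source]
    refine ⟨hy, ?_⟩
    rw [Set.mem_preimage, e.right_inv hq]
    exact hqΦ
  · rw [OpenPartialHomeomorph.trans_source] at hx
    exact (h3 _ hx.2).trans (congrArg f (e.left_inv hx.1))

end Straightening

/-! ### Bundle-valued forms as scalar forms in charts -/

section FormInChart

set_option linter.unusedSectionVars false

variable {E : Type*} [NormedAddCommGroup E] [NormedSpace ℂ E]
  {M : Type*} [TopologicalSpace M] [ChartedSpace E M] [IsManifold 𝓘(ℂ, E) ω M]
  {L : M → Type*} [TopologicalSpace (TotalSpace ℂ L)] [∀ y, TopologicalSpace (L y)]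
  [∀ y, AddCommGroup (L y)] [∀ y, Module ℂ (L y)]
  [FiberBundle ℂ L] [VectorBundle ℂ ℂ L]
  [∀ y, IsTopologicalAddGroup (L y)] [∀ y, ContinuousSMul ℂ (L y)]
  {ϑ : ∀ y : M, TangentSpace 𝓘(ℂ, E) y →L[ℂ] L y}

theorem contMDiffAt_form_iff {y₀ : M} :
    ContMDiffAt 𝓘(ℂ, E) (𝓘(ℂ, E).prod 𝓘(ℂ, E →L[ℂ] ℂ)) ω
      (fun y => TotalSpace.mk' (E →L[ℂ] ℂ)
        (E := fun y => TangentSpace 𝓘(ℂ, E) y →L[ℂ] L y) y (ϑ y)) y₀ ↔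
    ContMDiffAt 𝓘(ℂ, E) 𝓘(ℂ, E →L[ℂ] ℂ) ω
      (fun y => ContinuousLinearMap.inCoordinates E (TangentSpace 𝓘(ℂ, E)) ℂ L y₀ y y₀ y (ϑ y)) y₀ :=
  (contMDiffAt_hom_bundle _).trans (and_iff_right contMDiffAt_id)

theorem inCoordinates_apply_mfderiv {y₀ y : M} (hy : y ∈ (chartAt E y₀).source)
    (v : TangentSpace 𝓘(ℂ, E) y) :
    ContinuousLinearMap.inCoordinates E (TangentSpace 𝓘(ℂ, E)) ℂ L y₀ y y₀ y (ϑ y)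
      (mfderiv 𝓘(ℂ, E) 𝓘(ℂ, E) (chartAt E y₀) y v) =
    (trivializationAt ℂ L y₀).continuousLinearMapAt ℂ y (ϑ y v) := by
  have : IsManifold 𝓘(ℂ, E) 1 M := IsManifold.of_le (n := ω) le_top
  have h1 := TangentBundle.continuousLinearMapAt_trivializationAt (I := 𝓘(ℂ, E)) hy
  have h2 : mfderiv 𝓘(ℂ, E) 𝓘(ℂ, E) (chartAt E y₀) y v =
      (trivializationAt E (TangentSpace 𝓘(ℂ, E)) y₀).continuousLinearMapAt ℂ y v :=
    (DFunLike.congr_fun h1 v).symm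
  have hb : y ∈ (trivializationAt E (TangentSpace 𝓘(ℂ, E) : M → Type _) y₀).baseSet := by
    rwa [TangentBundle.trivializationAt_baseSet]
  have h3 : (trivializationAt E (TangentSpace 𝓘(ℂ, E) : M → Type _) y₀).symmL ℂ y
      (mfderiv 𝓘(ℂ, E) 𝓘(ℂ, E) (chartAt E y₀) y v) = v :=
    (congrArg _ h2).trans (Bundle.Trivialization.symmL_continuousLinearMapAt _ hb v)
  exact congrArg (fun w => (trivializationAt ℂ L y₀).continuousLinearMapAt ℂ y (ϑ y w)) h3

theorem continuousLinearMapAt_eq_zero_iff {y₀ y : M} (hy : y ∈ (trivializationAt ℂ L y₀).baseSet)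
    (w : L y) : (trivializationAt ℂ L y₀).continuousLinearMapAt ℂ y w = 0 ↔ w = 0 := by
  have h := Bundle.Trivialization.coe_continuousLinearEquivAt_eq (R := ℂ) (trivializationAt ℂ L y₀) hy
  rw [← h]
  exact EmbeddingLike.map_eq_zero_iff

/-- The coordinate expression of `ϑ` at `Φ.symm q`, pulled back by the change of charts, has the
right kernel because the trivialization of `L` is injective on fibres. Arbitrary charts `Φ` are
allowed, since charts straightening a first integral are needed as well. -/
theorem exists_representsAt_kerForm (hϑ : IsNowhereVanishingForm ϑ)
    {V : Type*} [NormedAddCommGroup V] [NormedSpace ℂ V] {Φ : OpenPartialHomeomorph M V} {q : V}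
    (hΦ : IsAnalyticChart (E := E) Φ) (hq : q ∈ Φ.target) :
    ∃ θ : V → V →L[ℂ] ℂ, ContDiffAt ℂ ω θ q ∧ θ q ≠ 0 ∧
      RepresentsAt (kerForm ϑ) Φ θ (Φ.symm q) := by
  let e := chartAt E (Φ.symm q)
  have hA := (contMDiffAt_form_iff (y₀ := Φ.symm q)).1 hϑ.holomorphic.contMDiffAt
  have he := isAnalyticChart_chartAt (E := E) (Φ.symm q)
  have hes : Φ.symm q ∈ e.source := mem_chart_source E (Φ.symm q)
  let A : M → E →L[ℂ] ℂ := fun y => ContinuousLinearMap.inCoordinates E (TangentSpace 𝓘(ℂ, E)) ℂ L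
    (Φ.symm q) y (Φ.symm q) y (ϑ y)
  let θ : V → V →L[ℂ] ℂ := fun z => (A (Φ.symm z)).comp (fderiv ℂ (e ∘ Φ.symm) z)
  have key (z : M) (hz : z ∈ Φ.source) (hze : z ∈ e.source)
      (hzb : z ∈ (trivializationAt ℂ L (Φ.symm q)).baseSet) (v : TangentSpace 𝓘(ℂ, E) z) :
      v ∈ kerForm ϑ z ↔ θ (Φ z) (mfderiv 𝓘(ℂ, E) 𝓘(ℂ, V) Φ z v) = 0 := by
    obtain ⟨z', hz', rfl⟩ : ∃ z' ∈ Φ.target, Φ.symm z' = z := ⟨Φ z, Φ.map_source hz, Φ.left_inv hz⟩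
    rw [Φ.right_inv hz']
    have h1 := fderiv_comp_symm_apply hΦ hz' ((he.contMDiffAt hze).mdifferentiableAt (by simp))
      (mfderiv 𝓘(ℂ, E) 𝓘(ℂ, V) Φ (Φ.symm z') v)
    rw [hΦ.mfderiv_symm_mfderiv hz' v] at h1
    have h2 : θ z' (mfderiv 𝓘(ℂ, E) 𝓘(ℂ, V) Φ (Φ.symm z') v) =
        (trivializationAt ℂ L (Φ.symm q)).continuousLinearMapAt ℂ (Φ.symm z') (ϑ (Φ.symm z') v) :=
      (congrArg (A (Φ.symm z')) h1).trans (inCoordinates_apply_mfderiv hze v)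
    refine Iff.trans ?_ (Eq.congr_left h2).symm
    rw [continuousLinearMapAt_eq_zero_iff hzb]
    rfl
  have hbq := FiberBundle.mem_baseSet_trivializationAt' (F := ℂ) (E := L) (Φ.symm q)
  refine ⟨θ, ?_, fun h0 => ?_, ?_⟩
  · refine ContDiffAt.clm_comp ?_ ?_
    · exact ContMDiffAt.contDiffAt_comp_symm hΦ hq hA
    · exact (ContMDiffAt.contDiffAt_comp_symm hΦ hq (he.contMDiffAt hes)).fderiv_right (by simp)
  · have hall (v : TangentSpace 𝓘(ℂ, E) (Φ.symm q)) : ϑ _ v = 0 := by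
      refine (key _ (Φ.map_target hq) hes hbq v).2 ?_
      rw [Φ.right_inv hq, h0]
      rfl
    obtain ⟨v, hv⟩ := hϑ.surjective (Φ.symm q)
      (((trivializationAt ℂ L (Φ.symm q)).continuousLinearEquivAt ℂ (Φ.symm q) hbq).symm 1)
    rw [hall v] at hv
    exact one_ne_zero ((EmbeddingLike.map_eq_zero_iff).1 hv.symm)
  · filter_upwards [Φ.open_source.mem_nhds (Φ.map_target hq), e.open_source.mem_nhds hes,
      (trivializationAt ℂ L (Φ.symm q)).open_baseSet.mem_nhds hbq] with z h1 h2 h3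
    exact key z h1 h2 h3

end FormInChart

/-! ### Local sections of submersions -/

section LocalSection

set_option linter.unusedSectionVars false

variable {E : Type*} [NormedAddCommGroup E] [NormedSpace ℂ E] [FiniteDimensional ℂ E]
  {M : Type*} [TopologicalSpace M] [ChartedSpace E M] [IsManifold 𝓘(ℂ, E) ω M]
  {G : Type*} [NormedAddCommGroup G] [NormedSpace ℂ G] [FiniteDimensional ℂ G]
  {F : Type*} [NormedAddCommGroup F] [NormedSpace ℂ F] [FiniteDimensional ℂ F]
  {H : Type*} [NormedAddCommGroup H] [NormedSpace ℂ H]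

theorem mfderiv_eq_fst_of_chart {Φ : OpenPartialHomeomorph M (G × F)}
    (hΦ : IsAnalyticChart (E := E) Φ) {f : M → G} (hf : ∀ x ∈ Φ.source, (Φ x).1 = f x) {z : M}
    (hz : z ∈ Φ.source) (v : TangentSpace 𝓘(ℂ, E) z) :
    mfderiv 𝓘(ℂ, E) 𝓘(ℂ, G) f z v = (mfderiv 𝓘(ℂ, E) 𝓘(ℂ, G × F) Φ z v).1 := by
  have h1 : f =ᶠ[𝓝 z] ContinuousLinearMap.fst ℂ G F ∘ Φ := by
    filter_upwards [Φ.open_source.mem_nhds hz] with x hx using (hf x hx).symm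
  rw [h1.mfderiv_eq, mfderiv_comp z
    (ContinuousLinearMap.fst ℂ G F).mdifferentiableAt
    ((hΦ.contMDiffAt hz).mdifferentiableAt (by simp))]
  rw [mfderiv_eq_fderiv, ContinuousLinearMap.fderiv]
  rfl

variable (F) in
/-- A holomorphic submersion has local sections, and maps that are constant along its fibres
factor through it locally. -/
theorem exists_local_section {f : M → G} {y : M} (hf : ContMDiffAt 𝓘(ℂ, E) 𝓘(ℂ, G) ω f y)
    (hs : Function.Surjective (mfderiv 𝓘(ℂ, E) 𝓘(ℂ, G) f y))
    (hdim : Module.finrank ℂ G + Module.finrank ℂ F = Module.finrank ℂ E) :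
    ∃ s : G → M, s (f y) = y ∧ ContMDiffAt 𝓘(ℂ, G) 𝓘(ℂ, E) ω s (f y) ∧
      (∀ᶠ b in 𝓝 (f y), f (s b) = b) ∧
      ∀ g : M → H, (∀ᶠ z in 𝓝 y, MDifferentiableAt 𝓘(ℂ, E) 𝓘(ℂ, H) g z ∧
        ∀ v, mfderiv 𝓘(ℂ, E) 𝓘(ℂ, G) f z v = 0 → mfderiv 𝓘(ℂ, E) 𝓘(ℂ, H) g z v = 0) →
        ∀ᶠ z in 𝓝 y, g z = g (s (f z)) := by
  obtain ⟨Φ, hy, hΦ, hΦf⟩ := exists_analyticChart_fst (F := F) hf hs hdim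
  obtain ⟨q, hq, rfl⟩ : ∃ q ∈ Φ.target, Φ.symm q = y := ⟨_, Φ.map_source hy, Φ.left_inv hy⟩
  have hfs (z : G × F) (hz : z ∈ Φ.target) : f (Φ.symm z) = z.1 := by
    rw [← hΦf _ (Φ.map_target hz), Φ.right_inv hz]
  have hpt : Filter.Tendsto (fun b : G => (b, q.2)) (𝓝 q.1) (𝓝 q) :=
    (continuous_id.prodMk continuous_const).continuousAt
  refine ⟨fun b => Φ.symm (b, q.2), ?_, ?_, ?_, fun g hg => ?_⟩
  · rw [hfs q hq]
  · rw [hfs q hq]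
    have h1 : ContMDiffAt 𝓘(ℂ, G) 𝓘(ℂ, G × F) ω (fun b : G => (b, q.2)) q.1 :=
      (contDiff_id.prodMk contDiff_const).contMDiff.contMDiffAt
    exact ContMDiffAt.comp (I' := 𝓘(ℂ, G × F)) q.1 (hΦ.contMDiffAt_symm hq) h1
  · rw [hfs q hq]
    filter_upwards [hpt.eventually (Φ.open_target.mem_nhds hq)] with b hb using hfs _ hb
  · have h1 : ∀ᶠ z in 𝓝 q, DifferentiableAt ℂ (g ∘ Φ.symm) z ∧
        ∀ c, fderiv ℂ (g ∘ Φ.symm) z (0, c) = 0 := by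
      filter_upwards [(IsAnalyticChart.tendsto_symm hq).eventually hg,
        Φ.open_target.mem_nhds hq] with z hz hzt
      refine ⟨(hz.1.comp z ((hΦ.contMDiffAt_symm hzt).mdifferentiableAt
        (by simp))).differentiableAt, fun c => ?_⟩
      refine (fderiv_comp_symm_apply hΦ hzt hz.1 (0, c)).trans (hz.2 _ ?_)
      refine (mfderiv_eq_fst_of_chart hΦ hΦf (Φ.map_target hzt) _).trans ?_
      exact congrArg Prod.fst (hΦ.mfderiv_mfderiv_symm hzt (0, c))
    filter_upwards [(IsAnalyticChart.tendsto hq).eventually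
      (eventually_eq_of_fderiv_snd_eq_zero h1), Φ.open_source.mem_nhds hy] with z hz hzs
    rw [Function.comp_apply, Function.comp_apply, Φ.left_inv hzs, hΦf z hzs] at hz
    exact hz

end LocalSection

/-! ### Local models of the null foliation with its transverse contact form -/

section LocalModel

set_option linter.unusedSectionVars false

variable {E : Type*} [NormedAddCommGroup E] [NormedSpace ℂ E] [FiniteDimensional ℂ E]
  {M : Type*} [TopologicalSpace M] [ChartedSpace E M] [IsManifold 𝓘(ℂ, E) ω M]
  {G : Type*} [NormedAddCommGroup G] [NormedSpace ℂ G] [FiniteDimensional ℂ G]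
  {F : Type*} [NormedAddCommGroup F] [NormedSpace ℂ F] [FiniteDimensional ℂ F]
  {D : ∀ y : M, Submodule ℂ (TangentSpace 𝓘(ℂ, E) y)}

/-- In every analytic chart with values in `V`, the distribution `D` is locally the kernel of a
nowhere zero analytic 1-form. -/
def HasLocalForms (D : ∀ y : M, Submodule ℂ (TangentSpace 𝓘(ℂ, E) y))
    (V : Type*) [NormedAddCommGroup V] [NormedSpace ℂ V] : Prop :=
  ∀ (Φ : OpenPartialHomeomorph M V) (q : V), IsAnalyticChart (E := E) Φ → q ∈ Φ.target →
    ∃ θ : V → V →L[ℂ] ℂ, ContDiffAt ℂ ω θ q ∧ θ q ≠ 0 ∧ RepresentsAt D Φ θ (Φ.symm q)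

/-- Near `y`, the map `f` is a first integral of the null spaces of the Levi tensor of `D`, and `D`
is the preimage of the kernel of `σ`. -/
structure IsLocalModel (D : ∀ y : M, Submodule ℂ (TangentSpace 𝓘(ℂ, E) y)) (f : M → G)
    (σ : G → G →L[ℂ] ℂ) (y : M) : Prop where
  contMDiffAt : ContMDiffAt 𝓘(ℂ, E) 𝓘(ℂ, G) ω f y
  ker : ∀ᶠ z in 𝓝 y, ∀ v, mfderiv 𝓘(ℂ, E) 𝓘(ℂ, G) f z v = 0 ↔ v ∈ leviNull D z
  contDiffAt : ContDiffAt ℂ ω σ (f y)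
  mem_iff : ∀ᶠ z in 𝓝 y, ∀ v, v ∈ D z ↔ σ (f z) (mfderiv 𝓘(ℂ, E) 𝓘(ℂ, G) f z v) = 0

namespace IsLocalModel

variable {f g h : M → G} {σ τ : G → G →L[ℂ] ℂ} {y y₀ : M}

theorem eventually (h : IsLocalModel D f σ y) : ∀ᶠ z in 𝓝 y, IsLocalModel D f σ z := by
  filter_upwards [(contMDiffAt_iff_contMDiffAt_nhds (by simp)).1 h.contMDiffAt, h.ker.eventually_nhds,
    h.contMDiffAt.continuousAt.eventually (h.contDiffAt.eventually (by simp)),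
    h.mem_iff.eventually_nhds] with z h1 h2 h3 h4 using ⟨h1, h2, h3, h4⟩

theorem mdifferentiableAt (h : IsLocalModel D f σ y) : MDifferentiableAt 𝓘(ℂ, E) 𝓘(ℂ, G) f y :=
  h.contMDiffAt.mdifferentiableAt (by simp)

variable (F) in
theorem surjective (h : IsLocalModel D f σ y)
    (hk : Module.finrank ℂ (leviNull D y) = Module.finrank ℂ F)
    (hdim : Module.finrank ℂ G + Module.finrank ℂ F = Module.finrank ℂ E) :
    Function.Surjective (mfderiv 𝓘(ℂ, E) 𝓘(ℂ, G) f y) := by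
  let A : E →L[ℂ] G := mfderiv 𝓘(ℂ, E) 𝓘(ℂ, G) f y
  have h1 : LinearMap.ker A.toLinearMap = leviNull D y := by
    ext v
    exact h.ker.self_of_nhds v
  have h2 := LinearMap.finrank_range_add_finrank_ker A.toLinearMap
  have h3 : Module.finrank ℂ (LinearMap.ker A.toLinearMap) = Module.finrank ℂ F :=
    (congrArg (fun S : Submodule ℂ E => Module.finrank ℂ S) h1).trans hk
  have h4 : LinearMap.range A.toLinearMap = ⊤ := Submodule.eq_top_of_finrank_eq (by omega)
  exact LinearMap.range_eq_top.1 h4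

variable (F) in
-- Every local model has the null spaces as kernels of its derivative, so it is locally constant
-- along the fibres of `f` and factors through the section.
theorem exists_section (h : IsLocalModel D f σ y)
    (hk : ∀ y, Module.finrank ℂ (leviNull D y) = Module.finrank ℂ F)
    (hdim : Module.finrank ℂ G + Module.finrank ℂ F = Module.finrank ℂ E) :
    ∃ s : G → M, s (f y) = y ∧ ContMDiffAt 𝓘(ℂ, G) 𝓘(ℂ, E) ω s (f y) ∧
      (∀ᶠ b in 𝓝 (f y), f (s b) = b) ∧
      ∀ (g : M → G) (τ : G → G →L[ℂ] ℂ), IsLocalModel D g τ y → ∀ᶠ z in 𝓝 y, g z = g (s (f z)) := by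
  obtain ⟨s, h1, h2, h3, h4⟩ :=
    exists_local_section (H := G) F h.contMDiffAt (h.surjective F (hk y) hdim) hdim
  refine ⟨s, h1, h2, h3, fun g τ hg => h4 g ?_⟩
  filter_upwards [hg.eventually, h.ker] with z hgz hz
  exact ⟨hgz.mdifferentiableAt, fun v hv => (hgz.ker.self_of_nhds v).2 ((hz v).1 hv)⟩

variable (F) in
theorem nhds_le_map (h : IsLocalModel D f σ y)
    (hk : ∀ y, Module.finrank ℂ (leviNull D y) = Module.finrank ℂ F)
    (hdim : Module.finrank ℂ G + Module.finrank ℂ F = Module.finrank ℂ E) :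
    𝓝 (f y) ≤ Filter.map f (𝓝 y) := by
  obtain ⟨s, h1, h2, h3, -⟩ := h.exists_section F hk hdim
  have h4 : Filter.Tendsto s (𝓝 (f y)) (𝓝 y) := by simpa [ContinuousAt, h1] using h2.continuousAt
  calc 𝓝 (f y) = Filter.map (f ∘ s) (𝓝 (f y)) := 
        ((Filter.map_congr (m₂ := id) h3).trans Filter.map_id).symm
    _ = Filter.map f (Filter.map s (𝓝 (f y))) := Filter.map_map.symm
    _ ≤ _ := Filter.map_mono h4

variable (F) in
/-- Two local models have the same fibres. -/
theorem eventually_eq_iff (hf : IsLocalModel D f σ y) (hg : IsLocalModel D g τ y)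
    (hk : ∀ y, Module.finrank ℂ (leviNull D y) = Module.finrank ℂ F)
    (hdim : Module.finrank ℂ G + Module.finrank ℂ F = Module.finrank ℂ E) :
    ∃ W ∈ 𝓝 y, ∀ z ∈ W, ∀ z' ∈ W, f z = f z' ↔ g z = g z' := by
  obtain ⟨s, -, -, -, hs⟩ := hf.exists_section F hk hdim
  obtain ⟨t, -, -, -, ht⟩ := hg.exists_section F hk hdim
  refine ⟨_, (hs g τ hg).and (ht f σ hf), fun z hz z' hz' => ⟨fun h => ?_, fun h => ?_⟩⟩
  · rw [hz.1, hz'.1, h]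
  · rw [hz.2, hz'.2, h]

variable (F) in
/-- A local model at `y₀` is transported along the fibres of `f` to a local model at `y`. -/
theorem transport (hf : IsLocalModel D f σ y) (hf₀ : IsLocalModel D f σ y₀)
    (hg : IsLocalModel D g τ y₀)
    (hk : ∀ y, Module.finrank ℂ (leviNull D y) = Module.finrank ℂ F)
    (hdim : Module.finrank ℂ G + Module.finrank ℂ F = Module.finrank ℂ E)
    (hy : f y = f y₀) {W : Set M} (hW : W ∈ 𝓝 y₀)
    (hh : ∀ᶠ z in 𝓝 y, ∀ z' ∈ W, f z = f z' → h z = g z') :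
    IsLocalModel D h τ y := by
  obtain ⟨s, hs1, hs2, hs3, hs4⟩ := hf₀.exists_section F hk hdim
  have hst : Filter.Tendsto s (𝓝 (f y₀)) (𝓝 y₀) := by
    simpa [ContinuousAt, hs1] using hs2.continuousAt
  have hft : Filter.Tendsto f (𝓝 y) (𝓝 (f y₀)) := hy ▸ hf.contMDiffAt.continuousAt
  -- `c` is the change from the coordinate `f` to the coordinate `g`. It is built near `y₀`, but
  -- since `h = c ∘ f` near `y`, it acts at every point of the same fibre.
  let c : G → G := g ∘ s
  have hgc : ContMDiffAt 𝓘(ℂ, E) 𝓘(ℂ, G) ω g (s (f y₀)) := by rw [hs1]; exact hg.contMDiffAt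
  have hc : ContDiffAt ℂ ω c (f y₀) := (hgc.comp (f y₀) hs2).contDiffAt
  have hhc : ∀ᶠ z in 𝓝 y, h z = c (f z) := by
    filter_upwards [hh, hft.eventually (hst.eventually hW), hft.eventually hs3] with z h1 h2 h3
    exact h1 _ h2 h3.symm
  have hchain {z : M} (hz : MDifferentiableAt 𝓘(ℂ, E) 𝓘(ℂ, G) f z)
      (hcz : DifferentiableAt ℂ c (f z)) {e : M → G} (he : e =ᶠ[𝓝 z] c ∘ f)
      (v : TangentSpace 𝓘(ℂ, E) z) : mfderiv 𝓘(ℂ, E) 𝓘(ℂ, G) e z v =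
        fderiv ℂ c (f z) (mfderiv 𝓘(ℂ, E) 𝓘(ℂ, G) f z v) := by
    rw [he.mfderiv_eq, mfderiv_comp z hcz.mdifferentiableAt hz, mfderiv_eq_fderiv]
    rfl
  -- These properties of `c` concern only the target. They are verified at `s b`, near `y₀`, where
  -- `f` and `g` are both local models, and used near `y`.
  have hP : ∀ᶠ b in 𝓝 (f y₀), DifferentiableAt ℂ c b ∧ ∀ w,
      (fderiv ℂ c b w = 0 → w = 0) ∧ (σ b w = 0 ↔ τ (c b) (fderiv ℂ c b w) = 0) := by
    filter_upwards [hc.eventually (by simp), hs3, hst.eventually hf₀.eventually,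
      hst.eventually hg.eventually, hst.eventually (hs4 g τ hg).eventually_nhds]
      with b hcb hsb hfb hgb hgeq
    have hcb' : DifferentiableAt ℂ c (f (s b)) := hsb.symm ▸ hcb.differentiableAt (by simp)
    have hd := hchain hfb.mdifferentiableAt hcb' (e := g) hgeq
    refine ⟨hcb.differentiableAt (by simp), fun w => ?_⟩
    obtain ⟨v, rfl⟩ := hfb.surjective F (hk _) hdim w
    have hcs : c b = g (s b) := rfl
    have hdb : mfderiv 𝓘(ℂ, E) 𝓘(ℂ, G) g (s b) v =
        fderiv ℂ c b (mfderiv 𝓘(ℂ, E) 𝓘(ℂ, G) f (s b) v) :=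
      (hd v).trans (congrArg (fun b' => fderiv ℂ c b' (mfderiv 𝓘(ℂ, E) 𝓘(ℂ, G) f (s b) v)) hsb)
    constructor
    · intro h0
      exact (hfb.ker.self_of_nhds v).2 ((hgb.ker.self_of_nhds v).1 (hdb.trans h0))
    · have h1 := hfb.mem_iff.self_of_nhds v
      have h2 := hgb.mem_iff.self_of_nhds v
      rw [hdb] at h2
      rw [hsb] at h1
      exact h1.symm.trans h2
  refine ⟨?_, ?_, ?_, ?_⟩
  · refine ContMDiffAt.congr_of_eventuallyEq ?_ hhc
    exact ContMDiffAt.comp (I' := 𝓘(ℂ, G)) (g := c) (f := f) y (hy.symm ▸ hc.contMDiffAt)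
      hf.contMDiffAt
  · filter_upwards [hhc.eventually_nhds, hf.eventually, hft.eventually hP] with z h1 h2 h3 v
    rw [hchain h2.mdifferentiableAt h3.1 h1 v, ← h2.ker.self_of_nhds v]
    exact ⟨(h3.2 _).1, fun h => (congrArg (fderiv ℂ c (f z)) h).trans (map_zero (fderiv ℂ c (f z)))⟩
  · have h1 : h y = g y₀ := by
      rw [hhc.self_of_nhds, hy]
      exact congrArg g hs1
    rw [h1]
    exact hg.contDiffAt
  · filter_upwards [hhc.eventually_nhds, hf.eventually, hft.eventually hP] with z h1 h2 h3 v
    rw [hchain h2.mdifferentiableAt h3.1 h1 v, h2.mem_iff.self_of_nhds v, h1.self_of_nhds]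
    exact (h3.2 _).2

variable (F) in
/-- The 1-form of a local model is contact. -/
theorem nondegenerate (h : IsLocalModel D f σ y) (hD : D y ≠ ⊤)
    (hk : Module.finrank ℂ (leviNull D y) = Module.finrank ℂ F)
    (hdim : Module.finrank ℂ G + Module.finrank ℂ F = Module.finrank ℂ E) :
    σ (f y) ≠ 0 ∧ nullSpace σ (f y) = ⊥ := by
  have hσ0 : σ (f y) ≠ 0 := by
    intro h0
    refine hD (eq_top_iff.2 fun v _ => ?_)
    rw [h.mem_iff.self_of_nhds v, h0]
    rfl
  refine ⟨hσ0, ?_⟩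
  obtain ⟨Φ, hy, hΦ, hΦf⟩ := exists_analyticChart_fst (F := F) h.contMDiffAt
    (h.surjective F hk hdim) hdim
  obtain ⟨q, hq, rfl⟩ : ∃ q ∈ Φ.target, Φ.symm q = y := ⟨_, Φ.map_source hy, Φ.left_inv hy⟩
  have hfq : f (Φ.symm q) = q.1 := by rw [← hΦf _ hy, Φ.right_inv hq]
  -- In a chart straightening `f`, the pullback of `σ` represents `D`. A null vector `b` of `dσ`
  -- then gives a null vector `(b, 0)`, which lies in `Ker df`; its first component `b` is therefore
  -- zero.
  let θ : G × F → G × F →L[ℂ] ℂ := fun p => (σ p.1).comp (ContinuousLinearMap.fst ℂ G F)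
  have hσq : ContDiffAt ℂ ω σ q.1 := hfq ▸ h.contDiffAt
  have hθ : ContDiffAt ℂ ω θ q := (hσq.comp q contDiffAt_fst).clm_comp contDiffAt_const
  have hθ0 : θ q ≠ 0 := by
    intro h0
    refine hσ0 ?_
    ext v
    have := DFunLike.congr_fun h0 (v, 0)
    rw [hfq]
    exact this
  have hrep : RepresentsAt D Φ θ (Φ.symm q) := by
    filter_upwards [h.mem_iff, Φ.open_source.mem_nhds hy] with z hz hzs v
    rw [hz v, mfderiv_eq_fst_of_chart hΦ hΦf hzs, ← hΦf z hzs]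
    rfl
  have hθd (u v : G × F) : fderiv ℂ θ q u v = fderiv ℂ σ q.1 u.1 v.1 := by
    have h1 : HasFDerivAt (fun p : G × F => σ p.1)
        ((fderiv ℂ σ q.1).comp (ContinuousLinearMap.fst ℂ G F)) q :=
      (hσq.differentiableAt (by simp)).hasFDerivAt.comp q hasFDerivAt_fst
    have h2 := h1.clm_apply (hasFDerivAt_const v.1 q)
    have h3 := ((hθ.differentiableAt (by simp)).hasFDerivAt.clm_apply (hasFDerivAt_const v q))
    have h4 := DFunLike.congr_fun (h3.unique h2) u
    simpa using h4
  rw [hfq, Submodule.eq_bot_iff]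
  rintro b ⟨hb1, hb2⟩
  have hmem : ((b, 0) : G × F) ∈ nullSpace θ q := by
    refine ⟨hb1, fun u hu => ?_⟩
    rw [hθd, hθd]
    exact hb2 u.1 hu
  have hN : mfderiv 𝓘(ℂ, G × F) 𝓘(ℂ, E) Φ.symm q (b, 0) ∈ leviNull D (Φ.symm q) := by
    rw [mem_leviNull_iff hΦ hq hθ hθ0 hrep, hΦ.mfderiv_mfderiv_symm hq]
    exact hmem
  have h5 := (h.ker.self_of_nhds _).2 hN
  rw [mfderiv_eq_fst_of_chart hΦ hΦf hy, hΦ.mfderiv_mfderiv_symm hq] at h5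
  exact h5

end IsLocalModel

theorem HasLocalForms.ne_top (hD : HasLocalForms D E) (y : M) : D y ≠ ⊤ := by
  intro htop
  have hΦ := isAnalyticChart_chartAt (E := E) y
  obtain ⟨θ, -, hθ0, hrep⟩ := hD _ _ hΦ (mem_chart_target E y)
  refine hθ0 ?_
  have h1 : (chartAt E y).symm (chartAt E y y) = y := (chartAt E y).left_inv (mem_chart_source E y)
  ext u
  have h2 := (hrep.self_of_nhds
    (mfderiv 𝓘(ℂ, E) 𝓘(ℂ, E) (chartAt E y).symm (chartAt E y y) u)).1 (by rw [h1, htop]; trivial)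
  rw [hΦ.mfderiv_mfderiv_symm (mem_chart_target E y), (chartAt E y).right_inv
    (mem_chart_target E y)] at h2
  exact h2

/-- Frobenius in a chart of `M` produces `f`. In a second chart, straightening `f`, the null spaces
are the second factor, so the form there descends to `σ`. This is why local forms are required for
charts with values in both spaces. -/
theorem exists_isLocalModel {m : ℕ} (hD : HasLocalForms D E)
    (hD' : HasLocalForms D (EuclideanSpace ℂ (Fin m) × F))
    (hk : ∀ y, Module.finrank ℂ (leviNull D y) = Module.finrank ℂ F)
    (hdim : m + Module.finrank ℂ F = Module.finrank ℂ E) (y : M) :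
    ∃ (f : M → EuclideanSpace ℂ (Fin m)) (σ : EuclideanSpace ℂ (Fin m) →
      EuclideanSpace ℂ (Fin m) →L[ℂ] ℂ), IsLocalModel D f σ y := by
  obtain ⟨e, he, hy⟩ : ∃ e : OpenPartialHomeomorph M E, IsAnalyticChart (E := E) e ∧ y ∈ e.source :=
    ⟨chartAt E y, isAnalyticChart_chartAt y, mem_chart_source E y⟩
  obtain ⟨p, hp, rfl⟩ : ∃ p ∈ e.target, e.symm p = y := ⟨_, e.map_source hy, e.left_inv hy⟩
  obtain ⟨θ, hθ, hθ0, hrep⟩ := hD e p he hp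
  have hev : ∀ᶠ x in 𝓝 p, x ∈ e.target ∧ ContDiffAt ℂ ω θ x ∧ θ x ≠ 0 ∧
      RepresentsAt D e θ (e.symm x) := by
    filter_upwards [e.open_target.mem_nhds hp, hθ.eventually (by simp),
      hθ.continuousAt.eventually_ne hθ0,
      (IsAnalyticChart.tendsto_symm hp).eventually hrep.eventually_nhds] with x h1 h2 h3 h4
    exact ⟨h1, h2, h3, h4⟩
  obtain ⟨f₀, hf₀, hker₀⟩ := exists_first_integral_nullSpace hθ hθ0
    (hev.mono fun x hx => (finrank_nullSpace_eq he hx.1 hx.2.1 hx.2.2.1 hx.2.2.2).trans (hk _)) hdim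
  let f : M → EuclideanSpace ℂ (Fin m) := f₀ ∘ e
  have hf : ContMDiffAt 𝓘(ℂ, E) 𝓘(ℂ, EuclideanSpace ℂ (Fin m)) ω f (e.symm p) :=
    ContMDiffAt.comp (I' := 𝓘(ℂ, E)) (e.symm p) (by rw [e.right_inv hp]; exact hf₀.contMDiffAt)
      (he.contMDiffAt hy)
  have hker : ∀ᶠ z in 𝓝 (e.symm p), ∀ v,
      mfderiv 𝓘(ℂ, E) 𝓘(ℂ, EuclideanSpace ℂ (Fin m)) f z v = 0 ↔ v ∈ leviNull D z := by
    filter_upwards [e.open_source.mem_nhds hy, (IsAnalyticChart.tendsto hp).eventually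
      ((hf₀.eventually (by simp)).and (hker₀.and hev))] with z hz h v
    obtain ⟨x, hx, rfl⟩ : ∃ x ∈ e.target, e.symm x = z := ⟨_, e.map_source hz, e.left_inv hz⟩
    rw [e.right_inv hx] at h
    obtain ⟨h1, h2, -, h3, h4, h5⟩ := h
    rw [mem_leviNull_iff he hx h3 h4 h5 v, ← h2]
    have h6 : mfderiv 𝓘(ℂ, E) 𝓘(ℂ, EuclideanSpace ℂ (Fin m)) f (e.symm x) v =
        fderiv ℂ f₀ x (mfderiv 𝓘(ℂ, E) 𝓘(ℂ, E) e (e.symm x) v) := by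
      have h7 : MDifferentiableAt 𝓘(ℂ, E) 𝓘(ℂ, EuclideanSpace ℂ (Fin m)) f₀ (e (e.symm x)) := by
        rw [e.right_inv hx]; exact (h1.differentiableAt (by simp)).mdifferentiableAt
      rw [mfderiv_comp _ h7 ((he.contMDiffAt hz).mdifferentiableAt (by simp)), mfderiv_eq_fderiv,
        e.right_inv hx]
      rfl
    rw [h6]
    rfl
  have hsurj : Function.Surjective
      (mfderiv 𝓘(ℂ, E) 𝓘(ℂ, EuclideanSpace ℂ (Fin m)) f (e.symm p)) := by
    let A : E →L[ℂ] EuclideanSpace ℂ (Fin m) :=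
      mfderiv 𝓘(ℂ, E) 𝓘(ℂ, EuclideanSpace ℂ (Fin m)) f (e.symm p)
    have h1 : LinearMap.ker A.toLinearMap = leviNull D (e.symm p) := by
      ext v
      exact hker.self_of_nhds v
    have h2 := LinearMap.finrank_range_add_finrank_ker A.toLinearMap
    have h3 : Module.finrank ℂ (LinearMap.ker A.toLinearMap) = Module.finrank ℂ F :=
      (congrArg (fun S : Submodule ℂ E => Module.finrank ℂ S) h1).trans (hk _)
    have h4 : LinearMap.range A.toLinearMap = ⊤ := Submodule.eq_top_of_finrank_eq (by
      rw [finrank_euclideanSpace_fin]; omega)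
    exact LinearMap.range_eq_top.1 h4
  obtain ⟨Φ, hyΦ, hΦ, hΦf⟩ := exists_analyticChart_fst (F := F) hf hsurj
    (by rw [finrank_euclideanSpace_fin, hdim])
  obtain ⟨q, hq, hqy⟩ : ∃ q ∈ Φ.target, Φ.symm q = e.symm p :=
    ⟨_, Φ.map_source hyΦ, Φ.left_inv hyΦ⟩
  rw [← hqy] at hf hker hyΦ ⊢
  obtain ⟨θ', hθ', hθ0', hrep'⟩ := hD' Φ q hΦ hq
  obtain ⟨σ, hσ, hσθ⟩ := exists_form_on_fst hθ' hθ0' (by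
    filter_upwards [Φ.open_target.mem_nhds hq, hθ'.eventually (by simp),
      hθ'.continuousAt.eventually_ne hθ0', (IsAnalyticChart.tendsto_symm hq).eventually
      (hrep'.eventually_nhds.and hker)] with z h1 h2 h3 h4 c
    have h5 := (mem_leviNull_iff hΦ h1 h2 h3 h4.1
      (mfderiv 𝓘(ℂ, EuclideanSpace ℂ (Fin m) × F) 𝓘(ℂ, E) Φ.symm z (0, c))).1 ((h4.2 _).1
        ((mfderiv_eq_fst_of_chart hΦ hΦf (Φ.map_target h1) _).trans
          (congrArg Prod.fst (hΦ.mfderiv_mfderiv_symm h1 (0, c)))))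
    rwa [hΦ.mfderiv_mfderiv_symm h1] at h5)
  refine ⟨f, σ, hf, hker, ?_, ?_⟩
  · rw [← hΦf _ hyΦ, Φ.right_inv hq]
    exact hσ
  · filter_upwards [hrep', (IsAnalyticChart.tendsto hq).eventually hσθ,
      Φ.open_source.mem_nhds hyΦ] with z h1 h2 h3 v
    rw [h1 v, mfderiv_eq_fst_of_chart hΦ hΦf h3, ← hΦf z h3]
    exact h2 _

end LocalModel

/-! ### Local injectivity on the submanifold, and submersions in charts -/

/-- A map with injective strict derivative at a point of a finite-dimensional space is injective
near this point. -/
theorem HasStrictFDerivAt.exists_injOn {F G : Type*} [NormedAddCommGroup F] [NormedSpace ℂ F]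
    [FiniteDimensional ℂ F] [NormedAddCommGroup G] [NormedSpace ℂ G] [FiniteDimensional ℂ G]
    {g : F → G} {g' : F →L[ℂ] G} {p : F} (hg : HasStrictFDerivAt g g' p)
    (hinj : Function.Injective g') : ∃ U ∈ 𝓝 p, Set.InjOn g U := by
  have : CompleteSpace F := FiniteDimensional.complete ℂ F
  -- Composing `g` with a linear left inverse of its derivative reduces to the inverse function
  -- theorem.
  obtain ⟨P, hP⟩ := g'.toLinearMap.exists_leftInverse_of_injective (LinearMap.ker_eq_bot.2 hinj)
  have h1 : HasStrictFDerivAt (P.toContinuousLinearMap ∘ g)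
      ((ContinuousLinearEquiv.refl ℂ F : F ≃L[ℂ] F) : F →L[ℂ] F) p := by
    have h2 := P.toContinuousLinearMap.hasStrictFDerivAt.comp p hg
    refine h2.congr_fderiv ?_
    ext v
    exact DFunLike.congr_fun hP v
  let e := h1.toOpenPartialHomeomorph _
  refine ⟨e.source, e.open_source.mem_nhds h1.mem_toOpenPartialHomeomorph_source, ?_⟩
  intro a ha b hb hab
  exact e.injOn ha hb (congrArg P.toContinuousLinearMap hab)

section Submersion

set_option linter.unusedSectionVars false

variable {E : Type*} [NormedAddCommGroup E] [NormedSpace ℂ E] [FiniteDimensional ℂ E]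
  {M : Type*} [TopologicalSpace M] [ChartedSpace E M] [IsManifold 𝓘(ℂ, E) ω M]
  {G : Type*} [NormedAddCommGroup G] [NormedSpace ℂ G] [FiniteDimensional ℂ G]
  {F : Type*} [NormedAddCommGroup F] [NormedSpace ℂ F] [FiniteDimensional ℂ F]

theorem isAnalyticChart_of_mem_maximalAtlas {e : OpenPartialHomeomorph M E}
    (he : e ∈ IsManifold.maximalAtlas 𝓘(ℂ, E) ω M) : IsAnalyticChart (E := E) e :=
  ⟨contMDiffOn_of_mem_maximalAtlas he, contMDiffOn_symm_of_mem_maximalAtlas he⟩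

/-- A map that is injective on the tangent space of an immersed submanifold is locally injective on
this submanifold. -/
theorem exists_injOn_of_isImmersionAt {Z : Type*} [TopologicalSpace Z] [ChartedSpace F Z]
    [IsManifold 𝓘(ℂ, F) ω Z] {ι : Z → M} {z : Z}
    (hι : IsImmersionAt 𝓘(ℂ, F) 𝓘(ℂ, E) ω ι z) {f : M → G}
    (hf : ContMDiffAt 𝓘(ℂ, E) 𝓘(ℂ, G) ω f (ι z))
    (hker : ∀ v, mfderiv 𝓘(ℂ, E) 𝓘(ℂ, G) f (ι z) (mfderiv 𝓘(ℂ, F) 𝓘(ℂ, E) ι z v) = 0 →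
      mfderiv 𝓘(ℂ, F) 𝓘(ℂ, E) ι z v = 0) :
    ∃ U ∈ 𝓝 z, Set.InjOn (f ∘ ι) U := by
  have he := isAnalyticChart_of_mem_maximalAtlas hι.domChart_mem_maximalAtlas
  have hc := isAnalyticChart_of_mem_maximalAtlas hι.codChart_mem_maximalAtlas
  have hz := hι.mem_domChart_source
  have hcz := hι.mem_codChart_source
  have hιz := hι.contMDiffAt
  have hw : Set.EqOn (hι.codChart ∘ ι ∘ hι.domChart.symm) (hι.equiv ∘ (·, 0))
      hι.domChart.target := by
    have := hι.writtenInCharts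
    simpa [OpenPartialHomeomorph.extend_target] using this
  generalize hι.domChart = e at he hz hw
  generalize hι.codChart = c at hc hcz hw
  generalize hι.equiv = A at hw
  obtain ⟨p, hp, rfl⟩ : ∃ p ∈ e.target, e.symm p = z := ⟨_, e.map_source hz, e.left_inv hz⟩
  have hιe : ContMDiffAt 𝓘(ℂ, F) 𝓘(ℂ, E) ω (ι ∘ e.symm) p := hιz.comp p (he.contMDiffAt_symm hp)
  have h1 (u : F) : mfderiv 𝓘(ℂ, F) 𝓘(ℂ, E) (ι ∘ e.symm) p u =
      mfderiv 𝓘(ℂ, F) 𝓘(ℂ, E) ι (e.symm p) (mfderiv 𝓘(ℂ, F) 𝓘(ℂ, F) e.symm p u) := by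
    rw [mfderiv_comp p (hιz.mdifferentiableAt (by simp))
      ((he.contMDiffAt_symm hp).mdifferentiableAt (by simp))]
    rfl
  have h2 (u : F) (hu : mfderiv 𝓘(ℂ, F) 𝓘(ℂ, E) (ι ∘ e.symm) p u = 0) : u = 0 := by
    have h3 : c ∘ ι ∘ e.symm =ᶠ[𝓝 p] A ∘ ContinuousLinearMap.inl ℂ F _ := by
      filter_upwards [e.open_target.mem_nhds hp] with x hx using hw hx
    have h4 : fderiv ℂ (c ∘ ι ∘ e.symm) p u = A (u, 0) := by
      have h5 : HasFDerivAt (A ∘ ContinuousLinearMap.inl ℂ F hι.complement)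
          (A.toContinuousLinearMap.comp (ContinuousLinearMap.inl ℂ F hι.complement)) p :=
        (A.toContinuousLinearMap.comp (ContinuousLinearMap.inl ℂ F hι.complement)).hasFDerivAt
      rw [h3.fderiv_eq, h5.fderiv]
      rfl
    have h5 : fderiv ℂ (c ∘ ι ∘ e.symm) p u = mfderiv 𝓘(ℂ, E) 𝓘(ℂ, E) c (ι (e.symm p))
        (mfderiv 𝓘(ℂ, F) 𝓘(ℂ, E) (ι ∘ e.symm) p u) := by
      rw [← mfderiv_eq_fderiv, mfderiv_comp p ((hc.contMDiffAt hcz).mdifferentiableAt (by simp))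
        (hιe.mdifferentiableAt (by simp))]
      rfl
    have h6 : A (u, 0) = 0 := h4.symm.trans (h5.trans
      ((congrArg (mfderiv 𝓘(ℂ, E) 𝓘(ℂ, E) c (ι (e.symm p))) hu).trans (map_zero _)))
    exact congrArg Prod.fst ((EmbeddingLike.map_eq_zero_iff (f := A)).1 h6)
  have hg : ContDiffAt ℂ ω (f ∘ ι ∘ e.symm) p :=
    (ContMDiffAt.comp (I' := 𝓘(ℂ, E)) (f := ι ∘ e.symm) (g := f) p hf hιe).contDiffAt
  have hg' (u : F) : fderiv ℂ (f ∘ ι ∘ e.symm) p u = mfderiv 𝓘(ℂ, E) 𝓘(ℂ, G) f (ι (e.symm p))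
      (mfderiv 𝓘(ℂ, F) 𝓘(ℂ, E) (ι ∘ e.symm) p u) := by
    rw [← mfderiv_eq_fderiv, mfderiv_comp (f := ι ∘ e.symm) p (hf.mdifferentiableAt (by simp))
      (hιe.mdifferentiableAt (by simp))]
    rfl
  obtain ⟨U, hU, hinj⟩ := (hg.hasStrictFDerivAt (by simp)).exists_injOn (by
    refine (injective_iff_map_eq_zero _).2 fun u hu => h2 u ?_
    rw [h1]
    refine hker _ ?_
    rw [← h1]
    exact (hg' u).symm.trans hu)
  refine ⟨e.source ∩ e ⁻¹' U, Filter.inter_mem (e.open_source.mem_nhds hz)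
    (IsAnalyticChart.tendsto hp hU), ?_⟩
  rintro a ⟨ha, haU⟩ b ⟨hb, hbU⟩ hab
  refine e.injOn ha hb (hinj haU hbU ?_)
  simpa only [Function.comp_apply, e.left_inv ha, e.left_inv hb] using hab

/-- A map that is a submersion in a chart of the target is a submersion. -/
theorem isSubmersionAtOfComplement_of_surjective {N : Type*} [TopologicalSpace N]
    [ChartedSpace G N] {ν : M → N} {x : M} (hν : ContinuousAt ν x)
    {c : OpenPartialHomeomorph N G} (hc : c ∈ IsManifold.maximalAtlas 𝓘(ℂ, G) ω N)
    (hx : ν x ∈ c.source) (hcν : ContMDiffAt 𝓘(ℂ, E) 𝓘(ℂ, G) ω (c ∘ ν) x)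
    (hs : Function.Surjective (mfderiv 𝓘(ℂ, E) 𝓘(ℂ, G) (c ∘ ν) x))
    (hdim : Module.finrank ℂ G + Module.finrank ℂ F = Module.finrank ℂ E) :
    IsSubmersionAtOfComplement F 𝓘(ℂ, E) 𝓘(ℂ, G) ω ν x := by
  obtain ⟨Φ, hxΦ, hΦ, hΦf⟩ := exists_analyticChart_fst (F := F) hcν hs hdim
  have hdim' : Module.finrank ℂ E = Module.finrank ℂ (G × F) := by
    rw [Module.finrank_prod, hdim]
  -- Charts of `M` must have values in `E`; any identification with `G × F` serves, because the same
  -- `A` enters the submersion data.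
  let A : E ≃L[ℂ] G × F := ContinuousLinearEquiv.ofFinrankEq hdim'
  let Ψ : OpenPartialHomeomorph M E := Φ.trans A.symm.toHomeomorph.toOpenPartialHomeomorph
  have hΨ : IsAnalyticChart (E := E) Ψ :=
    hΦ.trans (Ψ := A.symm.toHomeomorph.toOpenPartialHomeomorph) A.symm.contDiff.contDiffOn
      A.contDiff.contDiffOn
  refine IsSubmersionAtOfComplement.mk_of_continuousAt hν A Ψ c ?_ hx
    (IsManifold.mem_maximalAtlas_iff_contMDiffOn Ψ |>.2 ⟨hΨ.contMDiffOn, hΨ.contMDiffOn_symm⟩) hc ?_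
  · simp [Ψ, hxΦ]
  · intro u hu
    have hu' : A u ∈ Φ.target := by simpa [Ψ, OpenPartialHomeomorph.extend_target] using hu
    have h1 := hΦf _ (Φ.map_target hu')
    rw [Φ.right_inv hu'] at h1
    simpa [Ψ] using h1.symm

end Submersion

/-! ### Closed equivalence relations from local fibres, and their quotients -/

section Topology

variable {Y : Type*} [TopologicalSpace Y]

theorem IsCompact.exists_isOpen_prod_prod_subset {K : Set Y} (hK : IsCompact K)
    {S : Set (Y × Y × Y)} (hS : IsOpen S) (hKS : K ×ˢ K ×ˢ K ⊆ S) :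
    ∃ O : Set Y, IsOpen O ∧ K ⊆ O ∧ O ×ˢ O ×ˢ O ⊆ S := by
  obtain ⟨u, v, hu, hv, hKu, hKv, huv⟩ := generalized_tube_lemma hK (hK.prod hK) hS hKS
  obtain ⟨u', v', hu', hv', hKu', hKv', huv'⟩ := generalized_tube_lemma hK hK hv hKv
  refine ⟨u ∩ (u' ∩ v'), hu.inter (hu'.inter hv'),
    Set.subset_inter hKu (Set.subset_inter hKu' hKv'), ?_⟩
  rintro ⟨a, b, c⟩ ⟨ha, hb, hc⟩
  exact huv ⟨ha.1, huv' ⟨hb.2.1, hc.2.2⟩⟩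

/-- Let the fibres of a family of local maps define the same local equivalence relation wherever
two of these maps are defined, and let these maps be locally injective on the compact set `K`. Then
there is a closed equivalence relation on a neighborhood of `K` that is locally (along its classes)
given by the fibres of these maps. -/
theorem exists_setoid_of_local_fibres [T2Space Y] [LocallyCompactSpace Y] {G 𝓜 : Type*}
    [TopologicalSpace G] [T2Space G] (P : 𝓜 → Y → Prop) (φ : 𝓜 → Y → G)
    (hP : ∀ μ y, P μ y → ∀ᶠ z in 𝓝 y, P μ z) (hφ : ∀ μ y, P μ y → ContinuousAt (φ μ) y)
    (hcompat : ∀ μ μ' y, P μ y → P μ' y →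
      ∃ W ∈ 𝓝 y, ∀ z ∈ W, ∀ z' ∈ W, φ μ z = φ μ z' ↔ φ μ' z = φ μ' z')
    {K : Set Y} (hK : IsCompact K)
    (hex : ∀ y ∈ K, ∃ μ, P μ y ∧ ∃ U ∈ 𝓝 y, Set.InjOn (φ μ) (U ∩ K)) :
    ∃ (O : TopologicalSpace.Opens Y) (C : Set Y) (R : Setoid O), K ⊆ O ∧ IsCompact C ∧ (O : Set Y) ⊆ C ∧
      IsClosed {p : O × O | R p.1 p.2} ∧
      ∀ y y' : O, R y y' → ∃ W : Set O, IsOpen W ∧ y ∈ W ∧ y' ∈ W ∧ ∃ μ, (∀ z ∈ W, P μ z) ∧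
        ∀ z ∈ W, ∀ z' ∈ W, R z z' ↔ φ μ z = φ μ z' := by
  classical
  have hex' : ∀ y : K, ∃ (μ : 𝓜) (U C : Set Y), IsOpen U ∧ IsCompact C ∧ (y : Y) ∈ interior C ∧
      C ⊆ U ∧ (∀ z ∈ U, P μ z) ∧ Set.InjOn (φ μ) (U ∩ K) := by
    rintro ⟨y, hy⟩
    obtain ⟨μ, hμ, U, hU, hinj⟩ := hex y hy
    obtain ⟨V, hVs, hV, hyV⟩ := mem_nhds_iff.1 (Filter.inter_mem hU (hP μ y hμ))
    obtain ⟨C, hC, hyC, hCV⟩ := exists_compact_subset hV hyV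
    exact ⟨μ, V, C, hV, hC, hyC, hCV, fun z hz => (hVs hz).2,
      hinj.mono (Set.inter_subset_inter_left K fun z hz => (hVs hz).1)⟩
  choose μ U C hU hC hyC hCU hPU hinj using hex'
  obtain ⟨t, ht⟩ := hK.elim_finite_subcover (fun y : K => interior (C y))
    (fun _ => isOpen_interior) fun y hy => Set.mem_iUnion.2 ⟨⟨y, hy⟩, hyC _⟩
  have hcont (i : K) : ContinuousOn (φ (μ i)) (U i) := fun z hz =>
    (hφ _ z (hPU i z hz)).continuousWithinAt
  -- Compactness of the `C i` and finiteness of `t` make `g` closed. Transitivity, however, may fail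
  -- when the two relations of a chain use different indices.
  let g : Y → Y → Prop := fun y y' => ∃ i ∈ t, y ∈ C i ∧ y' ∈ C i ∧ φ (μ i) y = φ (μ i) y'
  have hg : IsClosed {p : Y × Y | g p.1 p.2} := by
    have h1 : {p : Y × Y | g p.1 p.2} =
        ⋃ i ∈ t, (C i ×ˢ C i) ∩ {p | φ (μ i) p.1 = φ (μ i) p.2} := by
      ext p
      simp only [g, Set.mem_iUnion, Set.mem_inter_iff, Set.mem_prod, Set.mem_ofPred_eq, exists_prop,
        and_assoc]
    rw [h1]
    refine isClosed_biUnion_finset fun i _ => ?_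
    have h2 : ContinuousOn (fun p : Y × Y => (φ (μ i) p.1, φ (μ i) p.2)) (C i ×ˢ C i) :=
      ((hcont i).mono (hCU i)).prodMap ((hcont i).mono (hCU i))
    exact h2.preimage_isClosed_of_isClosed ((hC i).isClosed.prod (hC i).isClosed)
      (isClosed_diagonal (X := G))
  have hgK {y y' : Y} (hy : y ∈ K) (hy' : y' ∈ K) (h : g y y') : y = y' := by
    obtain ⟨i, -, h1, h2, h3⟩ := h
    exact hinj i ⟨hCU i h1, hy⟩ ⟨hCU i h2, hy'⟩ h3
  -- `W z` is so small that it meets only those `C i` that contain `z`, lies in those with `z` in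
  -- the interior, and all maps of index `i` with `z ∈ C i` have the same fibres on it. Hence `g` is
  -- on `W z` the fibre relation of a single map (`hcommon`).
  have hW : ∀ z : K, ∃ W : Set Y, IsOpen W ∧ (z : Y) ∈ W ∧ ∀ i ∈ t,
      (∀ y ∈ W, y ∈ C i → (z : Y) ∈ C i) ∧ ((z : Y) ∈ interior (C i) → W ⊆ C i) ∧
      ∀ j ∈ t, (z : Y) ∈ C i → (z : Y) ∈ C j → ∀ y ∈ W, ∀ y' ∈ W,
        φ (μ i) y = φ (μ i) y' ↔ φ (μ j) y = φ (μ j) y' := by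
    intro z
    have h1 : ∀ᶠ W in (𝓝 (z : Y)).smallSets, ∀ i ∈ t,
        (∀ y ∈ W, y ∈ C i → (z : Y) ∈ C i) ∧ ((z : Y) ∈ interior (C i) → W ⊆ C i) ∧
        ∀ j ∈ t, (z : Y) ∈ C i → (z : Y) ∈ C j → ∀ y ∈ W, ∀ y' ∈ W,
          φ (μ i) y = φ (μ i) y' ↔ φ (μ j) y = φ (μ j) y' := by
      rw [Filter.eventually_all_finset]
      intro i _
      refine Filter.Eventually.and ?_ (Filter.Eventually.and ?_ ?_)
      · by_cases hz : (z : Y) ∈ C i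
        · exact Filter.Eventually.of_forall fun _ _ _ _ => hz
        · exact Filter.eventually_smallSets.2 ⟨(C i)ᶜ, (hC i).isClosed.isOpen_compl.mem_nhds hz,
            fun W hWs y hy hyC => absurd hyC (hWs hy)⟩
      · by_cases hz : (z : Y) ∈ interior (C i)
        · exact Filter.eventually_smallSets.2 ⟨C i, mem_interior_iff_mem_nhds.1 hz,
            fun W hWs _ => hWs⟩
        · exact Filter.Eventually.of_forall fun _ h => absurd h hz
      · rw [Filter.eventually_all_finset]
        intro j _
        by_cases hz : (z : Y) ∈ C i ∧ (z : Y) ∈ C j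
        · obtain ⟨V, hV, hVp⟩ :=
            hcompat (μ i) (μ j) z (hPU i z (hCU i hz.1)) (hPU j z (hCU j hz.2))
          exact Filter.eventually_smallSets.2 ⟨V, hV,
            fun W hWs _ _ y hy y' hy' => hVp y (hWs hy) y' (hWs hy')⟩
        · exact Filter.Eventually.of_forall fun _ h h' => absurd ⟨h, h'⟩ hz
    obtain ⟨s, hs, h⟩ := Filter.eventually_smallSets.1 h1
    obtain ⟨W, hWs, hW, hzW⟩ := mem_nhds_iff.1 hs
    exact ⟨W, hW, hzW, h W hWs⟩
  choose W hWo hzW hWp using hW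
  -- The triples at which transitivity cannot fail: those that are not chains, an open condition
  -- since `g` is closed, and those in one `W z`. A chain in `K` is constant, so `S` contains `K ×ˢ
  -- K ×ˢ K`.
  let S : Set (Y × Y × Y) := {p | g p.1 p.2.1 ∧ g p.2.1 p.2.2}ᶜ ∪ ⋃ z, W z ×ˢ W z ×ˢ W z
  have hS : IsOpen S := by
    refine IsOpen.union (IsClosed.isOpen_compl (self := IsClosed.inter ?_ ?_))
      (isOpen_iUnion fun z => (hWo z).prod ((hWo z).prod (hWo z)))
    · exact hg.preimage (continuous_fst.prodMk (continuous_fst.comp continuous_snd))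
    · exact hg.preimage continuous_snd
  have hKS : K ×ˢ K ×ˢ K ⊆ S := by
    rintro ⟨a, b, c⟩ ⟨ha : a ∈ K, hb : b ∈ K, hc : c ∈ K⟩
    by_cases h : g a b ∧ g b c
    · obtain rfl : a = b := hgK ha hb h.1
      obtain rfl : a = c := hgK hb hc h.2
      exact Or.inr (Set.mem_iUnion.2 ⟨⟨a, ha⟩, hzW _, hzW _, hzW _⟩)
    · exact Or.inl h
  obtain ⟨O, hO, hKO, hOS⟩ := hK.exists_isOpen_prod_prod_subset hS hKS
  have hint : ∀ z : K, ∃ l ∈ t, (z : Y) ∈ interior (C l) := fun z => by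
    simpa using ht z.2
  have hcommon {y y' : Y} {z l : K} (hl : l ∈ t) (hzl : (z : Y) ∈ interior (C l)) (hy : y ∈ W z)
      (hy' : y' ∈ W z) : g y y' ↔ φ (μ l) y = φ (μ l) y' := by
    constructor
    · rintro ⟨i, hi, h1, h2, h3⟩
      exact ((hWp z i hi).2.2 l hl ((hWp z i hi).1 y hy h1) (interior_subset hzl) y hy y' hy').1 h3
    · intro h
      exact ⟨l, hl, (hWp z l hl).2.1 hzl hy, (hWp z l hl).2.1 hzl hy', h⟩
  have htriple {a b c : Y} (ha : a ∈ O) (hb : b ∈ O) (hc : c ∈ O) (h1 : g a b) (h2 : g b c) :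
      ∃ z, a ∈ W z ∧ b ∈ W z ∧ c ∈ W z := by
    rcases hOS (show (a, b, c) ∈ O ×ˢ O ×ˢ O from ⟨ha, hb, hc⟩) with h | h
    · exact absurd ⟨h1, h2⟩ h
    · exact Set.mem_iUnion.1 h
  -- Reflexivity of `g` holds only on the union of the `C i`.
  let O' : TopologicalSpace.Opens Y := ⟨O ∩ ⋃ i ∈ t, interior (C i),
    hO.inter (isOpen_biUnion fun _ _ => isOpen_interior)⟩
  have hrefl (y : O') : g y y := by
    obtain ⟨i, hi, hy⟩ := Set.mem_iUnion₂.1 y.2.2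
    exact ⟨i, hi, interior_subset hy, interior_subset hy, rfl⟩
  let R : Setoid O' :=
    { r := fun y y' => g y y'
      iseqv := by
        refine ⟨hrefl, ?_, ?_⟩
        · rintro a b ⟨i, hi, h1, h2, h3⟩
          exact ⟨i, hi, h2, h1, h3.symm⟩
        · intro a b c hab hbc
          obtain ⟨z, ha, hb, hc⟩ := htriple a.2.1 b.2.1 c.2.1 hab hbc
          obtain ⟨l, hl, hzl⟩ := hint z
          rw [hcommon hl hzl ha hb] at hab
          rw [hcommon hl hzl hb hc] at hbc
          exact (hcommon hl hzl ha hc).2 (hab.trans hbc) }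
  refine ⟨O', ⋃ i ∈ t, C i, R, Set.subset_inter hKO ht, t.isCompact_biUnion fun i _ => hC i, ?_, ?_,
    fun y y' hyy' => ?_⟩
  · exact Set.inter_subset_right.trans (Set.iUnion₂_mono fun i _ => interior_subset)
  · exact hg.preimage (continuous_subtype_val.prodMap continuous_subtype_val)
  -- The degenerate chain `y, y', y'` puts any two related points into a common `W z`.
  · obtain ⟨z, hy, hy', -⟩ := htriple y.2.1 y'.2.1 y'.2.1 hyy' (hrefl y')
    obtain ⟨l, hl, hzl⟩ := hint z
    exact ⟨Subtype.val ⁻¹' W z, (hWo z).preimage continuous_subtype_val, hy, hy', μ l,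
      fun a ha => hPU l a (hCU l ((hWp z l hl).2.1 hzl ha)),
      fun a ha b hb => hcommon hl hzl ha hb⟩

end Topology

/-- If the fibres of an open map `q` agree on an open set with those of a map `f` that is open and
continuous there, then `f` descends to a partial homeomorphism. -/
theorem exists_openPartialHomeomorph_of_fibres {A X B : Type*} [TopologicalSpace A]
    [TopologicalSpace X] [TopologicalSpace B] {q : A → X} (hq : Continuous q) (hqo : IsOpenMap q)
    {f : A → B} {W : Set A} (hW : IsOpen W) (hf : ∀ w ∈ W, ContinuousAt f w)
    (hfo : ∀ w ∈ W, 𝓝 (f w) ≤ Filter.map f (𝓝 w)) (hne : W.Nonempty)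
    (h : ∀ w ∈ W, ∀ w' ∈ W, q w = q w' ↔ f w = f w') :
    ∃ e : OpenPartialHomeomorph X B, e.source = q '' W ∧ ∀ w ∈ W, e (q w) = f w := by
  classical
  obtain ⟨w₀, hw₀⟩ := hne
  let F : X → B := fun x => if hx : ∃ w ∈ W, q w = x then f hx.choose else f w₀
  let I : B → X := fun b => if hb : ∃ w ∈ W, f w = b then q hb.choose else q w₀
  have hF (w : A) (hw : w ∈ W) : F (q w) = f w := by
    have hx : ∃ w' ∈ W, q w' = q w := ⟨w, hw, rfl⟩
    have h1 : F (q w) = f hx.choose := dif_pos hx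
    rw [h1]
    exact (h _ hx.choose_spec.1 _ hw).1 hx.choose_spec.2
  have hI (w : A) (hw : w ∈ W) : I (f w) = q w := by
    have hx : ∃ w' ∈ W, f w' = f w := ⟨w, hw, rfl⟩
    have h1 : I (f w) = q hx.choose := dif_pos hx
    rw [h1]
    exact (h _ hx.choose_spec.1 _ hw).2 hx.choose_spec.2
  refine ⟨⟨⟨⟨F, I, q '' W, f '' W, ?_, ?_, ?_, ?_⟩, ?_, ?_⟩, ?_, ?_⟩, rfl, hF⟩
  · rintro _ ⟨w, hw, rfl⟩
    exact ⟨w, hw, (hF w hw).symm⟩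
  · rintro _ ⟨w, hw, rfl⟩
    exact ⟨w, hw, (hI w hw).symm⟩
  · rintro _ ⟨w, hw, rfl⟩
    rw [hF w hw, hI w hw]
  · rintro _ ⟨w, hw, rfl⟩
    rw [hI w hw, hF w hw]
  · rintro _ ⟨w, hw, rfl⟩
    refine ContinuousAt.continuousWithinAt ?_
    change Filter.Tendsto F (𝓝 (q w)) (𝓝 (F (q w)))
    rw [hF w hw, ← hqo.map_nhds_eq hq.continuousAt, Filter.tendsto_map'_iff]
    refine (hf w hw).tendsto.congr' ?_
    filter_upwards [hW.mem_nhds hw] with z hz using (hF z hz).symm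
  · rintro _ ⟨w, hw, rfl⟩
    refine ContinuousAt.continuousWithinAt ?_
    change Filter.Tendsto I (𝓝 (f w)) (𝓝 (I (f w)))
    rw [hI w hw]
    refine Filter.Tendsto.mono_left ?_ (hfo w hw)
    rw [Filter.tendsto_map'_iff]
    refine hq.continuousAt.tendsto.congr' ?_
    filter_upwards [hW.mem_nhds hw] with z hz using (hI z hz).symm
  · exact hqo W hW
  · rw [isOpen_iff_mem_nhds]
    rintro _ ⟨w, hw, rfl⟩
    exact hfo w hw (Filter.image_mem_map (hW.mem_nhds hw))

/-- Finitely many chart domains cover `C`, and each is second countable as a copy of an open subset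
of `E`; `M` itself need not be second countable. -/
theorem secondCountableTopology_of_subset_isCompact {E M : Type*} [NormedAddCommGroup E]
    [NormedSpace ℂ E] [FiniteDimensional ℂ E] [TopologicalSpace M] [ChartedSpace E M]
    (O : TopologicalSpace.Opens M) {C : Set M} (hC : IsCompact C) (hOC : (O : Set M) ⊆ C) :
    SecondCountableTopology O := by
  have : ProperSpace E := FiniteDimensional.proper ℂ E
  obtain ⟨t, ht⟩ := hC.elim_finite_subcover (fun y : M => (chartAt E y).source)
    (fun y => (chartAt E y).open_source) fun y _ => Set.mem_iUnion.2 ⟨y, mem_chart_source E y⟩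
  let U : t → Set O := fun i => Subtype.val ⁻¹' (chartAt E i.1).source
  have hU (i : t) : SecondCountableTopology (U i) := by
    have := (chartAt E i.1).secondCountableTopology_source
    let g : U i → (chartAt E i.1).source := fun z => ⟨z.1.1, z.2⟩
    have hg : Topology.IsInducing g := by
      have h1 : Topology.IsInducing (Subtype.val ∘ g) :=
        (Topology.IsInducing.subtypeVal (t := (O : Set M))).comp (Topology.IsInducing.subtypeVal (t := U i))
      exact h1.of_comp (by fun_prop) continuous_subtype_val
    exact hg.secondCountableTopology
  refine TopologicalSpace.secondCountableTopology_of_countable_cover (U := U)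
    (fun i => (chartAt E i.1).open_source.preimage continuous_subtype_val) ?_
  rw [Set.eq_univ_iff_forall]
  intro y
  obtain ⟨i, hi, hy⟩ := Set.mem_iUnion₂.1 (ht (hOC y.2))
  exact Set.mem_iUnion.2 ⟨⟨i, hi⟩, hy⟩

/-! ### The tangent spaces of an open subset -/

section OpenSubset

variable {E : Type*} [NormedAddCommGroup E] [NormedSpace ℂ E]
  {M : Type*} [TopologicalSpace M] [ChartedSpace E M] [IsManifold 𝓘(ℂ, E) ω M]

omit [IsManifold 𝓘(ℂ, E) ω M] in
-- The preferred chart of `O` at `y` is the restriction of the one of `M`, so the inclusion reads as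
-- the identity.
theorem bijective_mfderiv_subtypeVal (O : TopologicalSpace.Opens M) (y : O) :
    Function.Bijective (mfderiv 𝓘(ℂ, E) 𝓘(ℂ, E) (Subtype.val : O → M) y) := by
  have h1 : mfderiv 𝓘(ℂ, E) 𝓘(ℂ, E) (Subtype.val : O → M) y = ContinuousLinearMap.id ℂ E := by
    refine HasMFDerivAt.mfderiv ⟨continuous_subtype_val.continuousAt, ?_⟩
    have h2 : writtenInExtChartAt 𝓘(ℂ, E) 𝓘(ℂ, E) y (Subtype.val : O → M) =ᶠ[𝓝 (chartAt E y y)]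
        id := by
      filter_upwards [(chartAt E y).open_target.mem_nhds (mem_chart_target E y)] with b hb
      exact (chartAt E y).right_inv hb
    exact ((hasFDerivAt_id _).congr_of_eventuallyEq h2).hasFDerivWithinAt
  rw [h1]
  exact Function.bijective_id

end OpenSubset

/-! ### The leaf space as a Hausdorff complex manifold -/

section NullFoliation

set_option linter.unusedSectionVars false

variable {E : Type*} [NormedAddCommGroup E] [NormedSpace ℂ E] [FiniteDimensional ℂ E]
  {M : Type*} [TopologicalSpace M] [ChartedSpace E M] [IsManifold 𝓘(ℂ, E) ω M]
  {G : Type*} [NormedAddCommGroup G] [NormedSpace ℂ G] [FiniteDimensional ℂ G]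
  {F : Type*} [NormedAddCommGroup F] [NormedSpace ℂ F] [FiniteDimensional ℂ F]
  {D : ∀ y : M, Submodule ℂ (TangentSpace 𝓘(ℂ, E) y)}
  {O : TopologicalSpace.Opens M} {R : Setoid O}

/-- An equivalence relation whose classes are, locally along these classes, the fibres of local
models. -/
def IsNullRelation (G : Type*) [NormedAddCommGroup G] [NormedSpace ℂ G]
    (D : ∀ y : M, Submodule ℂ (TangentSpace 𝓘(ℂ, E) y)) (R : Setoid O) : Prop :=
  ∀ y y' : O, R y y' → ∃ W : Set O, IsOpen W ∧ y ∈ W ∧ y' ∈ W ∧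
    ∃ (f : M → G) (σ : G → G →L[ℂ] ℂ), (∀ z ∈ W, IsLocalModel D f σ z) ∧
      ∀ z ∈ W, ∀ z' ∈ W, R z z' ↔ f z = f z'

theorem nhds_le_map_val {f : M → G} {y : O} (h : 𝓝 (f y) ≤ Filter.map f (𝓝 (y : M))) :
    𝓝 (f y) ≤ Filter.map (fun z : O => f z) (𝓝 y) := by
  rwa [← (O.isOpenEmbedding').map_nhds_eq, Filter.map_map] at h

namespace IsNullRelation

variable (hR : IsNullRelation G D R)
    (hk : ∀ y, Module.finrank ℂ (leviNull D y) = Module.finrank ℂ F)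
    (hdim : Module.finrank ℂ G + Module.finrank ℂ F = Module.finrank ℂ E)

include hR hk hdim

/-- Saturations of open sets are open: around two equivalent points the relation is the fibre
relation of one `f`. As `f` is open at `y'`, all points near `y` take values that are attained in
the given open set. -/
theorem isOpenQuotientMap : IsOpenQuotientMap (Quotient.mk R) := by
  refine ⟨Quotient.mk_surjective, continuous_quot_mk, fun U hU => ?_⟩
  change IsOpen (Quotient.mk R ⁻¹' _)
  rw [isOpen_iff_mem_nhds]
  rintro y ⟨y', hy', hyy'⟩
  obtain ⟨W, hW, h1, h2, f, σ, hf, hRf⟩ := hR y' y (Quotient.exact hyy')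
  have h3 : (fun z : O => f z) '' (U ∩ W) ∈ 𝓝 (f y') :=
    nhds_le_map_val ((hf y' h1).nhds_le_map F hk hdim)
      (Filter.image_mem_map ((hU.inter hW).mem_nhds ⟨hy', h1⟩))
  rw [(hRf _ h1 _ h2).1 (Quotient.exact hyy')] at h3
  have h4 : ContinuousAt (fun z : O => f z) y :=
    ContinuousAt.comp (f := Subtype.val) (hf y h2).contMDiffAt.continuousAt
      continuous_subtype_val.continuousAt
  filter_upwards [h4 h3, hW.mem_nhds h2] with z hz hzW
  obtain ⟨z', hz', hzz'⟩ := hz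
  exact ⟨z', hz'.1, Quotient.sound ((hRf _ hz'.2 _ hzW).2 hzz')⟩

theorem t2Space (hcl : IsClosed {p : O × O | R p.1 p.2}) : T2Space (Quotient R) := by
  rw [t2Space_iff_of_isOpenQuotientMap (hR.isOpenQuotientMap hk hdim)]
  convert hcl using 3
  exact Quotient.eq

theorem exists_chart (x : Quotient R) :
    ∃ (e : OpenPartialHomeomorph (Quotient R) G) (W : Set O) (f : M → G) (σ : G → G →L[ℂ] ℂ),
      x ∈ e.source ∧ IsOpen W ∧ e.source = Quotient.mk R '' W ∧
      ∀ w ∈ W, e (Quotient.mk R w) = f w ∧ IsLocalModel D f σ w := by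
  obtain ⟨y, rfl⟩ := Quotient.mk_surjective x
  obtain ⟨W, hW, hy, -, f, σ, hf, hRf⟩ := hR y y (R.refl y)
  have hq := hR.isOpenQuotientMap hk hdim
  obtain ⟨e, he, hef⟩ := exists_openPartialHomeomorph_of_fibres hq.continuous hq.isOpenMap
    (f := fun z : O => f z) hW (fun w hw => ContinuousAt.comp (f := Subtype.val)
      (hf w hw).contMDiffAt.continuousAt continuous_subtype_val.continuousAt)
    (fun w hw => nhds_le_map_val ((hf w hw).nhds_le_map F hk hdim)) ⟨y, hy⟩
    (fun w hw w' hw' => Quotient.eq.trans (hRf w hw w' hw'))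
  exact ⟨e, W, f, σ, by rw [he]; exact ⟨y, hy, rfl⟩, hW, he, fun w hw => ⟨hef w hw, hf w hw⟩⟩

/-- The preferred chart of the leaf space at a point. -/
noncomputable def chart (x : Quotient R) : OpenPartialHomeomorph (Quotient R) G :=
  (hR.exists_chart hk hdim x).choose

/-- A 1-form in the preferred chart of the leaf space at a point. -/
noncomputable def form (x : Quotient R) : G → G →L[ℂ] ℂ :=
  (hR.exists_chart hk hdim x).choose_spec.choose_spec.choose_spec.choose

theorem mem_chart_source (x : Quotient R) : x ∈ (hR.chart hk hdim x).source :=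
  (hR.exists_chart hk hdim x).choose_spec.choose_spec.choose_spec.choose_spec.1

open Classical in
/-- The preferred chart of the leaf space at a point, as a map on `M`. -/
noncomputable def coord (x : Quotient R) (z : M) : G :=
  -- The value off `O` is immaterial: only germs at points of the open set `O` are used.
  if hz : z ∈ O then hR.chart hk hdim x (Quotient.mk R ⟨z, hz⟩) else 0

theorem coord_val (x : Quotient R) (y : O) :
    hR.coord hk hdim x y = hR.chart hk hdim x (Quotient.mk R y) := dif_pos y.2

/-- The chart is known to be given by a model only at representatives in `V`. Any other
representative of the same class is reached by `transport` along the fibres of a model `f` defined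
around both. -/
theorem isLocalModel_coord (x : Quotient R) {y : O}
    (hy : Quotient.mk R y ∈ (hR.chart hk hdim x).source) :
    IsLocalModel D (hR.coord hk hdim x) (hR.form hk hdim x) y := by
  obtain ⟨V, g, hV, hVs, hVg⟩ : ∃ (V : Set O) (g : M → G), IsOpen V ∧
      (hR.chart hk hdim x).source = Quotient.mk R '' V ∧ ∀ w ∈ V,
        hR.chart hk hdim x (Quotient.mk R w) = g w ∧ IsLocalModel D g (hR.form hk hdim x) w :=
    ⟨_, _, (hR.exists_chart hk hdim x).choose_spec.choose_spec.choose_spec.choose_spec.2⟩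
  rw [hVs] at hy
  obtain ⟨y₀, hy₀, hyy₀⟩ := hy
  obtain ⟨W, hW, h1, h2, f, σ, hf, hRf⟩ := hR y₀ y (Quotient.exact hyy₀)
  have himg {U : Set O} (hU : IsOpen U) {z : O} (hz : z ∈ U) : Subtype.val '' U ∈ 𝓝 (z : M) :=
    (O.isOpenEmbedding'.isOpenMap U hU).mem_nhds ⟨z, hz, rfl⟩
  refine IsLocalModel.transport F (hf y h2) (hf y₀ h1) (hVg y₀ hy₀).2 hk hdim
    ((hRf _ h1 _ h2).1 (Quotient.exact hyy₀)).symm (himg (hW.inter hV) ⟨h1, hy₀⟩) ?_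
  filter_upwards [himg hW h2]
  rintro _ ⟨z, hz, rfl⟩ _ ⟨z', hz', rfl⟩ hzz'
  rw [hR.coord_val hk hdim, ← (hVg z' hz'.2).1, Quotient.sound ((hRf _ hz _ hz'.1).2 hzz')]

/-- The charted space structure of the leaf space. -/
@[reducible] noncomputable def chartedSpace : ChartedSpace G (Quotient R) where
  atlas := Set.range (hR.chart hk hdim)
  chartAt := hR.chart hk hdim
  mem_chart_source := hR.mem_chart_source hk hdim
  chart_mem_atlas x := ⟨x, rfl⟩

/-- A holomorphic section `s` of one coordinate map expresses the transition map as the other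
coordinate map composed with `s`. -/
theorem isManifold :
    let _ := hR.chartedSpace hk hdim
    IsManifold 𝓘(ℂ, G) ω (Quotient R) := by
  let _ := hR.chartedSpace hk hdim
  refine isManifold_of_contDiffOn _ _ _ ?_
  rintro _ _ ⟨x, rfl⟩ ⟨x', rfl⟩ b hb
  refine ContDiffAt.contDiffWithinAt ?_
  have hb1 : b ∈ (hR.chart hk hdim x).target := by
    simp only [mfld_simps] at hb
    exact hb.1
  have hb2 : (hR.chart hk hdim x).symm b ∈ (hR.chart hk hdim x').source := by
    simp only [mfld_simps] at hb
    exact hb.2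
  obtain ⟨y, hy⟩ := Quotient.mk_surjective ((hR.chart hk hdim x).symm b)
  have hys : Quotient.mk R y ∈ (hR.chart hk hdim x).source := by
    rw [hy]; exact (hR.chart hk hdim x).map_target hb1
  have hyb : hR.coord hk hdim x y = b := by
    rw [hR.coord_val hk hdim, hy, (hR.chart hk hdim x).right_inv hb1]
  have h1 := hR.isLocalModel_coord hk hdim x hys
  have h2 := hR.isLocalModel_coord hk hdim x' (hy.symm ▸ hb2)
  obtain ⟨s, hs1, hs2, hs3, -⟩ := h1.exists_section F hk hdim
  rw [hyb] at hs1 hs2 hs3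
  have hcont : Filter.Tendsto s (𝓝 b) (𝓝 (y : M)) := by
    simpa [ContinuousAt, hs1] using hs2.continuousAt
  have h3 : ContDiffAt ℂ ω (hR.coord hk hdim x' ∘ s) b := by
    refine ContMDiffAt.contDiffAt ?_
    refine ContMDiffAt.comp (I' := 𝓘(ℂ, E)) b ?_ hs2
    rw [hs1]
    exact h2.contMDiffAt
  refine h3.congr_of_eventuallyEq ?_
  have hU : Subtype.val '' (Quotient.mk R ⁻¹' (hR.chart hk hdim x).source) ∈ 𝓝 (y : M) :=
    (O.isOpenEmbedding'.isOpenMap _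
      ((hR.chart hk hdim x).open_source.preimage continuous_quot_mk)).mem_nhds ⟨y, hys, rfl⟩
  filter_upwards [hs3, hcont hU] with b' h4 h5
  obtain ⟨z, hz, hzs⟩ := h5
  have h6 : hR.chart hk hdim x (Quotient.mk R z) = b' := by
    rw [← hR.coord_val hk hdim, hzs, h4]
  have h7 : (hR.chart hk hdim x).symm b' = Quotient.mk R z := by
    rw [← h6, (hR.chart hk hdim x).left_inv hz]
  simp only [mfld_simps]
  rw [h7, ← hR.coord_val hk hdim, hzs]

end IsNullRelation

end NullFoliation

/-! ### Gluing contact forms of charts in a line bundle -/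

section ContactAtlas

set_option linter.unusedSectionVars false

variable {G : Type*} [NormedAddCommGroup G] [NormedSpace ℂ G] [FiniteDimensional ℂ G]
  {X : Type*} [TopologicalSpace X] [ChartedSpace G X] [IsManifold 𝓘(ℂ, G) ω X]

/-- The pullback of the 1-form `σ i` by the preferred chart at `i`. -/
noncomputable def chartPullback (σ : X → G → G →L[ℂ] ℂ) (i p : X) :
    TangentSpace 𝓘(ℂ, G) p →L[ℂ] ℂ :=
  (σ i (chartAt G i p)).comp (mfderiv 𝓘(ℂ, G) 𝓘(ℂ, G) (chartAt G i) p)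

/-- A family of 1-forms in the preferred charts that define the same contact structure. -/
structure IsContactAtlas (σ : X → G → G →L[ℂ] ℂ) : Prop where
  contDiffAt : ∀ x, ∀ b ∈ (chartAt G x).target, ContDiffAt ℂ ω (σ x) b
  ne_zero : ∀ x, ∀ b ∈ (chartAt G x).target, σ x b ≠ 0
  nullSpace_eq_bot : ∀ x, nullSpace (σ x) (chartAt G x x) = ⊥
  ker_le : ∀ i j p, p ∈ (chartAt G i).source → p ∈ (chartAt G j).source → ∀ v,
    chartPullback σ i p v = 0 → chartPullback σ j p v = 0

namespace IsContactAtlas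

variable {σ : X → G → G →L[ℂ] ℂ} (h : IsContactAtlas σ)

include h

theorem exists_chartPullback_ne_zero {i p : X} (hp : p ∈ (chartAt G i).source) :
    ∃ v, chartPullback σ i p v ≠ 0 := by
  by_contra! h0
  refine h.ne_zero i _ ((chartAt G i).map_source hp) ?_
  obtain ⟨b, hb, rfl⟩ : ∃ b ∈ (chartAt G i).target, (chartAt G i).symm b = p :=
    ⟨_, (chartAt G i).map_source hp, (chartAt G i).left_inv hp⟩
  ext u
  have h1 := h0 (mfderiv 𝓘(ℂ, G) 𝓘(ℂ, G) (chartAt G i).symm b u)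
  have h2 : chartPullback σ i ((chartAt G i).symm b)
      (mfderiv 𝓘(ℂ, G) 𝓘(ℂ, G) (chartAt G i).symm b u) =
        σ i (chartAt G i ((chartAt G i).symm b)) u :=
    congrArg (σ i (chartAt G i ((chartAt G i).symm b)))
      ((isAnalyticChart_chartAt i).mfderiv_mfderiv_symm hb u)
  exact h2.symm.trans h1

/-- A functional that vanishes on the kernel of a nonzero functional is a multiple of it. -/
theorem exists_ratio {i j p : X} (hi : p ∈ (chartAt G i).source) (hj : p ∈ (chartAt G j).source) :
    ∃ c : ℂ, ∀ v, chartPullback σ j p v = c * chartPullback σ i p v := by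
  obtain ⟨w, hw⟩ := h.exists_chartPullback_ne_zero hi
  refine ⟨chartPullback σ j p w / chartPullback σ i p w, fun v => ?_⟩
  have h1 := h.ker_le i j p hi hj
    (v - (chartPullback σ i p v / chartPullback σ i p w) • w) (by
      rw [map_sub, map_smul, smul_eq_mul, div_mul_cancel₀ _ hw, sub_self])
  rw [map_sub, map_smul, smul_eq_mul, sub_eq_zero] at h1
  rw [h1]
  ring

omit h in
open Classical in
/-- The factor between the 1-forms of two charts. -/
noncomputable def ratio (σ : X → G → G →L[ℂ] ℂ) (i j p : X) : ℂ :=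
  if hc : ∃ c : ℂ, ∀ v, chartPullback σ j p v = c * chartPullback σ i p v then hc.choose else 0

theorem ratio_mul {i j p : X} (hi : p ∈ (chartAt G i).source) (hj : p ∈ (chartAt G j).source)
    (v : TangentSpace 𝓘(ℂ, G) p) :
    ratio σ i j p * chartPullback σ i p v = chartPullback σ j p v := by
  have hc := h.exists_ratio hi hj
  have h1 : ratio σ i j p = hc.choose := dif_pos hc
  rw [h1]
  exact (hc.choose_spec v).symm

theorem ratio_self {i p : X} (hi : p ∈ (chartAt G i).source) : ratio σ i i p = 1 := by
  obtain ⟨w, hw⟩ := h.exists_chartPullback_ne_zero hi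
  have := h.ratio_mul hi hi w
  exact mul_right_cancel₀ hw (this.trans (one_mul _).symm)

theorem ratio_comp {i j l p : X} (hi : p ∈ (chartAt G i).source) (hj : p ∈ (chartAt G j).source)
    (hl : p ∈ (chartAt G l).source) : ratio σ j l p * ratio σ i j p = ratio σ i l p := by
  obtain ⟨w, hw⟩ := h.exists_chartPullback_ne_zero hi
  refine mul_right_cancel₀ hw ?_
  rw [mul_assoc, h.ratio_mul hi hj, h.ratio_mul hj hl, h.ratio_mul hi hl]

/-- Evaluated on a constant chart vector `a` with `σ i b a ≠ 0`, the ratio is a quotient of analytic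
functions. -/
theorem contMDiffAt_ratio {i j p : X} (hi : p ∈ (chartAt G i).source)
    (hj : p ∈ (chartAt G j).source) :
    ContMDiffAt 𝓘(ℂ, G) 𝓘(ℂ, ℂ) ω (ratio σ i j) p := by
  have hei := isAnalyticChart_chartAt (E := G) i
  have hej := isAnalyticChart_chartAt (E := G) j
  obtain ⟨b, hb, rfl⟩ : ∃ b ∈ (chartAt G i).target, (chartAt G i).symm b = p :=
    ⟨_, (chartAt G i).map_source hi, (chartAt G i).left_inv hi⟩
  obtain ⟨a, ha⟩ : ∃ a, σ i b a ≠ 0 := by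
    by_contra! h0
    exact h.ne_zero i b hb (by ext v; simpa using h0 v)
  let t : G → G := chartAt G j ∘ (chartAt G i).symm
  have ht : ContDiffAt ℂ ω t b := ContMDiffAt.contDiffAt_comp_symm hei hb (hej.contMDiffAt hj)
  let r : G → ℂ := fun b' => σ j (t b') (fderiv ℂ t b' a) / σ i b' a
  have hr : ContDiffAt ℂ ω r b := by
    refine ContDiffAt.div ?_ ((h.contDiffAt i b hb).clm_apply contDiffAt_const) ha
    have h1 : ContDiffAt ℂ ω (σ j) (t b) := h.contDiffAt j _ ((chartAt G j).map_source hj)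
    exact (h1.comp b ht).clm_apply ((ht.fderiv_right (m := ω) (by simp)).clm_apply contDiffAt_const)
  have h2 : ContMDiffAt 𝓘(ℂ, G) 𝓘(ℂ, ℂ) ω (r ∘ chartAt G i) ((chartAt G i).symm b) :=
    ContMDiffAt.comp (I' := 𝓘(ℂ, G)) _ (by rw [(chartAt G i).right_inv hb]; exact hr.contMDiffAt)
      (hei.contMDiffAt hi)
  refine h2.congr_of_eventuallyEq ?_
  filter_upwards [(chartAt G i).open_source.mem_nhds hi, (chartAt G j).open_source.mem_nhds hj,
    (IsAnalyticChart.tendsto hb).eventually (((h.contDiffAt i b hb).clm_apply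
      (contDiffAt_const (c := a))).continuousAt.eventually_ne ha)] with z hzi hzj hza
  obtain ⟨b', hb', rfl⟩ : ∃ b ∈ (chartAt G i).target, (chartAt G i).symm b = z :=
    ⟨_, (chartAt G i).map_source hzi, (chartAt G i).left_inv hzi⟩
  rw [(chartAt G i).right_inv hb'] at hza
  have h3 := h.ratio_mul hzi hzj (mfderiv 𝓘(ℂ, G) 𝓘(ℂ, G) (chartAt G i).symm b' a)
  have h4 : chartPullback σ i ((chartAt G i).symm b')
      (mfderiv 𝓘(ℂ, G) 𝓘(ℂ, G) (chartAt G i).symm b' a) = σ i b' a := by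
    have h5 : chartPullback σ i ((chartAt G i).symm b')
        (mfderiv 𝓘(ℂ, G) 𝓘(ℂ, G) (chartAt G i).symm b' a) =
          σ i (chartAt G i ((chartAt G i).symm b')) a :=
      congrArg (σ i (chartAt G i ((chartAt G i).symm b'))) (hei.mfderiv_mfderiv_symm hb' a)
    rwa [(chartAt G i).right_inv hb'] at h5
  have h5 : chartPullback σ j ((chartAt G i).symm b')
      (mfderiv 𝓘(ℂ, G) 𝓘(ℂ, G) (chartAt G i).symm b' a) = σ j (t b') (fderiv ℂ t b' a) :=
    congrArg (σ j (t b')) (fderiv_comp_symm_apply hei hb'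
      ((hej.contMDiffAt hzj).mdifferentiableAt (by simp)) a).symm
  rw [h4, h5] at h3
  rw [Function.comp_apply, (chartAt G i).right_inv hb']
  exact eq_div_of_mul_eq hza h3

/-- The line bundle of a contact atlas. -/
@[simps]
noncomputable def lineBundleCore : VectorBundleCore ℂ X ℂ X where
  baseSet i := (chartAt G i).source
  isOpen_baseSet i := (chartAt G i).open_source
  indexAt x := x
  mem_baseSet_at x := mem_chart_source G x
  coordChange i j p := ratio σ i j p • ContinuousLinearMap.id ℂ ℂ
  coordChange_self i p hp v := by simp [h.ratio_self hp]
  continuousOn_coordChange i j := fun p hp =>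
    ((h.contMDiffAt_ratio hp.1 hp.2).continuousAt.smul continuousAt_const).continuousWithinAt
  coordChange_comp i j l p hp v := by
    simp [← h.ratio_comp hp.1.1 hp.1.2 hp.2, mul_assoc]

theorem isContMDiff_lineBundleCore : h.lineBundleCore.IsContMDiff 𝓘(ℂ, G) ω :=
  ⟨fun _ _ _ hp => ((h.contMDiffAt_ratio hp.1 hp.2).smul contMDiffAt_const).contMDiffWithinAt⟩

/-- The contact form of a contact atlas. -/
noncomputable def contactForm (x : X) :
    TangentSpace 𝓘(ℂ, G) x →L[ℂ] h.lineBundleCore.Fiber x :=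
  chartPullback σ x x

/-- The coordinate change from index `p` to index `x` multiplies by the ratio, which turns the form
of the chart at `p` into that of the chart at `x`. So the glued form, read at `x`, is `σ x`
throughout the chart, and its derivative is that of `σ x`. -/
theorem continuousLinearMapAt_contactForm {x p : X} (hp : p ∈ (chartAt G x).source)
    (v : TangentSpace 𝓘(ℂ, G) p) :
    (trivializationAt ℂ h.lineBundleCore.Fiber x).continuousLinearMapAt ℂ p (h.contactForm p v) =
      chartPullback σ x p v := by
  have h1 := h.lineBundleCore.trivializationAt_continuousLinearMapAt (b₀ := x) (b := p) hp
  refine (DFunLike.congr_fun h1 (h.contactForm p v)).trans ?_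
  exact h.ratio_mul (mem_chart_source G p) hp v

theorem localForm_contactForm {x : X} {b : G} (hb : b ∈ (chartAt G x).target) :
    localForm h.contactForm x b = σ x b := by
  have he := isAnalyticChart_chartAt (E := G) x
  ext v
  have h1 := h.continuousLinearMapAt_contactForm ((chartAt G x).map_target hb)
    (mfderiv 𝓘(ℂ, G) 𝓘(ℂ, G) (chartAt G x).symm b v)
  have h2 : localForm h.contactForm x b v = chartPullback σ x ((chartAt G x).symm b)
    (mfderiv 𝓘(ℂ, G) 𝓘(ℂ, G) (chartAt G x).symm b v) := h1
  have h3 : chartPullback σ x ((chartAt G x).symm b)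
      (mfderiv 𝓘(ℂ, G) 𝓘(ℂ, G) (chartAt G x).symm b v) =
        σ x (chartAt G x ((chartAt G x).symm b)) v :=
    congrArg (σ x (chartAt G x ((chartAt G x).symm b))) (he.mfderiv_mfderiv_symm hb v)
  rw [h2, h3, (chartAt G x).right_inv hb]

instance (x : X) : IsTopologicalAddGroup (h.lineBundleCore.Fiber x) :=
  inferInstanceAs (IsTopologicalAddGroup ℂ)

instance (x : X) : ContinuousSMul ℂ (h.lineBundleCore.Fiber x) :=
  inferInstanceAs (ContinuousSMul ℂ ℂ)

theorem isContactForm_contactForm : IsContactForm h.contactForm := by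
  refine ⟨⟨?_, ?_⟩, ?_⟩
  · intro x
    have he := isAnalyticChart_chartAt (E := G) x
    refine contMDiffAt_form_iff.2 ?_
    have h1 : ContMDiffAt 𝓘(ℂ, G) 𝓘(ℂ, G →L[ℂ] ℂ) ω (σ x ∘ chartAt G x) x :=
      ContMDiffAt.comp (I' := 𝓘(ℂ, G)) x (h.contDiffAt x _ (mem_chart_target G x)).contMDiffAt
        (he.contMDiffAt (mem_chart_source G x))
    refine h1.congr_of_eventuallyEq ?_
    filter_upwards [(chartAt G x).open_source.mem_nhds (mem_chart_source G x)] with p hp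
    obtain ⟨b, hb, rfl⟩ : ∃ b ∈ (chartAt G x).target, (chartAt G x).symm b = p :=
      ⟨_, (chartAt G x).map_source hp, (chartAt G x).left_inv hp⟩
    ext u
    have h2 := inCoordinates_apply_mfderiv (ϑ := h.contactForm) hp
      (mfderiv 𝓘(ℂ, G) 𝓘(ℂ, G) (chartAt G x).symm b u)
    rw [h.continuousLinearMapAt_contactForm hp] at h2
    have h3 := he.mfderiv_mfderiv_symm hb u
    rw [h3] at h2
    refine h2.trans ?_
    exact congrArg (σ x (chartAt G x ((chartAt G x).symm b))) h3
  · intro x a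
    obtain ⟨w, hw⟩ := h.exists_chartPullback_ne_zero (mem_chart_source G x)
    refine ⟨((show ℂ from a) / chartPullback σ x x w) • w, ?_⟩
    have h1 : chartPullback σ x x (((show ℂ from a) / chartPullback σ x x w) • w) =
        (show ℂ from a) := by
      rw [map_smul, smul_eq_mul, div_mul_cancel₀ _ hw]
    exact h1
  · intro x v hv hall
    have he := isAnalyticChart_chartAt (E := G) x
    have hx := mem_chart_source G x
    have hfd : fderiv ℂ (localForm h.contactForm x) (extChartAt 𝓘(ℂ, G) x x) =
        fderiv ℂ (σ x) (chartAt G x x) := by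
      refine Filter.EventuallyEq.fderiv_eq ?_
      filter_upwards [(chartAt G x).open_target.mem_nhds (mem_chart_target G x)] with b hb
      exact h.localForm_contactForm hb
    have hbij : Function.Bijective (mfderiv 𝓘(ℂ, G) 𝓘(ℂ, G) (chartAt G x) x) :=
      he.mdifferentiable.mfderiv_bijective hx
    have hnull : (mfderiv 𝓘(ℂ, G) 𝓘(ℂ, G) (chartAt G x) x v : G) ∈
        nullSpace (σ x) (chartAt G x x) := by
      refine ⟨hv, fun u hu => ?_⟩
      obtain ⟨w, rfl⟩ := hbij.2 u
      have h1 := hall w hu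
      have hb : x ∈ (trivializationAt ℂ h.lineBundleCore.Fiber x).baseSet := hx
      let A : G →L[ℂ] G →L[ℂ] ℂ :=
        fderiv ℂ (localForm h.contactForm x) (extChartAt 𝓘(ℂ, G) x x)
      let w' : G := mfderiv 𝓘(ℂ, G) 𝓘(ℂ, G) (chartAt G x) x w
      let v' : G := mfderiv 𝓘(ℂ, G) 𝓘(ℂ, G) (chartAt G x) x v
      have h2 : dForm h.contactForm x w v =
        (trivializationAt ℂ h.lineBundleCore.Fiber x).symmL ℂ x (A w' v' - A v' w') := by
        rw [Bundle.Trivialization.symmL_apply _ hb]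
        rfl
      have h3 : A w' v' - A v' w' = 0 := by
        rw [← (trivializationAt ℂ h.lineBundleCore.Fiber x).continuousLinearMapAt_symmL (R := ℂ)
          hb (A w' v' - A v' w'), ← h2, h1, map_zero]
      simp only [A, hfd] at h3
      exact sub_eq_zero.1 h3
    rw [h.nullSpace_eq_bot x] at hnull
    exact hbij.1 (hnull.trans (map_zero (mfderiv 𝓘(ℂ, G) 𝓘(ℂ, G) (chartAt G x) x)).symm)

theorem exists_isContactStructure : ∃ D : ∀ x : X, Submodule ℂ (TangentSpace 𝓘(ℂ, G) x),
    IsContactStructure D ∧ ∀ x v, v ∈ D x ↔ chartPullback σ x x v = 0 := by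
  have := h.isContMDiff_lineBundleCore
  exact ⟨fun x => kerForm h.contactForm x, ⟨h.lineBundleCore.Fiber, inferInstance, inferInstance,
    inferInstance, inferInstance, inferInstance, inferInstance, inferInstance, inferInstance, inferInstance,
    h.contactForm,
    h.isContactForm_contactForm, fun _ => rfl⟩, fun _ _ => Iff.rfl⟩

end IsContactAtlas

end ContactAtlas

/-! ### The quotient map and the contact structure of the leaf space -/

section LeafSpace

set_option linter.unusedSectionVars false

variable {E : Type*} [NormedAddCommGroup E] [NormedSpace ℂ E] [FiniteDimensional ℂ E]
  {M : Type*} [TopologicalSpace M] [ChartedSpace E M] [IsManifold 𝓘(ℂ, E) ω M]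
  {G : Type*} [NormedAddCommGroup G] [NormedSpace ℂ G] [FiniteDimensional ℂ G]
  {F : Type*} [NormedAddCommGroup F] [NormedSpace ℂ F] [FiniteDimensional ℂ F]
  {D : ∀ y : M, Submodule ℂ (TangentSpace 𝓘(ℂ, E) y)}
  {O : TopologicalSpace.Opens M} {R : Setoid O}

namespace IsNullRelation

variable (hR : IsNullRelation G D R)
    (hk : ∀ y, Module.finrank ℂ (leviNull D y) = Module.finrank ℂ F)
    (hdim : Module.finrank ℂ G + Module.finrank ℂ F = Module.finrank ℂ E)

theorem mdifferentiableAt_subtypeVal (y : O) :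
    MDifferentiableAt 𝓘(ℂ, E) 𝓘(ℂ, E) (Subtype.val : O → M) y :=
  (contMDiff_subtype_val (n := ω)).contMDiffAt.mdifferentiableAt (by simp)

include hR hk hdim

theorem chart_comp_mk (x : Quotient R) :
    hR.chart hk hdim x ∘ Quotient.mk R = hR.coord hk hdim x ∘ Subtype.val :=
  funext fun y => (hR.coord_val hk hdim x y).symm

theorem mfderiv_coord_val (x : Quotient R) {y : O}
    (hy : Quotient.mk R y ∈ (hR.chart hk hdim x).source) (v : TangentSpace 𝓘(ℂ, E) y) :
    mfderiv 𝓘(ℂ, E) 𝓘(ℂ, G) (hR.coord hk hdim x ∘ Subtype.val) y v =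
      mfderiv 𝓘(ℂ, E) 𝓘(ℂ, G) (hR.coord hk hdim x) (y : M)
        (mfderiv 𝓘(ℂ, E) 𝓘(ℂ, E) (Subtype.val : O → M) y v) := by
  rw [mfderiv_comp y (hR.isLocalModel_coord hk hdim x hy).mdifferentiableAt
    (mdifferentiableAt_subtypeVal y)]
  rfl

theorem isSubmersionOfComplement_mk :
    letI := hR.chartedSpace hk hdim
    IsSubmersionOfComplement F 𝓘(ℂ, E) 𝓘(ℂ, G) ω (Quotient.mk R) := by
  let _ := hR.chartedSpace hk hdim
  have := hR.isManifold hk hdim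
  intro y
  have hy : Quotient.mk R y ∈ (hR.chart hk hdim (Quotient.mk R y)).source :=
    hR.mem_chart_source hk hdim _
  have h1 := hR.isLocalModel_coord hk hdim _ hy
  refine isSubmersionAtOfComplement_of_surjective (c := hR.chart hk hdim (Quotient.mk R y))
    continuous_quot_mk.continuousAt (IsManifold.chart_mem_maximalAtlas (Quotient.mk R y)) hy ?_ ?_
    hdim
  · rw [hR.chart_comp_mk hk hdim]
    exact ContMDiffAt.comp (I' := 𝓘(ℂ, E)) y h1.contMDiffAt contMDiff_subtype_val.contMDiffAt
  · intro w
    obtain ⟨v, hv⟩ := h1.surjective F (hk _) hdim w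
    obtain ⟨u, rfl⟩ := (bijective_mfderiv_subtypeVal O y).2 v
    refine ⟨u, ?_⟩
    rw [hR.chart_comp_mk hk hdim]
    exact (hR.mfderiv_coord_val hk hdim _ hy u).trans hv

theorem mfderiv_chart_mfderiv_mk (x : Quotient R) {y : O}
    (hy : Quotient.mk R y ∈ (hR.chart hk hdim x).source) (v : TangentSpace 𝓘(ℂ, E) y) :
    letI := hR.chartedSpace hk hdim
    mfderiv 𝓘(ℂ, G) 𝓘(ℂ, G) (hR.chart hk hdim x) (Quotient.mk R y)
        (mfderiv 𝓘(ℂ, E) 𝓘(ℂ, G) (Quotient.mk R) y v) =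
      mfderiv 𝓘(ℂ, E) 𝓘(ℂ, G) (hR.coord hk hdim x) (y : M)
        (mfderiv 𝓘(ℂ, E) 𝓘(ℂ, E) (Subtype.val : O → M) y v) := by
  let _ := hR.chartedSpace hk hdim
  have := hR.isManifold hk hdim
  have he : IsAnalyticChart (E := G) (hR.chart hk hdim x) := isAnalyticChart_chartAt x
  rw [← hR.mfderiv_coord_val hk hdim x hy, ← hR.chart_comp_mk hk hdim, mfderiv_comp y
    ((he.contMDiffAt hy).mdifferentiableAt (by simp))
    ((hR.isSubmersionOfComplement_mk hk hdim).contMDiff.contMDiffAt.mdifferentiableAt (by simp))]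
  rfl

/-- A chart composed with the quotient map is a local model, whose `mem_iff` describes `D`. -/
theorem chartPullback_mfderiv_mk (x : Quotient R) {y : O}
    (hy : Quotient.mk R y ∈ (hR.chart hk hdim x).source) (v : TangentSpace 𝓘(ℂ, E) y) :
    letI := hR.chartedSpace hk hdim
    chartPullback (hR.form hk hdim) x (Quotient.mk R y)
        (mfderiv 𝓘(ℂ, E) 𝓘(ℂ, G) (Quotient.mk R) y v) = 0 ↔
      mfderiv 𝓘(ℂ, E) 𝓘(ℂ, E) (Subtype.val : O → M) y v ∈ D y := by
  let _ := hR.chartedSpace hk hdim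
  refine Iff.trans (Eq.congr_left ?_)
    ((hR.isLocalModel_coord hk hdim x hy).mem_iff.self_of_nhds _).symm
  exact (congrArg (hR.form hk hdim x (hR.chart hk hdim x (Quotient.mk R y)))
    (hR.mfderiv_chart_mfderiv_mk hk hdim x hy v)).trans
    (congrArg (fun b => hR.form hk hdim x b (mfderiv 𝓘(ℂ, E) 𝓘(ℂ, G) (hR.coord hk hdim x) (y : M)
      (mfderiv 𝓘(ℂ, E) 𝓘(ℂ, E) (Subtype.val : O → M) y v))) (hR.coord_val hk hdim x y).symm)

theorem surjective_mfderiv_mk (y : O) :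
    letI := hR.chartedSpace hk hdim
    Function.Surjective (mfderiv 𝓘(ℂ, E) 𝓘(ℂ, G) (Quotient.mk R) y) := by
  let _ := hR.chartedSpace hk hdim
  have := hR.isManifold hk hdim
  intro w
  have hy : Quotient.mk R y ∈ (hR.chart hk hdim (Quotient.mk R y)).source :=
    hR.mem_chart_source hk hdim _
  have h1 := hR.isLocalModel_coord hk hdim _ hy
  have he : IsAnalyticChart (E := G) (hR.chart hk hdim (Quotient.mk R y)) :=
    isAnalyticChart_chartAt (Quotient.mk R y)
  obtain ⟨v, hv⟩ := h1.surjective F (hk _) hdim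
    (mfderiv 𝓘(ℂ, G) 𝓘(ℂ, G) (hR.chart hk hdim (Quotient.mk R y)) (Quotient.mk R y) w)
  obtain ⟨u, rfl⟩ := (bijective_mfderiv_subtypeVal O y).2 v
  exact ⟨u, (he.mdifferentiable.mfderiv_bijective hy).1
    ((hR.mfderiv_chart_mfderiv_mk hk hdim _ hy u).trans hv)⟩

theorem mfderiv_mk_eq_zero_iff (y : O) (v : TangentSpace 𝓘(ℂ, E) y) :
    letI := hR.chartedSpace hk hdim
    mfderiv 𝓘(ℂ, E) 𝓘(ℂ, G) (Quotient.mk R) y v = 0 ↔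
      mfderiv 𝓘(ℂ, E) 𝓘(ℂ, E) (Subtype.val : O → M) y v ∈ leviNull D y := by
  let _ := hR.chartedSpace hk hdim
  have := hR.isManifold hk hdim
  have hy : Quotient.mk R y ∈ (hR.chart hk hdim (Quotient.mk R y)).source :=
    hR.mem_chart_source hk hdim _
  have he : IsAnalyticChart (E := G) (hR.chart hk hdim (Quotient.mk R y)) :=
    isAnalyticChart_chartAt (Quotient.mk R y)
  rw [← (hR.isLocalModel_coord hk hdim _ hy).ker.self_of_nhds,
    ← hR.mfderiv_chart_mfderiv_mk hk hdim _ hy]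
  constructor
  · intro h
    rw [h]
    exact map_zero (mfderiv 𝓘(ℂ, G) 𝓘(ℂ, G) (hR.chart hk hdim (Quotient.mk R y)) (Quotient.mk R y))
  · intro h
    exact (he.mdifferentiable.mfderiv_bijective hy).1 (h.trans (map_zero
      (mfderiv 𝓘(ℂ, G) 𝓘(ℂ, G) (hR.chart hk hdim (Quotient.mk R y)) (Quotient.mk R y))).symm)

/-- Each form is the `σ` of local models at all points over its chart, hence contact there. The
kernels of two such forms agree because both pull back to `D` under the quotient map, whose
derivative is surjective. -/
theorem isContactAtlas_form (hD : HasLocalForms D E) :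
    letI := hR.chartedSpace hk hdim
    IsContactAtlas (hR.form hk hdim) := by
  let _ := hR.chartedSpace hk hdim
  have := hR.isManifold hk hdim
  have hmodel (x : Quotient R) (b : G) (hb : b ∈ (hR.chart hk hdim x).target) :
      ContDiffAt ℂ ω (hR.form hk hdim x) b ∧ hR.form hk hdim x b ≠ 0 ∧
        nullSpace (hR.form hk hdim x) b = ⊥ := by
    obtain ⟨y, hy⟩ := Quotient.mk_surjective ((hR.chart hk hdim x).symm b)
    have hys : Quotient.mk R y ∈ (hR.chart hk hdim x).source := by
      rw [hy]; exact (hR.chart hk hdim x).map_target hb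
    have hyb : hR.coord hk hdim x y = b := by
      rw [hR.coord_val hk hdim, hy, (hR.chart hk hdim x).right_inv hb]
    have h1 := hR.isLocalModel_coord hk hdim x hys
    have h2 := h1.nondegenerate F (hD.ne_top y) (hk y) hdim
    have h3 := h1.contDiffAt
    rw [hyb] at h2 h3
    exact ⟨h3, h2⟩
  refine ⟨fun x b hb => (hmodel x b hb).1, fun x b hb => (hmodel x b hb).2.1,
    fun x => (hmodel x _ (mem_chart_target G x)).2.2, fun i j p hi hj v hv => ?_⟩
  obtain ⟨y, rfl⟩ := Quotient.mk_surjective p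
  obtain ⟨w, rfl⟩ := hR.surjective_mfderiv_mk hk hdim y v
  exact (hR.chartPullback_mfderiv_mk hk hdim j hj w).2
    ((hR.chartPullback_mfderiv_mk hk hdim i hi w).1 hv)

end IsNullRelation

end LeafSpace

/-! ### Assembly of the theorem -/

/-- As `N ∩ TZ = 0`, a first integral has injective derivative along `Z` and is locally injective on
it. Since `ι` is an embedding, this is local injectivity on the compact set `Set.range ι` in the
topology of `M`, as the construction of the relation requires. -/
theorem exists_isNullRelation
    {E : Type*} [NormedAddCommGroup E] [NormedSpace ℂ E] [FiniteDimensional ℂ E]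
    {M : Type*} [TopologicalSpace M] [T2Space M] [ChartedSpace E M] [IsManifold 𝓘(ℂ, E) ω M]
    {G : Type*} [NormedAddCommGroup G] [NormedSpace ℂ G] [FiniteDimensional ℂ G]
    {F : Type*} [NormedAddCommGroup F] [NormedSpace ℂ F] [FiniteDimensional ℂ F]
    {B : Type*} [NormedAddCommGroup B] [NormedSpace ℂ B] [FiniteDimensional ℂ B]
    {Z : Type*} [TopologicalSpace Z] [CompactSpace Z] [ChartedSpace B Z] [IsManifold 𝓘(ℂ, B) ω Z]
    {D : ∀ y : M, Submodule ℂ (TangentSpace 𝓘(ℂ, E) y)}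
    (hD : ∀ y, ∃ (f : M → G) (σ : G → G →L[ℂ] ℂ), IsLocalModel D f σ y)
    (hk : ∀ y, Module.finrank ℂ (leviNull D y) = Module.finrank ℂ F)
    (hdim : Module.finrank ℂ G + Module.finrank ℂ F = Module.finrank ℂ E)
    {ι : Z → M} (hι : IsSmoothEmbedding 𝓘(ℂ, B) 𝓘(ℂ, E) ω ι)
    (hZ : ∀ z : Z, leviNull D (ι z) ⊓
      LinearMap.range (mfderiv 𝓘(ℂ, B) 𝓘(ℂ, E) ι z).toLinearMap = ⊥) :
    ∃ (O : TopologicalSpace.Opens M) (C : Set M) (R : Setoid O), Set.range ι ⊆ (O : Set M) ∧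
      IsCompact C ∧ (O : Set M) ⊆ C ∧ IsClosed {p : O × O | R p.1 p.2} ∧ IsNullRelation G D R := by
  have : ProperSpace E := FiniteDimensional.proper ℂ E
  have : LocallyCompactSpace M := ChartedSpace.locallyCompactSpace E M
  obtain ⟨O, C, R, hO, hC, hOC, hcl, h⟩ := exists_setoid_of_local_fibres
    (𝓜 := (M → G) × (G → G →L[ℂ] ℂ)) (fun μ y => IsLocalModel D μ.1 μ.2 y) (fun μ => μ.1)
    (fun μ y h => h.eventually) (fun μ y h => h.contMDiffAt.continuousAt)
    (fun μ μ' y h h' => h.eventually_eq_iff F h' hk hdim)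
    (isCompact_range hι.isEmbedding.continuous) (by
      rintro _ ⟨z, rfl⟩
      obtain ⟨f, σ, hf⟩ := hD (ι z)
      obtain ⟨U, hU, hinj⟩ := exists_injOn_of_isImmersionAt (hι.isImmersion.isImmersionAt z)
        hf.contMDiffAt (fun v hv => by
          have h1 : mfderiv 𝓘(ℂ, B) 𝓘(ℂ, E) ι z v ∈ leviNull D (ι z) ⊓
              LinearMap.range (mfderiv 𝓘(ℂ, B) 𝓘(ℂ, E) ι z).toLinearMap :=
            ⟨(hf.ker.self_of_nhds _).1 hv, v, rfl⟩
          rw [hZ z] at h1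
          exact h1)
      rw [hι.isEmbedding.nhds_eq_comap] at hU
      obtain ⟨V, hV, hVU⟩ := hU
      refine ⟨(f, σ), hf, V, hV, ?_⟩
      rintro _ ⟨ha, a, rfl⟩ _ ⟨hb, b, rfl⟩ hab
      exact congrArg ι (hinj (hVU ha) (hVU hb) hab))
  refine ⟨O, C, R, hO, hC, hOC, hcl, fun y y' hyy' => ?_⟩
  obtain ⟨W, hW, h1, h2, μ, h3, h4⟩ := h y y' hyy'
  exact ⟨W, hW, h1, h2, μ.1, μ.2, h3, h4⟩

theorem lemma3p4
    -- a complex manifold `Y`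
    {E : Type*} [NormedAddCommGroup E] [NormedSpace ℂ E] [FiniteDimensional ℂ E]
    {Y : Type uY} [TopologicalSpace Y] [T2Space Y] [Nonempty Y]
    [ChartedSpace E Y] [IsManifold 𝓘(ℂ, E) ω Y]
    -- a holomorphic line bundle `L` on `Y`
    (L : Y → Type*) [TopologicalSpace (TotalSpace ℂ L)] [∀ y, TopologicalSpace (L y)]
    [∀ y, AddCommGroup (L y)] [∀ y, Module ℂ (L y)]
    [∀ y, IsTopologicalAddGroup (L y)] [∀ y, ContinuousSMul ℂ (L y)]
    [FiberBundle ℂ L] [VectorBundle ℂ ℂ L] [ContMDiffVectorBundle ω ℂ L 𝓘(ℂ, E)]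
    -- a compact complex submanifold `ι : Z ↪ Y`
    {F : Type*} [NormedAddCommGroup F] [NormedSpace ℂ F] [FiniteDimensional ℂ F]
    {Z : Type*} [TopologicalSpace Z] [CompactSpace Z]
    [ChartedSpace F Z] [IsManifold 𝓘(ℂ, F) ω Z]
    (ι : Z → Y) (hι : IsSmoothEmbedding 𝓘(ℂ, F) 𝓘(ℂ, E) ω ι)
    -- a nowhere vanishing `L`-valued form
    (ϑ : ∀ y : Y, TangentSpace 𝓘(ℂ, E) y →L[ℂ] L y) (hϑ : IsNowhereVanishingForm ϑ)
    (k : ℕ) (hk : ∀ y : Y, Module.finrank ℂ (leviNull (kerForm ϑ) y) = k)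
    (hZ : ∀ z : Z, leviNull (kerForm ϑ) (ι z) ⊓
      LinearMap.range (mfderiv 𝓘(ℂ, F) 𝓘(ℂ, E) ι z).toLinearMap = ⊥) :
    ∃ (O : TopologicalSpace.Opens Y), Set.range ι ⊆ (O : Set Y) ∧
      ∃ m : ℕ, m + k = Module.finrank ℂ E ∧
      -- a complex manifold `X` of dimension `m`
      ∃ (X : Type uY) (_ : TopologicalSpace X) (_ : T2Space X) (_ : SecondCountableTopology X)
        (_ : ChartedSpace (EuclideanSpace ℂ (Fin m)) X)
        (_ : IsManifold 𝓘(ℂ, EuclideanSpace ℂ (Fin m)) ω X)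
        (ν : O → X) (D : ∀ x : X, Submodule ℂ (TangentSpace 𝓘(ℂ, EuclideanSpace ℂ (Fin m)) x)),
        IsSubmersion 𝓘(ℂ, E) 𝓘(ℂ, EuclideanSpace ℂ (Fin m)) ω ν ∧ Function.Surjective ν ∧
        IsContactStructure D ∧
        ∀ y : O,
          -- `(Ker ϑ)_y = (d_y ν)⁻¹ (D_{ν y})`; the inclusion `O ⊆ Y` identifies `T_y O` with `T_y Y`
          (kerForm ϑ (y : Y)).comap
              (mfderiv 𝓘(ℂ, E) 𝓘(ℂ, E) (Subtype.val : O → Y) y).toLinearMap =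
            (D (ν y)).comap
              (mfderiv 𝓘(ℂ, E) 𝓘(ℂ, EuclideanSpace ℂ (Fin m)) ν y).toLinearMap ∧
          -- `Ker (d_y ν) = Null(Levi_y)`
          LinearMap.ker (mfderiv 𝓘(ℂ, E) 𝓘(ℂ, EuclideanSpace ℂ (Fin m)) ν y).toLinearMap =
            (leviNull (kerForm ϑ) (y : Y)).comap
              (mfderiv 𝓘(ℂ, E) 𝓘(ℂ, E) (Subtype.val : O → Y) y).toLinearMap := by
  -- A point of `Y` is needed here: only its null space bounds `k`.
  have hle : k ≤ Module.finrank ℂ E := by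
    have : FiniteDimensional ℂ (TangentSpace 𝓘(ℂ, E) (Classical.arbitrary Y)) :=
      inferInstanceAs (FiniteDimensional ℂ E)
    have h1 := Submodule.finrank_le (leviNull (kerForm ϑ) (Classical.arbitrary Y))
    rw [hk] at h1
    exact h1
  obtain ⟨m, hm⟩ : ∃ m, m + k = Module.finrank ℂ E := ⟨_, Nat.sub_add_cancel hle⟩
  -- `EuclideanSpace ℂ (Fin k)` serves as the model of the leaves and `EuclideanSpace ℂ (Fin m)` as
  -- that of the leaf space.
  have hk' (y : Y) : Module.finrank ℂ (leviNull (kerForm ϑ) y) =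
      Module.finrank ℂ (EuclideanSpace ℂ (Fin k)) := by rw [hk, finrank_euclideanSpace_fin]
  have hdim : Module.finrank ℂ (EuclideanSpace ℂ (Fin m)) +
      Module.finrank ℂ (EuclideanSpace ℂ (Fin k)) = Module.finrank ℂ E := by
    rw [finrank_euclideanSpace_fin, finrank_euclideanSpace_fin, hm]
  have hE : HasLocalForms (kerForm ϑ) E := fun Φ q => exists_representsAt_kerForm hϑ
  obtain ⟨O, C, R, hO, hC, hOC, hcl, hR⟩ := exists_isNullRelation
    (G := EuclideanSpace ℂ (Fin m)) (F := EuclideanSpace ℂ (Fin k))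
    (exists_isLocalModel hE (fun Φ q => exists_representsAt_kerForm hϑ) hk'
      (by rw [finrank_euclideanSpace_fin, hm])) hk' hdim hι hZ
  have hq := hR.isOpenQuotientMap hk' hdim
  have := secondCountableTopology_of_subset_isCompact (E := E) O hC hOC
  let _ := hR.chartedSpace hk' hdim
  have hX := hR.isManifold hk' hdim
  obtain ⟨D, hDc, hD⟩ := (hR.isContactAtlas_form hk' hdim hE).exists_isContactStructure
  refine ⟨O, hO, m, hm, Quotient R, inferInstance, hR.t2Space hk' hdim hcl,
    hq.isQuotientMap.secondCountableTopology hq.isOpenMap, hR.chartedSpace hk' hdim, hX,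
    Quotient.mk R, D, (hR.isSubmersionOfComplement_mk hk' hdim).isSubmersion, hq.surjective, hDc,
    fun y => ⟨?_, ?_⟩⟩
  · ext v
    exact ((hD _ _).trans (hR.chartPullback_mfderiv_mk hk' hdim _
      (hR.mem_chart_source hk' hdim _) v)).symm
  · ext v
    exact hR.mfderiv_mk_eq_zero_iff hk' hdim y v
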